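/- **Setting.** A commutative monoid $P$ (written additively) is *weakly toric* if it is finitely generated, cancellative, saturated (if $g\in P^{\rm gp}$, $n\ge1$, $ng\in P$, then $g\in P$) and $P^{\rm gp}$ is torsion-free; its rank is the rank of $P^{\rm gp}$. Let $X_P$ be the set of monoid morphisms $x:P\to([0,\infty),\cdot)$, with the weakest topology for which all $\lambda_p:X_P\to[0,\infty)$, $\lambda_p(x)=x(p)$, are continuous, and let $X_P^\circ$ be the set of $x$ with values in $(0,\infty)$. For $U\subseteq X_P$ open, $f:U\to\mathbb R$ is *smooth* if $f=g(\lambda_{r_1},\dots,\lambda_{r_n})$ on $U$ for some $r_1,\dots,r_n\in P$ and some $C^\infty$ function $g$ on an open subset of $\mathbb R^n$ containing the image of $U$ under $(\lambda_{r_1},\dots,\lambda_{r_n})$; and $f:U\to[0,\infty)$ is *smooth* if near each point of $U$ either $f=\lambda_p\cdot h$ with $p\in P$ and $h$ smooth and positive, or $f=0$. A continuous map $F:U\to V$ with $V\subseteq X_Q$ open is *smooth* if $\lambda_q\circ F$ is smooth for all $q\in Q$. A *manifold with g-corners* of dimension $n$ is a second countable Hausdorff space $X$ with a maximal atlas of charts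 $(P,U,\phi)$, where $P$ is a weakly toric monoid of rank $n$ which is a submonoid of some $\mathbb Z^k$, $U\subseteq X_P$ is open, $\phi$ is a homeomorphism of $U$ with an open subset of $X$, and all transition maps $\psi^{-1}\circ\phi$ are smooth. A map $f:X\to Y$ of manifolds with g-corners (not necessarily of the same dimension) is *smooth* if it is continuous and $\psi^{-1}\circ f\circ\phi$ is smooth, where defined, for all charts $\phi$ on $X$ and $\psi$ on $Y$; it is *interior* if it is smooth and all these maps $\psi^{-1}\circ f\circ\phi$ take points of $X_P^\circ$ to points of $X_Q^\circ$. Smoothness on open subsets of $X$, of functions to $\mathbb R$ and to $[0,\infty)$, is defined similarly using charts; a function $b$ to $[0,\infty)$ is *interior* if it is smooth and in each chart it is positive at points of $X_P^\circ$. A *diffeomorphism* is a smooth bijection with smooth inverse. A smooth map $f:X\to Y$ is *étale* if every $x\in X$ has an open neighbourhood $U$ such that $f(U)$ is open in $Y$ and $f|_U:U\to f(U)$ is a diffeomorphism. For $x\in X$, let $C^\infty_x(X)$ be the algebra of germs at $x$ of smooth functions to $\mathbb R$, and $\mathcal I_x(X)$ the multiplicative monoid of germs at $x$ of interior functions to $[0,\infty)$.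 Let $\tilde M_xX$ be the monoid of monoid morphisms $\mathcal I_x(X)\to(\mathbb N,+)$ which vanish on all $[b]$ with $b(x)>0$. Let ${}^bT_xX$ be the real vector space of pairs $(v,v')$ of a linear map $v:C^\infty_x(X)\to\mathbb R$ and a monoid morphism $v':\mathcal I_x(X)\to(\mathbb R,+)$ such that $v([a][c])=v([a])c(x)+a(x)v([c])$, $v'([e^a])=v([a])$ and $v([b])=b(x)\,v'([b])$ for all $[a],[c]\in C^\infty_x(X)$ and $[b]\in\mathcal I_x(X)$. An interior map $f:X\to Y$ induces, by composition with the pullbacks $f^*$ of germs, a monoid morphism $\tilde M_xf:\tilde M_xX\to\tilde M_{f(x)}Y$ and a linear map ${}^b\mathrm df|_x:{}^bT_xX\to{}^bT_{f(x)}Y$. The map $f$ is *simple* if it is interior and $\tilde M_xf$ is an isomorphism for all $x\in X$. The spaces ${}^bT_xX$ are the fibres of a vector bundle ${}^bTX\to X$, and ${}^bT_{f(x)}Y$ those of its pullback $f^*({}^bTY)\to X$; a local section $x\mapsto s(x)\in{}^bT_{f(x)}Y$ of the latter is smooth if for every interior function $b$ on an open subset $V$ of $Y$ the function $x\mapsto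 s(x)[b]:=w'([b])$, where $s(x)=(w,w')$, is smooth where it is defined (for ${}^bTX$, take $f=\mathrm{id}_X$). The *b-differential* ${}^b\mathrm df:{}^bTX\to f^*({}^bTY)$ is an isomorphism of vector bundles if it is a linear isomorphism on every fibre and it and its inverse take smooth local sections to smooth local sections. **Statement.** Let $f:X\to Y$ be a smooth map of manifolds with g-corners. Then $f$ is étale if and only if $f$ is simple (hence interior) and ${}^b\mathrm df:{}^bTX\to f^*({}^bTY)$ is an isomorphism of vector bundles on $X$. If $f$ is étale, then $f$ is a diffeomorphism if and only if it is a bijection. -/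

import Mathlib

namespace GCorners

open Set Filter Topology
open scoped NNReal ContDiff

/-! ### Weakly toric monoids -/

/-- A commutative monoid is weakly toric if it is finitely generated, integral (cancellative),
saturated and torsion-free. -/
structure IsWeaklyToric (P : Type*) [AddCommMonoid P] : Prop where
  fg : AddMonoid.FG P
  integral : ∀ p p' p'' : P, p + p'' = p' + p'' → p = p'
  saturated : ∀ (g : Algebra.GrothendieckAddGroup P) (n : ℕ), 1 ≤ n →
    n • g ∈ Set.range (Algebra.GrothendieckAddGroup.of (M := P)) →
    g ∈ Set.range (Algebra.GrothendieckAddGroup.of (M := P))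
  torsion_free : ∀ (g : Algebra.GrothendieckAddGroup P) (n : ℕ), 1 ≤ n → n • g = 0 → g = 0

/-- The rank of a weakly toric monoid is the rank of its group completion. -/
noncomputable def monoidRank (P : Type*) [AddCommMonoid P] : ℕ :=
  Module.finrank ℤ (Algebra.GrothendieckAddGroup P)

/-! ### The model spaces `X_P` -/

/-- The model space `X_P`: monoid morphisms `(P, +, 0) → ([0, ∞), ·, 1)`. -/
def ModelSpace (P : Type*) [AddCommMonoid P] : Type _ := Multiplicative P →* ℝ≥0

section Model

variable {P : Type*} [AddCommMonoid P] {Q : Type*} [AddCommMonoid Q]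

/-- The function `lam p : X_P → [0, ∞)`, `x ↦ x p`. -/
def lam (p : P) (x : ModelSpace P) : ℝ≥0 :=
  (show Multiplicative P →* ℝ≥0 from x) (Multiplicative.ofAdd p)

/-- The weakest topology on `X_P` making all functions `lam p` continuous. -/
instance : TopologicalSpace (ModelSpace P) :=
  TopologicalSpace.induced (fun x p => lam p x) Pi.topologicalSpace

/-- The interior of `X_P`: the morphisms with values in `(0, ∞)`. -/
def modelInterior (P : Type*) [AddCommMonoid P] : Set (ModelSpace P) :=
  {x | ∀ p : P, 0 < lam p x}

/-- Smooth functions `f : U → ℝ` for `U ⊆ X_P` open: those of the form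
`x ↦ g (x r₁, …, x rₙ)` with `r₁, …, rₙ ∈ P` and `g` smooth. (A smooth function on an open subset
of `[0, ∞)ⁿ` is the restriction of a smooth function on an open subset `W` of `ℝⁿ`.) -/
def SmoothReal (U : Set (ModelSpace P)) (f : ModelSpace P → ℝ) : Prop :=
  ∃ (n : ℕ) (r : Fin n → P) (W : Set (Fin n → ℝ)) (g : (Fin n → ℝ) → ℝ),
    IsOpen W ∧ ContDiffOn ℝ ∞ g W ∧
    ∀ x ∈ U, (fun i => (lam (r i) x : ℝ)) ∈ W ∧ f x = g (fun i => (lam (r i) x : ℝ))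

/-- Smooth functions `f : U → [0, ∞)` for `U ⊆ X_P` open: near each point of `U`, either
`f = lam p * h` with `p ∈ P` and `h > 0` smooth, or `f = 0`. -/
def SmoothNonneg (U : Set (ModelSpace P)) (f : ModelSpace P → ℝ≥0) : Prop :=
  ∀ x ∈ U, ∃ U' : Set (ModelSpace P), IsOpen U' ∧ x ∈ U' ∧ U' ⊆ U ∧
    ((∃ (p : P) (h : ModelSpace P → ℝ), SmoothReal U' h ∧
        ∀ y ∈ U', 0 < h y ∧ (f y : ℝ) = (lam p y : ℝ) * h y) ∨
      ∀ y ∈ U', f y = 0)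

/-- Smooth maps `F : U → X_Q` for `U ⊆ X_P` open: `lam q ∘ F` is smooth for all `q ∈ Q`. -/
def SmoothMap (U : Set (ModelSpace P)) (F : ModelSpace P → ModelSpace Q) : Prop :=
  ∀ q : Q, SmoothNonneg U (fun x => lam q (F x))

/-! Elementary closure properties of smooth functions. -/

theorem continuous_lam (p : P) : Continuous (lam p : ModelSpace P → ℝ≥0) :=
  (continuous_apply p).comp continuous_induced_dom

theorem SmoothReal.mono {U V : Set (ModelSpace P)} {f : ModelSpace P → ℝ}
    (hf : SmoothReal V f) (h : U ⊆ V) : SmoothReal U f := by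
  obtain ⟨n, r, W, g, hW, hg, H⟩ := hf
  exact ⟨n, r, W, g, hW, hg, fun x hx => H x (h hx)⟩

theorem SmoothReal.congr {U : Set (ModelSpace P)} {f f' : ModelSpace P → ℝ}
    (hf : SmoothReal U f) (h : ∀ x ∈ U, f' x = f x) : SmoothReal U f' := by
  obtain ⟨n, r, W, g, hW, hg, H⟩ := hf
  exact ⟨n, r, W, g, hW, hg, fun x hx => ⟨(H x hx).1, (h x hx).trans (H x hx).2⟩⟩

theorem SmoothReal.of_fintype {ι : Type*} [Fintype ι] {U : Set (ModelSpace P)}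
    {f : ModelSpace P → ℝ} (r : ι → P) (W : Set (ι → ℝ)) (g : (ι → ℝ) → ℝ)
    (hW : IsOpen W) (hg : ContDiffOn ℝ ∞ g W)
    (H : ∀ x ∈ U, (fun i => (lam (r i) x : ℝ)) ∈ W ∧ f x = g (fun i => (lam (r i) x : ℝ))) :
    SmoothReal U f := by
  let e := Fintype.equivFin ι
  let L : (Fin (Fintype.card ι) → ℝ) → (ι → ℝ) := fun w i => w (e i)
  have hL : ContDiff ℝ ∞ L := contDiff_pi.2 fun i => contDiff_apply ℝ ℝ (e i)
  refine ⟨Fintype.card ι, fun j => r (e.symm j), L ⁻¹' W, g ∘ L, hW.preimage hL.continuous,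
    hg.comp hL.contDiffOn (fun _ h => h), fun x hx => ?_⟩
  have : L (fun j => (lam (r (e.symm j)) x : ℝ)) = fun i => (lam (r i) x : ℝ) := by
    funext i; simp [L]
  exact ⟨by simpa only [mem_preimage, this] using (H x hx).1,
    by simpa only [Function.comp_apply, this] using (H x hx).2⟩

/-- A smooth function of finitely many smooth functions is smooth. -/
theorem SmoothReal.comp {k : ℕ} {U : Set (ModelSpace P)} {f : Fin k → ModelSpace P → ℝ}
    (hf : ∀ i, SmoothReal U (f i)) {W : Set (Fin k → ℝ)} {g : (Fin k → ℝ) → ℝ}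
    (hW : IsOpen W) (hg : ContDiffOn ℝ ∞ g W) (hU : ∀ x ∈ U, (fun i => f i x) ∈ W) :
    SmoothReal U (fun x => g (fun i => f i x)) := by
  choose n r W' g' hW' hg' H using hf
  let π : ∀ i, ((Σ i, Fin (n i)) → ℝ) → (Fin (n i) → ℝ) := fun i w j => w ⟨i, j⟩
  have hπ : ∀ i, ContDiff ℝ ∞ (π i) := fun i => contDiff_pi.2 fun j => contDiff_apply ℝ ℝ _
  let W₀ : Set ((Σ i, Fin (n i)) → ℝ) := ⋂ i, π i ⁻¹' W' i
  have hW₀ : IsOpen W₀ := isOpen_iInter_of_finite fun i => (hW' i).preimage (hπ i).continuous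
  let G : ((Σ i, Fin (n i)) → ℝ) → (Fin k → ℝ) := fun w i => g' i (π i w)
  have hG : ContDiffOn ℝ ∞ G W₀ := contDiffOn_pi.2 fun i =>
    (hg' i).comp (hπ i).contDiffOn fun w hw => mem_iInter.1 hw i
  refine SmoothReal.of_fintype (ι := Σ i, Fin (n i)) (fun j => r j.1 j.2) (W₀ ∩ G ⁻¹' W) (g ∘ G)
    (hG.continuousOn.isOpen_inter_preimage hW₀ hW)
    (hg.comp (hG.mono inter_subset_left) fun _ h => h.2) fun x hx => ?_
  have hGx : G (fun j => (lam (r j.1 j.2) x : ℝ)) = fun i => f i x := by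
    funext i; exact ((H i x hx).2).symm
  refine ⟨⟨mem_iInter.2 fun i => (H i x hx).1, ?_⟩, ?_⟩
  · rw [mem_preimage, hGx]; exact hU x hx
  · rw [Function.comp_apply, hGx]

theorem SmoothReal.comp₁ {U : Set (ModelSpace P)} {f : ModelSpace P → ℝ} (hf : SmoothReal U f)
    {g : ℝ → ℝ} (hg : ContDiff ℝ ∞ g) : SmoothReal U (fun x => g (f x)) :=
  SmoothReal.comp (k := 1) (f := fun _ => f) (fun _ => hf) (g := fun w => g (w 0)) isOpen_univ
    (hg.comp (contDiff_apply ℝ ℝ 0)).contDiffOn fun _ _ => mem_univ _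

theorem SmoothReal.comp₂ {U : Set (ModelSpace P)} {f f' : ModelSpace P → ℝ} (hf : SmoothReal U f)
    (hf' : SmoothReal U f') {g : ℝ × ℝ → ℝ} (hg : ContDiff ℝ ∞ g) :
    SmoothReal U (fun x => g (f x, f' x)) := by
  have := SmoothReal.comp (k := 2) (f := ![f, f']) (U := U)
    (by intro i; fin_cases i <;> simpa) (g := fun w => g (w 0, w 1)) isOpen_univ
    (hg.comp ((contDiff_apply ℝ ℝ 0).prodMk (contDiff_apply ℝ ℝ 1))).contDiffOn
    fun _ _ => mem_univ _
  simpa using this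

theorem SmoothReal.add {U : Set (ModelSpace P)} {f f' : ModelSpace P → ℝ} (hf : SmoothReal U f)
    (hf' : SmoothReal U f') : SmoothReal U (fun x => f x + f' x) :=
  hf.comp₂ hf' contDiff_add

theorem SmoothReal.mul {U : Set (ModelSpace P)} {f f' : ModelSpace P → ℝ} (hf : SmoothReal U f)
    (hf' : SmoothReal U f') : SmoothReal U (fun x => f x * f' x) :=
  hf.comp₂ hf' contDiff_mul

theorem smoothReal_const (U : Set (ModelSpace P)) (c : ℝ) : SmoothReal U (fun _ => c) :=
  ⟨0, Fin.elim0, univ, fun _ => c, isOpen_univ, contDiffOn_const, fun _ _ => ⟨mem_univ _, rfl⟩⟩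

theorem smoothReal_lam (U : Set (ModelSpace P)) (p : P) : SmoothReal U (fun x => (lam p x : ℝ)) :=
  ⟨1, fun _ => p, univ, fun w => w 0, isOpen_univ, (contDiff_apply ℝ ℝ 0).contDiffOn,
    fun _ _ => ⟨mem_univ _, rfl⟩⟩

theorem lam_add (p q : P) (x : ModelSpace P) : lam (p + q) x = lam p x * lam q x :=
  map_mul (show Multiplicative P →* ℝ≥0 from x) _ _

theorem lam_zero (x : ModelSpace P) : lam (0 : P) x = 1 :=
  map_one (show Multiplicative P →* ℝ≥0 from x)

theorem SmoothNonneg.inter {U V : Set (ModelSpace P)} {f : ModelSpace P → ℝ≥0}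
    (hf : SmoothNonneg V f) (hU : IsOpen U) : SmoothNonneg (U ∩ V) f := by
  rintro x ⟨hxU, hxV⟩
  obtain ⟨U', hU', hx, hs, h⟩ := hf x hxV
  refine ⟨U ∩ U', hU.inter hU', ⟨hxU, hx⟩, inter_subset_inter_right _ hs, ?_⟩
  rcases h with ⟨p, h, hh, H⟩ | H
  · exact Or.inl ⟨p, h, hh.mono inter_subset_right, fun y hy => H y hy.2⟩
  · exact Or.inr fun y hy => H y hy.2

theorem SmoothNonneg.mul {U : Set (ModelSpace P)} {f f' : ModelSpace P → ℝ≥0}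
    (hf : SmoothNonneg U f) (hf' : SmoothNonneg U f') :
    SmoothNonneg U (fun x => f x * f' x) := by
  intro x hx
  obtain ⟨V, hV, hxV, hVU, h⟩ := hf x hx
  obtain ⟨V', hV', hxV', -, h'⟩ := hf' x hx
  refine ⟨V ∩ V', hV.inter hV', ⟨hxV, hxV'⟩, inter_subset_left.trans hVU, ?_⟩
  rcases h with ⟨p, h, hh, H⟩ | H
  · rcases h' with ⟨p', h', hh', H'⟩ | H'
    · refine Or.inl ⟨p + p', fun y => h y * h' y,
        (hh.mono inter_subset_left).mul (hh'.mono inter_subset_right), fun y hy =>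
        ⟨mul_pos (H y hy.1).1 (H' y hy.2).1, ?_⟩⟩
      rw [NNReal.coe_mul, (H y hy.1).2, (H' y hy.2).2, lam_add, NNReal.coe_mul]; ring
    · exact Or.inr fun y hy => by
        show f y * f' y = 0
        rw [H' y hy.2, mul_zero]
  · exact Or.inr fun y hy => by
      show f y * f' y = 0
      rw [H y hy.1, zero_mul]

/-- A smooth function to `[0, ∞)` is locally smooth as a function to `ℝ`. -/
theorem SmoothNonneg.toReal {U : Set (ModelSpace P)} {f : ModelSpace P → ℝ≥0}
    (hf : SmoothNonneg U f) {x : ModelSpace P} (hx : x ∈ U) :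
    ∃ U' : Set (ModelSpace P), IsOpen U' ∧ x ∈ U' ∧ U' ⊆ U ∧
      SmoothReal U' (fun y => (f y : ℝ)) := by
  obtain ⟨V, hV, hxV, hVU, h⟩ := hf x hx
  refine ⟨V, hV, hxV, hVU, ?_⟩
  rcases h with ⟨p, h, hh, H⟩ | H
  · exact ((smoothReal_lam V p).mul hh).congr fun y hy => (H y hy).2
  · exact (smoothReal_const V 0).congr fun y hy => by rw [H y hy, NNReal.coe_zero]

theorem SmoothReal.pullback {U : Set (ModelSpace P)} {V : Set (ModelSpace Q)}
    {F : ModelSpace P → ModelSpace Q} {f : ModelSpace Q → ℝ} (hF : SmoothMap U F)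
    (hf : SmoothReal V f) (hUV : ∀ y ∈ U, F y ∈ V) {x : ModelSpace P} (hx : x ∈ U) :
    ∃ U' : Set (ModelSpace P), IsOpen U' ∧ x ∈ U' ∧ U' ⊆ U ∧ SmoothReal U' (fun y => f (F y)) := by
  obtain ⟨n, r, W, g, hW, hg, H⟩ := hf
  choose V' hV' hxV' hVU' hs using fun i => (hF (r i)).toReal hx
  obtain ⟨U₀, hU₀, hxU₀, hU₀U, -⟩ := hF 0 x hx
  refine ⟨U₀ ∩ ⋂ i, V' i, hU₀.inter (isOpen_iInter_of_finite hV'), ⟨hxU₀, mem_iInter.2 hxV'⟩,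
    inter_subset_left.trans hU₀U, ?_⟩
  refine (SmoothReal.comp (f := fun i y => (lam (r i) (F y) : ℝ))
    (fun i => (hs i).mono fun y hy => mem_iInter.1 hy.2 i) hW hg
    fun y hy => (H _ (hUV y (hU₀U hy.1))).1).congr
    fun y hy => (H _ (hUV y (hU₀U hy.1))).2

theorem SmoothNonneg.pullback {U : Set (ModelSpace P)} {V : Set (ModelSpace Q)}
    {F : ModelSpace P → ModelSpace Q} {f : ModelSpace Q → ℝ≥0} (hU : IsOpen U)
    (hFc : ContinuousOn F U) (hF : SmoothMap U F) (hf : SmoothNonneg V f)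
    (hUV : ∀ y ∈ U, F y ∈ V) : SmoothNonneg U (fun y => f (F y)) := by
  intro x hx
  obtain ⟨V₁, hV₁, hxV₁, -, h⟩ := hf (F x) (hUV x hx)
  have hU₁ : IsOpen (U ∩ F ⁻¹' V₁) := hFc.isOpen_inter_preimage hU hV₁
  rcases h with ⟨q, h, hh, H⟩ | H
  · have hF₁ : SmoothMap (U ∩ F ⁻¹' V₁) F := fun q => by
      have := (hF q).inter hU₁
      rwa [inter_eq_left.2 inter_subset_left] at this
    obtain ⟨U₂, hU₂, hxU₂, hs₂, hr⟩ := hh.pullback hF₁ (fun y hy => hy.2) ⟨hx, hxV₁⟩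
    obtain ⟨U₃, hU₃, hxU₃, -, h₃⟩ := hF q x hx
    refine ⟨U₂ ∩ U₃, hU₂.inter hU₃, ⟨hxU₂, hxU₃⟩, fun y hy => (hs₂ hy.1).1, ?_⟩
    rcases h₃ with ⟨p, k, hk, K⟩ | K
    · refine Or.inl ⟨p, fun y => k y * h (F y),
        (hk.mono inter_subset_right).mul (hr.mono inter_subset_left), fun y hy => ?_⟩
      have hy₁ := H (F y) (hs₂ hy.1).2
      refine ⟨mul_pos (K y hy.2).1 hy₁.1, ?_⟩
      rw [hy₁.2, (K y hy.2).2]; ring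
    · refine Or.inr fun y hy => ?_
      have hy₁ := (H (F y) (hs₂ hy.1).2).2
      have hK : lam q (F y) = 0 := K y hy.2
      rw [hK, NNReal.coe_zero, zero_mul] at hy₁
      exact NNReal.coe_eq_zero.1 hy₁
  · exact ⟨U ∩ F ⁻¹' V₁, hU₁, ⟨hx, hxV₁⟩, inter_subset_left, Or.inr fun y hy => H _ hy.2⟩

end Model

/-! ### Manifolds with g-corners -/

/-- An `n`-dimensional g-chart `(P, U, φ)` on `X`: a weakly toric monoid `P` of rank `n` which is a
submonoid of some `ℤ^k`, and a homeomorphism `φ` from an open set `U = φ.source` of `X_P` to an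
open set `φ.target` of `X`. -/
structure GChart (n : ℕ) (X : Type*) [TopologicalSpace X] where
  k : ℕ
  P : AddSubmonoid (Fin k → ℤ)
  weaklyToric : IsWeaklyToric P
  rank_eq : monoidRank P = n
  φ : OpenPartialHomeomorph (ModelSpace P) X

/-- Compatibility of g-charts: the homeomorphism `ψ⁻¹ ∘ φ : φ⁻¹(φ(U) ∩ ψ(V)) → ψ⁻¹(φ(U) ∩ ψ(V))`
and its inverse are smooth. -/
def GChart.Compatible {n : ℕ} {X : Type*} [TopologicalSpace X] (c d : GChart n X) : Prop :=
  SmoothMap (c.φ.source ∩ c.φ ⁻¹' d.φ.target) (fun u => d.φ.symm (c.φ u)) ∧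
    SmoothMap (d.φ.source ∩ d.φ ⁻¹' c.φ.target) (fun u => c.φ.symm (d.φ u))

/-- A manifold with g-corners: a second countable Hausdorff space with a maximal `n`-dimensional
g-atlas. -/
class ManifoldWithGCorners (X : Type*) [TopologicalSpace X] : Type _
    extends T2Space X, SecondCountableTopology X where
  dim : ℕ
  atlas : Set (GChart dim X)
  covers : ∀ x : X, ∃ c ∈ atlas, x ∈ c.φ.target
  compatible : ∀ c ∈ atlas, ∀ d ∈ atlas, c.Compatible d
  maximal : ∀ c : GChart dim X, (∀ d ∈ atlas, c.Compatible d) → c ∈ atlas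

/-- The g-charts of a manifold with g-corners: the elements of the maximal g-atlas. -/
abbrev gAtlas (X : Type*) [TopologicalSpace X] [ManifoldWithGCorners X] :
    Set (GChart (ManifoldWithGCorners.dim X) X) :=
  ManifoldWithGCorners.atlas

section Maps

variable {X : Type*} [TopologicalSpace X] [ManifoldWithGCorners X]
  {Y : Type*} [TopologicalSpace Y] [ManifoldWithGCorners Y]

/-- Smoothness of `f` on an open subset `U` of `X`, that is, of the map `f|_U : U → Y`: it is
continuous and `ψ⁻¹ ∘ f ∘ φ` is smooth where it is defined, for all g-charts `φ, ψ` on `X, Y`. -/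
def IsSmoothOn (f : X → Y) (U : Set X) : Prop :=
  ContinuousOn f U ∧ ∀ c ∈ gAtlas X, ∀ d ∈ gAtlas Y,
    SmoothMap (c.φ.source ∩ c.φ ⁻¹' (U ∩ f ⁻¹' d.φ.target)) (fun u => d.φ.symm (f (c.φ u)))

/-- Smooth maps of manifolds with g-corners. -/
def IsSmooth (f : X → Y) : Prop := IsSmoothOn f univ

/-- Diffeomorphisms: bijections such that `f` and `f⁻¹` are smooth. -/
def IsDiffeomorphism (f : X → Y) : Prop :=
  ∃ g : Y → X, Function.LeftInverse g f ∧ Function.RightInverse g f ∧ IsSmooth f ∧ IsSmooth g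

/-- `f` restricts to a diffeomorphism from the open set `U` to the open set `V`. -/
def IsDiffeomorphismOn (f : X → Y) (U : Set X) (V : Set Y) : Prop :=
  f '' U = V ∧ IsSmoothOn f U ∧ ∃ g : Y → X, (∀ x ∈ U, g (f x) = x) ∧ IsSmoothOn g V

/-- A smooth map is étale if it is a local diffeomorphism. -/
def IsEtale (f : X → Y) : Prop :=
  IsSmooth f ∧ ∀ x : X, ∃ (U : Set X) (V : Set Y), IsOpen U ∧ x ∈ U ∧ IsOpen V ∧ f x ∈ V ∧
    IsDiffeomorphismOn f U V

/-- A map is interior if it is smooth and in all g-charts it takes the interior of the source to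
the interior of the target (equivalently, `f(X°) ⊆ Y°`). -/
def IsInterior (f : X → Y) : Prop :=
  IsSmooth f ∧ ∀ c ∈ gAtlas X, ∀ d ∈ gAtlas Y, ∀ u ∈ c.φ.source ∩ c.φ ⁻¹' (f ⁻¹' d.φ.target),
    u ∈ modelInterior c.P → d.φ.symm (f (c.φ u)) ∈ modelInterior d.P

/-! ### Germs of smooth and of interior functions -/

/-- `a : X → ℝ` is smooth on a neighbourhood of `x`. -/
def SmoothNear (a : X → ℝ) (x : X) : Prop :=
  ∀ c ∈ gAtlas X, x ∈ c.φ.target → ∃ U : Set (ModelSpace c.P), IsOpen U ∧ c.φ.symm x ∈ U ∧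
    U ⊆ c.φ.source ∧ SmoothReal U (fun u => a (c.φ u))

/-- `b : X → [0, ∞)` is an interior map on a neighbourhood of `x`. -/
def InteriorNear (b : X → ℝ≥0) (x : X) : Prop :=
  ∀ c ∈ gAtlas X, x ∈ c.φ.target → ∃ U : Set (ModelSpace c.P), IsOpen U ∧ c.φ.symm x ∈ U ∧
    U ⊆ c.φ.source ∧ SmoothNonneg U (fun u => b (c.φ u)) ∧
    ∀ u ∈ U, u ∈ modelInterior c.P → 0 < b (c.φ u)

theorem SmoothNear.comp₂ {a b : X → ℝ} {x : X} (ha : SmoothNear a x) (hb : SmoothNear b x)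
    {g : ℝ × ℝ → ℝ} (hg : ContDiff ℝ ∞ g) : SmoothNear (fun y => g (a y, b y)) x := by
  intro c hc hx
  obtain ⟨U, hU, hxU, hs, h⟩ := ha c hc hx
  obtain ⟨U', hU', hxU', -, h'⟩ := hb c hc hx
  exact ⟨U ∩ U', hU.inter hU', ⟨hxU, hxU'⟩, inter_subset_left.trans hs,
    (h.mono inter_subset_left).comp₂ (h'.mono inter_subset_right) hg⟩

theorem smoothNear_const (x : X) (r : ℝ) : SmoothNear (fun _ : X => r) x := fun c _ hx =>
  ⟨c.φ.source, c.φ.open_source, c.φ.map_target hx, Subset.rfl, smoothReal_const _ r⟩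

theorem InteriorNear.mul {b b' : X → ℝ≥0} {x : X} (hb : InteriorNear b x)
    (hb' : InteriorNear b' x) : InteriorNear (fun y => b y * b' y) x := by
  intro c hc hx
  obtain ⟨U, hU, hxU, hs, h, hi⟩ := hb c hc hx
  obtain ⟨U', hU', hxU', -, h', hi'⟩ := hb' c hc hx
  have h₁ := h.inter hU'
  rw [inter_comm] at h₁
  exact ⟨U ∩ U', hU.inter hU', ⟨hxU, hxU'⟩, inter_subset_left.trans hs,
    h₁.mul (h'.inter hU), fun u hu hu' => mul_pos (hi u hu.1 hu') (hi' u hu.2 hu')⟩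

theorem SmoothNear.exp {a : X → ℝ} {x : X} (ha : SmoothNear a x) :
    InteriorNear (fun y => Real.toNNReal (Real.exp (a y))) x := by
  intro c hc hx
  obtain ⟨U, hU, hxU, hs, h⟩ := ha c hc hx
  refine ⟨U, hU, hxU, hs, fun u hu => ⟨U, hU, hu, Subset.rfl, Or.inl
    ⟨0, fun v => Real.exp (a (c.φ v)), h.comp₁ Real.contDiff_exp, fun v _ =>
      ⟨Real.exp_pos _, ?_⟩⟩⟩, fun u _ _ => Real.toNNReal_pos.2 (Real.exp_pos _)⟩
  rw [lam_zero, NNReal.coe_one, one_mul, Real.coe_toNNReal _ (Real.exp_pos _).le]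

theorem InteriorNear.toReal {b : X → ℝ≥0} {x : X} (hb : InteriorNear b x) :
    SmoothNear (fun y => (b y : ℝ)) x := by
  intro c hc hx
  obtain ⟨U, hU, hxU, hs, h, -⟩ := hb c hc hx
  obtain ⟨U', hU', hxU', hs', h'⟩ := h.toReal hxU
  exact ⟨U', hU', hxU', hs'.trans hs, h'⟩

theorem isOpen_chart_domain {f : X → Y} (hf : IsSmooth f) (c : GChart (ManifoldWithGCorners.dim X) X)
    (d : GChart (ManifoldWithGCorners.dim Y) Y) {V : Set (ModelSpace d.P)} (hV : IsOpen V) :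
    IsOpen (c.φ.source ∩ c.φ ⁻¹' (f ⁻¹' (d.φ.target ∩ d.φ.symm ⁻¹' V))) :=
  c.φ.isOpen_inter_preimage
    ((d.φ.isOpen_inter_preimage_symm hV).preimage (continuousOn_univ.1 hf.1))

theorem IsSmooth.smoothMap_restrict {f : X → Y} (hf : IsSmooth f)
    {c : GChart (ManifoldWithGCorners.dim X) X} (hc : c ∈ gAtlas X)
    {d : GChart (ManifoldWithGCorners.dim Y) Y} (hd : d ∈ gAtlas Y)
    {V : Set (ModelSpace d.P)} (hV : IsOpen V) :
    SmoothMap (c.φ.source ∩ c.φ ⁻¹' (f ⁻¹' (d.φ.target ∩ d.φ.symm ⁻¹' V)))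
      (fun u => d.φ.symm (f (c.φ u))) := by
  intro q
  have := (hf.2 c hc d hd q).inter (isOpen_chart_domain hf c d hV)
  rwa [inter_eq_left.2] at this
  exact fun u hu => ⟨hu.1, mem_univ _, hu.2.1⟩

theorem SmoothNear.comp {f : X → Y} (hf : IsSmooth f) {a : Y → ℝ} {x : X}
    (ha : SmoothNear a (f x)) : SmoothNear (fun y => a (f y)) x := by
  intro c hc hx
  obtain ⟨d, hd, hfx⟩ := ManifoldWithGCorners.covers (f x)
  obtain ⟨V, hV, hxV, -, h⟩ := ha d hd hfx
  obtain ⟨U, hU, hxU, hs, hr⟩ := h.pullback (hf.smoothMap_restrict hc hd hV)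
    (fun u hu => hu.2.2) (x := c.φ.symm x)
    ⟨c.φ.map_target hx, by simp only [mem_preimage, c.φ.right_inv hx]; exact ⟨hfx, hxV⟩⟩
  exact ⟨U, hU, hxU, fun u hu => (hs hu).1,
    hr.congr fun u hu => by rw [d.φ.right_inv (hs hu).2.1]⟩

theorem InteriorNear.comp {f : X → Y} (hf : IsInterior f) {b : Y → ℝ≥0} {x : X}
    (hb : InteriorNear b (f x)) : InteriorNear (fun y => b (f y)) x := by
  intro c hc hx
  obtain ⟨d, hd, hfx⟩ := ManifoldWithGCorners.covers (f x)
  obtain ⟨V, hV, hxV, -, h, hi⟩ := hb d hd hfx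
  have hcont : ContinuousOn (fun u => d.φ.symm (f (c.φ u)))
      (c.φ.source ∩ c.φ ⁻¹' (f ⁻¹' (d.φ.target ∩ d.φ.symm ⁻¹' V))) :=
    d.φ.symm.continuousOn.comp
      ((continuousOn_univ.1 hf.1.1).comp_continuousOn (c.φ.continuousOn.mono inter_subset_left))
      fun u hu => hu.2.1
  refine ⟨_, isOpen_chart_domain hf.1 c d hV, ⟨c.φ.map_target hx, ?_⟩, inter_subset_left, ?_, ?_⟩
  · simp only [mem_preimage, c.φ.right_inv hx]; exact ⟨hfx, hxV⟩
  · have := h.pullback (isOpen_chart_domain hf.1 c d hV) hcont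
      (hf.1.smoothMap_restrict hc hd hV) (fun u hu => hu.2.2)
    intro u hu
    obtain ⟨U', hU', huU', hs, h'⟩ := this u hu
    refine ⟨U', hU', huU', hs, ?_⟩
    rcases h' with ⟨p, k, hk, K⟩ | K
    · exact Or.inl ⟨p, k, hk, fun v hv => by
        have := K v hv
        simp only [d.φ.right_inv (hs hv).2.1] at this
        exact this⟩
    · exact Or.inr fun v hv => by
        have := K v hv
        simp only [d.φ.right_inv (hs hv).2.1] at this
        exact this
  · intro u hu hint
    have := hi _ hu.2.2 (hf.2 c hc d hd u ⟨hu.1, hu.2.1⟩ hint)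
    rwa [d.φ.right_inv hu.2.1] at this

/-- `C^∞_x(X)`: the germs at `x` of smooth functions to `ℝ`. -/
def smoothGerms (x : X) : Submodule ℝ (Germ (𝓝 x) ℝ) where
  carrier := {a | ∃ f : X → ℝ, (f : Germ (𝓝 x) ℝ) = a ∧ SmoothNear f x}
  add_mem' := by
    rintro _ _ ⟨f, rfl, hf⟩ ⟨g, rfl, hg⟩
    exact ⟨fun y => f y + g y, rfl, hf.comp₂ hg contDiff_add⟩
  zero_mem' := ⟨fun _ => 0, rfl, smoothNear_const x 0⟩
  smul_mem' := by
    rintro r _ ⟨f, rfl, hf⟩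
    exact ⟨fun y => r * f y, rfl, (smoothNear_const x r).comp₂ hf contDiff_mul⟩

/-- `I_x(X)`: the multiplicative monoid of germs at `x` of interior functions to `[0, ∞)`. -/
def interiorGerms (x : X) : Submonoid (Germ (𝓝 x) ℝ≥0) where
  carrier := {b | ∃ f : X → ℝ≥0, (f : Germ (𝓝 x) ℝ≥0) = b ∧ InteriorNear f x}
  mul_mem' := by
    rintro _ _ ⟨f, rfl, hf⟩ ⟨g, rfl, hg⟩
    exact ⟨fun y => f y * g y, rfl, hf.mul hg⟩
  one_mem' := ⟨fun _ => 1, rfl, by simpa using (smoothNear_const x 0).exp⟩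

/-- The germ of a function that is interior near `x`. -/
def interiorGerm (b : X → ℝ≥0) (x : X) (hb : InteriorNear b x) : interiorGerms x :=
  ⟨(b : Germ (𝓝 x) ℝ≥0), b, rfl, hb⟩

/-- The product of `C^∞_x(X)`. -/
def smoothMul {x : X} (a b : smoothGerms x) : smoothGerms x :=
  ⟨a.1 * b.1, by
    obtain ⟨_, f, rfl, hf⟩ := a
    obtain ⟨_, g, rfl, hg⟩ := b
    exact ⟨fun y => f y * g y, rfl, hf.comp₂ hg contDiff_mul⟩⟩

/-- Evaluation `C^∞_x(X) → ℝ`. -/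
def evSmooth {x : X} (a : smoothGerms x) : ℝ := a.1.value

/-- Evaluation `I_x(X) → [0, ∞)`. -/
def evInterior {x : X} (b : interiorGerms x) : ℝ≥0 := b.1.value

/-- The exponential map `C^∞_x(X) → I_x(X)`. -/
noncomputable def expGerm {x : X} (a : smoothGerms x) : interiorGerms x :=
  ⟨a.1.map (fun t => Real.toNNReal (Real.exp t)), by
    obtain ⟨_, f, rfl, hf⟩ := a
    exact ⟨_, rfl, hf.exp⟩⟩

/-- The inclusion map `I_x(X) → C^∞_x(X)`. -/
def incGerm {x : X} (b : interiorGerms x) : smoothGerms x :=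
  ⟨b.1.map NNReal.toReal, by
    obtain ⟨_, f, rfl, hf⟩ := b
    exact ⟨_, rfl, hf.toReal⟩⟩

theorem IsSmooth.continuousAt {f : X → Y} (hf : IsSmooth f) (x : X) : Tendsto f (𝓝 x) (𝓝 (f x)) :=
  (continuousOn_univ.1 hf.1).tendsto x

/-- Pullback of germs of smooth functions, `[a] ↦ [a ∘ f]`. -/
def pullSmooth (f : X → Y) (hf : IsSmooth f) (x : X) : smoothGerms (f x) →ₗ[ℝ] smoothGerms x where
  toFun a := ⟨a.1.compTendsto f (hf.continuousAt x), by
    obtain ⟨_, g, rfl, hg⟩ := a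
    exact ⟨_, rfl, hg.comp hf⟩⟩
  map_add' := by
    rintro ⟨_, g, rfl, hg⟩ ⟨_, g', rfl, hg'⟩; rfl
  map_smul' := by
    rintro r ⟨_, g, rfl, hg⟩; rfl

/-- Pullback of germs of interior functions, `[b] ↦ [b ∘ f]`, for `f` interior. -/
def pullInterior (f : X → Y) (hf : IsInterior f) (x : X) :
    interiorGerms (f x) →* interiorGerms x where
  toFun b := ⟨b.1.compTendsto f (hf.1.continuousAt x), by
    obtain ⟨_, g, rfl, hg⟩ := b
    exact ⟨_, rfl, hg.comp hf⟩⟩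
  map_one' := rfl
  map_mul' := by
    rintro ⟨_, g, rfl, hg⟩ ⟨_, g', rfl, hg'⟩; rfl

/-! ### Simple maps -/

/-- The monoid `M̃_x X` of monoid morphisms `I_x(X) → (ℕ, +)` vanishing on the germs of positive
functions. -/
def tildeM (x : X) : AddSubmonoid (Additive (interiorGerms x) →+ ℕ) where
  carrier := {α | ∀ b : interiorGerms x, 0 < evInterior b → α (Additive.ofMul b) = 0}
  add_mem' := by
    intro α β hα hβ b hb
    rw [AddMonoidHom.add_apply, hα b hb, hβ b hb]
  zero_mem' := fun _ _ => rfl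

/-- The monoid morphism `M̃_x f : M̃_x X → M̃_{f(x)} Y`, `α ↦ α ∘ f^*`, of an interior map `f`. -/
def tildeMMap (f : X → Y) (hf : IsInterior f) (x : X) : tildeM x →+ tildeM (f x) where
  toFun α := ⟨α.1.comp (MonoidHom.toAdditive (pullInterior f hf x)), fun b hb => by
    refine α.2 (pullInterior f hf x b) ?_
    obtain ⟨_, g, rfl, hg⟩ := b
    exact hb⟩
  map_zero' := rfl
  map_add' _ _ := rfl

/-- A map is simple if it is interior and `M̃_x f` is an isomorphism for all `x`. -/
def IsSimple (f : X → Y) : Prop :=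
  ∃ hf : IsInterior f, ∀ x : X, Function.Bijective (tildeMMap f hf x)

theorem IsSimple.isInterior {f : X → Y} (hf : IsSimple f) : IsInterior f := hf.1

/-! ### The b-tangent bundle and the b-differential -/

/-- The b-tangent space `ᵇT_x X`: pairs `(v, v')` of a linear map `v : C^∞_x(X) → ℝ` and a monoid
morphism `v' : I_x(X) → (ℝ, +)` such that `v` is a derivation, `v' (exp a) = v a` and
`v (inc b) = ev b * v' b`. -/
def BTangent (x : X) : Submodule ℝ ((smoothGerms x →ₗ[ℝ] ℝ) × (Additive (interiorGerms x) →+ ℝ)) where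
  carrier := {v |
    (∀ a b : smoothGerms x, v.1 (smoothMul a b) = v.1 a * evSmooth b + evSmooth a * v.1 b) ∧
    (∀ a : smoothGerms x, v.2 (Additive.ofMul (expGerm a)) = v.1 a) ∧
    (∀ b : interiorGerms x, v.1 (incGerm b) = (evInterior b : ℝ) * v.2 (Additive.ofMul b))}
  add_mem' := by
    rintro v w ⟨h₁, h₂, h₃⟩ ⟨k₁, k₂, k₃⟩
    refine ⟨fun a b => ?_, fun a => ?_, fun b => ?_⟩
    · simp only [Prod.fst_add, LinearMap.add_apply, h₁, k₁]; ring
    · simp only [Prod.fst_add, Prod.snd_add, LinearMap.add_apply, AddMonoidHom.add_apply, h₂, k₂]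
    · simp only [Prod.fst_add, Prod.snd_add, LinearMap.add_apply, AddMonoidHom.add_apply, h₃, k₃]
      ring
  zero_mem' := by
    refine ⟨fun a b => ?_, fun a => ?_, fun b => ?_⟩ <;> simp
  smul_mem' := by
    rintro r v ⟨h₁, h₂, h₃⟩
    refine ⟨fun a b => ?_, fun a => ?_, fun b => ?_⟩
    · simp only [Prod.smul_fst, LinearMap.smul_apply, h₁, smul_eq_mul]; ring
    · simp only [Prod.smul_fst, Prod.smul_snd, LinearMap.smul_apply, AddMonoidHom.smul_apply, h₂]
    · simp only [Prod.smul_fst, Prod.smul_snd, LinearMap.smul_apply, AddMonoidHom.smul_apply, h₃,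
        smul_eq_mul]
      ring

/-- The value `v' [b]` of a b-tangent vector `(v, v')` at `x` on a function `b` interior near `x`. -/
def BTangent.apply {x : X} (v : BTangent x) (b : X → ℝ≥0) (hb : InteriorNear b x) : ℝ :=
  v.1.2 (Additive.ofMul (interiorGerm b x hb))

/-- The b-differential `ᵇdf|_x : ᵇT_x X → ᵇT_{f(x)} Y`, `(v, v') ↦ (v ∘ f^*, v' ∘ f^*)`, of an
interior map `f`. -/
def bDiff (f : X → Y) (hf : IsInterior f) (x : X) : BTangent x →ₗ[ℝ] BTangent (f x) where
  toFun v := ⟨(v.1.1.comp (pullSmooth f hf.1 x),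
      v.1.2.comp (MonoidHom.toAdditive (pullInterior f hf x))), by
    refine ⟨fun a b => ?_, fun a => ?_, fun b => ?_⟩
    · obtain ⟨_, g, rfl, hg⟩ := a
      obtain ⟨_, g', rfl, hg'⟩ := b
      exact v.2.1 ⟨_, _, rfl, hg.comp hf.1⟩ ⟨_, _, rfl, hg'.comp hf.1⟩
    · obtain ⟨_, g, rfl, hg⟩ := a
      exact v.2.2.1 ⟨_, _, rfl, hg.comp hf.1⟩
    · obtain ⟨_, g, rfl, hg⟩ := b
      exact v.2.2.2 ⟨_, _, rfl, hg.comp hf⟩⟩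
  map_add' _ _ := rfl
  map_smul' _ _ := rfl

/-- Smooth local sections over the open set `U ⊆ X` of the pullback bundle `f^*(ᵇTY)`, whose fibre
at `x` is `ᵇT_{f(x)} Y`: families `s` such that, for each interior function `b` on an open subset
`V` of `Y`, the function `x ↦ s(x) [b]` is smooth on `U ∩ f⁻¹(V)`. (In the local trivialization
`(v, v') ↦ (p ↦ v' [lam p ∘ φ⁻¹])` of `ᵇTY` given by a g-chart `(P, V, φ)` these are the
sections with smooth coefficients. The values of `s` outside `U` are irrelevant.) -/
def IsSmoothSection (f : X → Y) (U : Set X) (s : ∀ x : X, BTangent (f x)) : Prop :=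
  ∀ (V : Set Y) (b : Y → ℝ≥0) (hb : ∀ y ∈ V, InteriorNear b y), IsOpen V →
    ∀ x₀ ∈ U, f x₀ ∈ V → ∃ a : X → ℝ, SmoothNear a x₀ ∧
      ∀ᶠ x in 𝓝 x₀, ∀ hx : f x ∈ V, BTangent.apply (s x) b (hb (f x) hx) = a x

/-- `ᵇdf : ᵇTX → f^*(ᵇTY)` is an isomorphism of vector bundles on `X`: it is a linear isomorphism
on each fibre, and it and its inverse take smooth local sections to smooth local sections. -/
def IsBDiffIso (f : X → Y) (hf : IsInterior f) : Prop :=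
  (∀ x : X, Function.Bijective (bDiff f hf x)) ∧
    ∀ (U : Set X), IsOpen U → ∀ s : (∀ x : X, BTangent x),
      (IsSmoothSection (fun x : X => x) U s ↔
        IsSmoothSection f U (fun x => bDiff f hf x (s x)))

end Maps

end GCorners

namespace GCorners

open Set Filter Topology
open scoped NNReal ContDiff

/-! ### Lattices and rational cones -/

/-! If `f` has local inverses, pullback along them inverts `f^*` on germs of smooth and of interior
functions. Both `M̃_x` and `ᵇT_x` are built from these germs alone, so `f` is simple and its
b-differential is an isomorphism. One point needs proof: a smooth local inverse is interior. A
smooth function to `[0, ∞)` is locally `λ_p h` with `h > 0`, or zero, and density of the interior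
rules out zero (`mem_interior_of_smooth_inverse`). For a bijective étale map, the global inverse
agrees locally with the local ones.

The converse is an inverse function theorem. Take charts on `X_P` and `X_Q`, and let `F` be the
local form of `f` at `x₀`. The elements not vanishing at `x₀` and at `F x₀` form faces of `P` and
`Q`. Each interior germ is `λ_p exp(a)` with `a` smooth, so `M̃_x X` is the monoid of morphisms `P →
ℕ` killing the face (`toFaceHom_injective`, `exists_toFaceHom_eq`). With Hadamard's lemma, `ᵇT_x X`
is `Hom(P, ℝ)` (`bTangentEquiv`). The hypotheses thus become statements about monoids and linear
algebra.

Combinatorial half. Write `λ_q ∘ F = λ_{θ₀ q} h_q`; here `θ₀ q` is determined only modulo the face.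
Farkas' lemma and saturation recover the group of a face, and the localization of the monoid at it,
from the morphisms to `ℕ` killing it. Bijectivity of `M̃_x f` therefore gives an isomorphism between
the group completions modulo faces that respects positivity, and it lifts to honest morphisms `θ : Q
→ P` and `κ : P → Q`, inverse to each other modulo the faces (`IsWeaklyToric.exists_quasi_inverse`).
Face elements are positive near the point, so `λ_q ∘ F = λ_{θ q} exp(l_q)` and `λ_{κ p} ∘ F = λ_p
exp(k_p)` with `l_q`, `k_p` smooth (`exists_normal_form`).

Analytic half. The second formula says that `x = exp(c) · κ^*(F x)` for some `c` in `Hom(P, ℝ)`. So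
`F x = y` is solved by `x = exp(c) · κ^* y`, with the vector `c` as the only unknown, even at
corners. Taking logarithms, the equation becomes `c(θ q) + log(λ_{κ θ q} / λ_q)(y) + l_q(exp(c) ·
κ^* y) = 0`, where the quotient is read as a ratio of face elements. It extends smoothly to a
Euclidean open set, and its derivative in `c` is the b-differential. The implicit function theorem
yields `c` as a smooth function of finitely many `λ_s(y)`, so `y ↦ exp(c(y)) · κ^* y` is a smooth
inverse (`exists_local_inverse_of_normal_form`). -/

/-- Farkas' lemma over `ℤ`. -/
theorem farkas_int {L : Type*} [AddCommGroup L] [Module.Free ℤ L] (S : List L) (g : L) :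
    (∃ n : ℕ, 1 ≤ n ∧ n • g ∈ AddSubmonoid.closure {x | x ∈ S}) ∨
      ∃ β : L →+ ℤ, (∀ s ∈ S, 0 ≤ β s) ∧ β g < 0 := by
  suffices H : ∀ (m : ℕ) (S : List L), S.length = m → ∀ g : L,
      (∃ n : ℕ, 1 ≤ n ∧ n • g ∈ AddSubmonoid.closure {x | x ∈ S}) ∨
      ∃ β : L →+ ℤ, (∀ s ∈ S, 0 ≤ β s) ∧ β g < 0 from H _ S rfl g
  intro m
  induction m with
  | zero =>
    intro S hS g
    obtain rfl := List.length_eq_zero_iff.1 hS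
    by_cases hg : g = 0
    · exact Or.inl ⟨1, le_rfl, by simp [hg]⟩
    · right
      have : ∃ β : Module.Dual ℤ L, β g ≠ 0 := by
        by_contra! h
        exact hg ((Module.forall_dual_apply_eq_zero_iff ℤ g).1 h)
      obtain ⟨β, hβ⟩ := this
      rcases lt_or_gt_of_ne hβ with h | h
      · exact ⟨β.toAddMonoidHom, by simp, h⟩
      · exact ⟨(-β).toAddMonoidHom, by simp, by simpa using h⟩
  | succ m ih =>
    intro S hS g
    obtain ⟨s, S, rfl⟩ := List.exists_cons_of_length_eq_add_one hS
    have hS' : S.length = m := by simpa using hS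
    have hsub : AddSubmonoid.closure {x | x ∈ S} ≤ AddSubmonoid.closure {x | x ∈ s :: S} :=
      AddSubmonoid.closure_mono fun x hx => List.mem_cons_of_mem _ hx
    have hs : s ∈ AddSubmonoid.closure {x | x ∈ s :: S} :=
      AddSubmonoid.subset_closure List.mem_cons_self
    rcases ih S hS' g with ⟨n, hn, h⟩ | ⟨β₀, hβ₀, hg⟩
    · exact Or.inl ⟨n, hn, hsub h⟩
    by_cases h0 : 0 ≤ β₀ s
    · exact Or.inr ⟨β₀, by simpa using ⟨h0, hβ₀⟩, hg⟩
    push Not at h0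
    obtain ⟨k, hk⟩ : ∃ k : ℕ, β₀ s = -(k : ℤ) := ⟨(-β₀ s).toNat, by omega⟩
    have hk1 : 1 ≤ k := by omega
    -- Since `β₀ s = -k < 0`, this is `k` times the projection onto `ker β₀` along `s`. It kills
    -- `s`, so the induction hypothesis applies to the images of the remaining vectors.
    let T : L →+ L := AddMonoidHom.mk' (fun v => k • v + β₀ v • s) fun a b => by
      simp only [map_add, add_smul, smul_add]; abel
    have hT : ∀ v, T v = k • v + β₀ v • s := fun _ => rfl
    have hTs : T s = 0 := by rw [hT, hk, neg_smul, natCast_zsmul]; abel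
    rcases ih (S.map T) (by simpa using hS') (T g) with ⟨n, hn, h⟩ | ⟨β₁, hβ₁, hg₁⟩
    · left
      have himg : {x | x ∈ S.map T} = T '' {x | x ∈ S} := by ext; simp
      rw [himg, ← AddMonoidHom.map_mclosure] at h
      obtain ⟨u, hu, hTu⟩ := h
      have hβu : 0 ≤ β₀ u := by
        refine AddSubmonoid.closure_induction (motive := fun x _ => 0 ≤ β₀ x) (fun x hx => hβ₀ x hx)
          (by simp) (fun x y _ _ hx hy => ?_) hu
        rw [map_add]; exact add_nonneg hx hy
      refine ⟨n * k, Nat.mul_pos hn hk1, ?_⟩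
      -- Unfolding `T u = n • T g`. The coefficient of `s` is nonnegative because `β₀ u ≥ 0` and `β₀
      -- g < 0`.
      have e : (n * k) • g = k • u + (β₀ u - n * β₀ g).toNat • s := by
        have h1 : ((β₀ u - n * β₀ g).toNat : ℤ) = β₀ u - n * β₀ g := by
          refine Int.toNat_of_nonneg ?_
          have : (n : ℤ) * β₀ g ≤ 0 := mul_nonpos_of_nonneg_of_nonpos (by positivity) hg.le
          omega
        rw [← natCast_zsmul s, h1]
        rw [hT, hT] at hTu
        rw [sub_smul, mul_smul, mul_smul]
        have : n • (k • g + β₀ g • s) = n • k • g + (n : ℤ) • β₀ g • s := by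
          rw [smul_add, natCast_zsmul]
        rw [this] at hTu
        rw [← add_sub_assoc, hTu]; abel
      rw [e]
      exact add_mem (nsmul_mem (hsub hu) _) (nsmul_mem hs _)
    · right
      refine ⟨β₁.comp T, ?_, hg₁⟩
      intro x hx
      rcases List.mem_cons.1 hx with rfl | hx
      · simp [hTs]
      · exact hβ₁ _ (List.mem_map_of_mem hx)

/-- A homomorphism of finite free `ℤ`-modules whose dual is bijective is bijective. -/
theorem bijective_of_dualMap_bijective {M N : Type*} [AddCommGroup M] [AddCommGroup N]
    [Module.Free ℤ M] [Module.Finite ℤ M] [Module.Free ℤ N] [Module.Finite ℤ N]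
    (f : M →ₗ[ℤ] N) (hf : Function.Bijective f.dualMap) : Function.Bijective f := by
  let e := LinearEquiv.ofBijective f.dualMap hf
  have h : ∀ x, Module.evalEquiv ℤ N (f x) = e.dualMap.symm.symm (Module.evalEquiv ℤ M x) := by
    intro x; ext γ
    simp [e]
  have : (f : M → N) = (Module.evalEquiv ℤ N).symm ∘ e.dualMap.symm.symm ∘
      Module.evalEquiv ℤ M := by
    funext x
    simp only [Function.comp_apply, ← h, LinearEquiv.symm_apply_apply]
  rw [this]
  exact (Module.evalEquiv ℤ N).symm.bijective.comp
    (e.dualMap.symm.symm.bijective.comp (Module.evalEquiv ℤ M).bijective)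

/-! ### Faces of weakly toric monoids -/

section Monoid

variable {P : Type*} [AddCommMonoid P] {Q : Type*} [AddCommMonoid Q]

/-- The group completion of a commutative monoid. -/
abbrev Gp (P : Type*) [AddCommMonoid P] : Type _ := Algebra.GrothendieckAddGroup P

/-- The canonical morphism to the group completion. -/
noncomputable def toGp : P →+ Gp P := Algebra.GrothendieckAddGroup.of

theorem gp_exists_sub (g : Gp P) : ∃ a b : P, g = toGp a - toGp b := by
  obtain ⟨⟨a, b⟩, h⟩ := (AddLocalization.addMonoidOf (⊤ : AddSubmonoid P)).surj g
  exact ⟨a, b, eq_sub_of_add_eq h⟩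

theorem gp_hom_ext {G : Type*} [AddCommGroup G] {f g : Gp P →+ G}
    (h : ∀ p : P, f (toGp p) = g (toGp p)) : f = g := by
  ext x
  obtain ⟨a, b, rfl⟩ := gp_exists_sub x
  simp only [map_sub, h]

/-- The extension of a morphism to the group completion. -/
noncomputable def gpLift {G : Type*} [AddCommGroup G] (f : P →+ G) : Gp P →+ G :=
  Algebra.GrothendieckAddGroup.lift f

@[simp] theorem gpLift_toGp {G : Type*} [AddCommGroup G] (f : P →+ G) (p : P) :
    gpLift f (toGp p) = f p :=
  DFunLike.congr_fun (Algebra.GrothendieckAddGroup.lift.symm_apply_apply f) p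

/-- The extension of a morphism `P → ℕ` to the group completion. -/
noncomputable def extInt (α : P →+ ℕ) : Gp P →+ ℤ :=
  gpLift ((Nat.castAddMonoidHom ℤ).comp α)

@[simp] theorem extInt_toGp (α : P →+ ℕ) (p : P) : extInt α (toGp p) = α p := by
  simp [extInt]

/-- A morphism `P^gp → ℤ` which is nonnegative on `P` restricts to a morphism `P → ℕ`. -/
theorem exists_extInt_eq (β : Gp P →+ ℤ) (h : ∀ p : P, 0 ≤ β (toGp p)) :
    ∃ α : P →+ ℕ, extInt α = β := by
  have hc : ∀ p, ((β (toGp p)).toNat : ℤ) = β (toGp p) := fun p => Int.toNat_of_nonneg (h p)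
  refine ⟨⟨⟨fun p => (β (toGp p)).toNat, ?_⟩, ?_⟩, gp_hom_ext fun p => ?_⟩
  · have h0 : β (toGp (0 : P)) = 0 := by rw [map_zero, map_zero]
    rw [h0]; rfl
  · intro x y
    zify
    show ((β (toGp (x + y))).toNat : ℤ) = (β (toGp x)).toNat + (β (toGp y)).toNat
    rw [hc, hc, hc, map_add, map_add]
  · rw [extInt_toGp]; exact hc p

/-- A submonoid is a face if it contains the summands of its elements. -/
def IsFace (F : AddSubmonoid P) : Prop := ∀ a b : P, a + b ∈ F → a ∈ F

/-- The subgroup of `P^gp` generated by a submonoid of `P`. -/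
noncomputable def faceSpan (F : AddSubmonoid P) : Submodule ℤ (Gp P) :=
  Submodule.span ℤ (toGp '' (F : Set P))

theorem toGp_mem_faceSpan {F : AddSubmonoid P} {a : P} (ha : a ∈ F) : toGp a ∈ faceSpan F :=
  Submodule.subset_span ⟨a, ha, rfl⟩

theorem exists_of_mem_faceSpan {F : AddSubmonoid P} {g : Gp P} (hg : g ∈ faceSpan F) :
    ∃ a ∈ F, ∃ b ∈ F, g = toGp a - toGp b := by
  refine Submodule.span_induction ?_ ?_ ?_ ?_ hg
  · rintro _ ⟨a, ha, rfl⟩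
    exact ⟨a, ha, 0, F.zero_mem, by simp⟩
  · exact ⟨0, F.zero_mem, 0, F.zero_mem, by simp⟩
  · rintro _ _ _ _ ⟨a, ha, b, hb, rfl⟩ ⟨a', ha', b', hb', rfl⟩
    exact ⟨a + a', F.add_mem ha ha', b + b', F.add_mem hb hb', by simp only [map_add]; abel⟩
  · rintro n _ _ ⟨a, ha, b, hb, rfl⟩
    rcases Int.eq_nat_or_neg n with ⟨m, rfl | rfl⟩
    · exact ⟨m • a, F.nsmul_mem ha m, m • b, F.nsmul_mem hb m, by
        simp only [map_nsmul, natCast_zsmul, smul_sub]⟩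
    · exact ⟨m • b, F.nsmul_mem hb m, m • a, F.nsmul_mem ha m, by
        simp only [map_nsmul, neg_smul, natCast_zsmul, smul_sub]; abel⟩

theorem extInt_eq_zero_of_mem_faceSpan {F : AddSubmonoid P} {α : P →+ ℕ} (hα : ∀ a ∈ F, α a = 0)
    {g : Gp P} (hg : g ∈ faceSpan F) : extInt α g = 0 := by
  obtain ⟨a, ha, b, hb, rfl⟩ := exists_of_mem_faceSpan hg
  simp [hα a ha, hα b hb]

namespace IsWeaklyToric

theorem toGp_injective (hP : IsWeaklyToric P) : Function.Injective (toGp : P →+ Gp P) := by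
  have : IsCancelAdd P :=
    { add_left_cancel := fun a b c h => hP.integral b c a (by
        simpa only [add_comm _ a] using h)
      add_right_cancel := fun a b c h => hP.integral b c a h }
  exact Algebra.GrothendieckAddGroup.of_injective

theorem finite_gp (hP : IsWeaklyToric P) : Module.Finite ℤ (Gp P) := by
  have := hP.fg
  infer_instance

theorem free_gp (hP : IsWeaklyToric P) : Module.Free ℤ (Gp P) := by
  have := hP.finite_gp
  have : Module.IsTorsionFree ℤ (Gp P) := by
    rw [Module.isTorsionFree_iff_smul_eq_zero]
    intro n g h
    by_contra! hn
    refine hn.2 (hP.torsion_free g n.natAbs (Int.natAbs_pos.2 hn.1) ?_)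
    rcases Int.natAbs_eq n with e | e
    · rw [← natCast_zsmul, ← e, h]
    · have : ((n.natAbs : ℕ) : ℤ) = -n := by omega
      rw [← natCast_zsmul, this, neg_smul, h, neg_zero]
  exact Module.free_of_finite_type_torsion_free'

end IsWeaklyToric

/-- A sum lying in a face has all its summands there, so only generators from the face occur.
Conditions on a face can thus be tested on finitely many elements. -/
theorem IsFace.closure_inter {F : AddSubmonoid P} (hF : IsFace F) {S : Set P}
    (hS : AddSubmonoid.closure S = ⊤) {a : P} (ha : a ∈ F) :
    a ∈ AddSubmonoid.closure {x ∈ S | x ∈ F} := by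
  have h : a ∈ AddSubmonoid.closure S := hS ▸ AddSubmonoid.mem_top a
  revert ha
  refine AddSubmonoid.closure_induction (motive := fun a _ => a ∈ F → a ∈ AddSubmonoid.closure
    {x ∈ S | x ∈ F}) ?_ ?_ ?_ h
  · exact fun x hx hxF => AddSubmonoid.subset_closure ⟨hx, hxF⟩
  · exact fun _ => zero_mem _
  · exact fun x y _ _ ihx ihy hxy => add_mem (ihx (hF x y hxy))
      (ihy (hF y x (by rwa [add_comm])))

/-- The localization of a weakly toric monoid at a face is the intersection of the half spaces
which contain it. -/
theorem IsWeaklyToric.exists_add_eq (hP : IsWeaklyToric P) {F : AddSubmonoid P} (hF : IsFace F)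
    (g : Gp P) (hg : ∀ α : P →+ ℕ, (∀ a ∈ F, α a = 0) → 0 ≤ extInt α g) :
    ∃ p : P, ∃ a ∈ F, g + toGp a = toGp p := by
  classical
  have := hP.free_gp
  obtain ⟨S, hS, hfin⟩ := (AddMonoid.fg_iff (M := P)).1 hP.fg
  lift S to Finset P using hfin
  -- The generators of the localization `P - F`: those of `P` and the negatives of those in `F`.
  let l : List (Gp P) := S.toList.map toGp ++ (S.filter (· ∈ F)).toList.map fun a => -toGp a
  have hl1 : ∀ s ∈ S, toGp s ∈ l := fun s hs => by
    simp only [l, List.mem_append, List.mem_map, Finset.mem_toList]; exact Or.inl ⟨s, hs, rfl⟩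
  have hl2 : ∀ s ∈ S, s ∈ F → -toGp s ∈ l := fun s hs hsF => by
    simp only [l, List.mem_append, List.mem_map, Finset.mem_toList, Finset.mem_filter]
    exact Or.inr ⟨s, ⟨hs, hsF⟩, rfl⟩
  rcases farkas_int l g with ⟨n, hn, h⟩ | ⟨β, hβ, hβg⟩
  · have : ∃ p : P, ∃ a ∈ F, n • g = toGp p - toGp a := by
      refine AddSubmonoid.closure_induction (motive := fun x _ => ∃ p : P, ∃ a ∈ F, x = toGp p - toGp a)
        ?_ ?_ ?_ h
      · intro x hx
        simp only [l, List.mem_append, List.mem_map, Finset.mem_toList, Finset.mem_filter,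
          mem_ofPred_eq] at hx
        rcases hx with ⟨a, -, rfl⟩ | ⟨a, ⟨-, ha⟩, rfl⟩
        · exact ⟨a, 0, F.zero_mem, by simp⟩
        · exact ⟨0, a, ha, by simp⟩
      · exact ⟨0, 0, F.zero_mem, by simp⟩
      · rintro _ _ _ _ ⟨p, a, ha, rfl⟩ ⟨p', a', ha', rfl⟩
        exact ⟨p + p', a + a', F.add_mem ha ha', by simp only [map_add]; abel⟩
    obtain ⟨p, a, ha, e⟩ := this
    obtain ⟨k, rfl⟩ : ∃ k, n = k + 1 := ⟨n - 1, by omega⟩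
    -- From `n g = p - a` follows `n (g + a) = p + (n - 1) a`, which lies in `P`; saturation removes
    -- the factor `n`.
    obtain ⟨q, hq⟩ := hP.saturated (g + toGp a) (k + 1) (by omega) ⟨p + k • a, by
      rw [smul_add, e]
      simp only [map_add, map_nsmul, add_smul, one_smul]; abel⟩
    exact ⟨q, a, ha, hq.symm⟩
  -- A separating functional is nonnegative on `P` and on `-F`, so it is a morphism to `ℕ` killing
  -- `F` and negative on `g`, against `hg`.
  · exfalso
    have hnn : ∀ p : P, 0 ≤ β (toGp p) := by
      intro p
      have hp : p ∈ AddSubmonoid.closure (S : Set P) := hS ▸ AddSubmonoid.mem_top p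
      refine AddSubmonoid.closure_induction (motive := fun p _ => 0 ≤ β (toGp p)) ?_ ?_ ?_ hp
      · exact fun x hx => hβ _ (hl1 x hx)
      · simp
      · intro x y _ _ hx hy
        simp only [map_add] at *; exact add_nonneg hx hy
    obtain ⟨α, rfl⟩ := exists_extInt_eq β hnn
    refine hβg.not_ge (hg α fun a ha => ?_)
    refine AddSubmonoid.closure_induction (motive := fun a _ => α a = 0) ?_ ?_ ?_
      (hF.closure_inter hS ha)
    · intro x hx
      have := hβ _ (hl2 x hx.1 hx.2)
      rw [map_neg, extInt_toGp] at this
      omega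
    · simp
    · intro x y _ _ hx hy; rw [map_add, hx, hy]

/-- Both `g` and `-g` lie in the localization, which gives `p + p' = a + a'` with right side in the
face; hence `p` is in the face and `g = p - a`. So morphisms to `ℕ` detect the group of a face. -/
theorem IsWeaklyToric.mem_faceSpan (hP : IsWeaklyToric P) {F : AddSubmonoid P} (hF : IsFace F)
    {g : Gp P} (hg : ∀ α : P →+ ℕ, (∀ a ∈ F, α a = 0) → extInt α g = 0) : g ∈ faceSpan F := by
  obtain ⟨p, a, ha, e⟩ := hP.exists_add_eq hF g fun α h => (hg α h).ge
  obtain ⟨p', a', ha', e'⟩ := hP.exists_add_eq hF (-g) fun α h => by rw [map_neg, hg α h, neg_zero]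
  have h : p + p' = a + a' := hP.toGp_injective <| by
    simp only [map_add] at *
    rw [← e, ← e']; abel
  have hp : p ∈ F := hF p p' (h ▸ F.add_mem ha ha')
  rw [eq_sub_of_add_eq e]
  exact sub_mem (toGp_mem_faceSpan hp) (toGp_mem_faceSpan ha)

/-- Every face is the zero set of a morphism to `ℕ`. -/
theorem IsWeaklyToric.exists_eq_zero_iff (hP : IsWeaklyToric P) {F : AddSubmonoid P}
    (hF : IsFace F) : ∃ α : P →+ ℕ, ∀ p, α p = 0 ↔ p ∈ F := by
  classical
  obtain ⟨S, hS, hfin⟩ := (AddMonoid.fg_iff (M := P)).1 hP.fg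
  lift S to Finset P using hfin
  have key : ∀ r : P, ∃ α : P →+ ℕ, (∀ a ∈ F, α a = 0) ∧ (α r = 0 → r ∈ F) := by
    intro r
    by_contra! h
    -- If every morphism killing `F` kills `r`, then `-r` lies in the localization: `r + p = a` is
    -- in `F`, and so is `r`.
    have h' := hP.exists_add_eq hF (-toGp r) fun α hα => by
      rw [map_neg, extInt_toGp, (h α hα).1]; simp
    obtain ⟨p, a, ha, e⟩ := h'
    have : a = r + p := hP.toGp_injective <| by
      simp only [map_add] at *
      rw [← e]; abel
    exact (h 0 fun _ _ => rfl).2 (hF r p (this ▸ ha))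
  choose α hα hαr using key
  have hsum : ∀ p, (∑ r ∈ S, α r) p = ∑ r ∈ S, α r p := fun p => by
    rw [AddMonoidHom.finsetSum_apply]
  refine ⟨∑ r ∈ S, α r, fun p => ⟨?_, fun hp => ?_⟩⟩
  · have hp : p ∈ AddSubmonoid.closure (S : Set P) := hS ▸ AddSubmonoid.mem_top p
    refine AddSubmonoid.closure_induction (motive := fun p _ => (∑ r ∈ S, α r) p = 0 → p ∈ F)
      ?_ ?_ ?_ hp
    · intro r hr h
      rw [hsum, Finset.sum_eq_zero_iff] at h
      exact hαr r (h r hr)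
    · exact fun _ => F.zero_mem
    · intro x y _ _ hx hy h
      rw [map_add] at h
      exact F.add_mem (hx (by omega)) (hy (by omega))
  · rw [hsum]; exact Finset.sum_eq_zero fun r _ => hα r p hp

/-- Every integral functional vanishing on a face is a difference of morphisms to `ℕ` vanishing
on the face. -/
theorem IsWeaklyToric.exists_sub (hP : IsWeaklyToric P) {F : AddSubmonoid P} (hF : IsFace F)
    (β : Gp P →+ ℤ) (hβ : ∀ a ∈ F, β (toGp a) = 0) :
    ∃ α α' : P →+ ℕ, (∀ a ∈ F, α a = 0) ∧ (∀ a ∈ F, α' a = 0) ∧ β = extInt α - extInt α' := by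
  classical
  obtain ⟨S, hS, hfin⟩ := (AddMonoid.fg_iff (M := P)).1 hP.fg
  lift S to Finset P using hfin
  obtain ⟨α₀, h₀⟩ := hP.exists_eq_zero_iff hF
  -- Large enough that `β + m α₀` is nonnegative on generators: off the face `α₀ ≥ 1`, on it `β`
  -- vanishes.
  let m : ℕ := ∑ r ∈ S, (β (toGp r)).natAbs
  have hnn : ∀ p : P, 0 ≤ (β + extInt (m • α₀)) (toGp p) := by
    intro p
    have hp : p ∈ AddSubmonoid.closure (S : Set P) := hS ▸ AddSubmonoid.mem_top p
    refine AddSubmonoid.closure_induction (motive := fun p _ => 0 ≤ (β + extInt (m • α₀)) (toGp p))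
      ?_ ?_ ?_ hp
    · intro r hr
      rw [AddMonoidHom.add_apply, extInt_toGp]
      by_cases hrF : r ∈ F
      · rw [hβ r hrF]; positivity
      · have h1 : 1 ≤ α₀ r := Nat.one_le_iff_ne_zero.2 fun h => hrF ((h₀ r).1 h)
        have h2 : (β (toGp r)).natAbs ≤ m :=
          Finset.single_le_sum (f := fun r => (β (toGp r)).natAbs) (fun _ _ => Nat.zero_le _) hr
        have h3 : m ≤ (m • α₀) r := by
          simpa using Nat.mul_le_mul_left m h1
        omega
    · simp
    · intro x y _ _ hx hy
      simp only [map_add] at *; exact add_nonneg hx hy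
  obtain ⟨α, hα⟩ := exists_extInt_eq _ hnn
  have hm : ∀ a ∈ F, (m • α₀) a = 0 := fun a ha => by simp [(h₀ a).2 ha]
  refine ⟨α, m • α₀, fun a ha => ?_, hm, by rw [hα]; abel⟩
  have := DFunLike.congr_fun hα (toGp a)
  rw [AddMonoidHom.add_apply, extInt_toGp, extInt_toGp, hβ a ha, hm a ha] at this
  simpa using this

/-- The group of a face is cut out by integral functionals, so it contains `x` once it contains a
nonzero multiple of `x`. Freeness supplies the splittings and the duality used below. -/
theorem IsWeaklyToric.free_quotient (hP : IsWeaklyToric P) {F : AddSubmonoid P} (hF : IsFace F) :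
    Module.Free ℤ (Gp P ⧸ faceSpan F) := by
  have := hP.finite_gp
  have : Module.IsTorsionFree ℤ (Gp P ⧸ faceSpan F) := by
    rw [Module.isTorsionFree_iff_smul_eq_zero]
    intro n x h
    obtain ⟨g, rfl⟩ := Submodule.mkQ_surjective _ x
    by_cases hn : n = 0
    · exact Or.inl hn
    right
    rw [← map_smul, Submodule.mkQ_apply, Submodule.Quotient.mk_eq_zero] at h
    rw [Submodule.mkQ_apply, Submodule.Quotient.mk_eq_zero]
    refine hP.mem_faceSpan hF fun α hα => ?_
    have := extInt_eq_zero_of_mem_faceSpan hα h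
    rw [map_zsmul, smul_eq_mul] at this
    exact (mul_eq_zero.1 this).resolve_left hn
  exact Module.free_of_finite_type_torsion_free'

theorem IsWeaklyToric.exists_add_eq_add (hP : IsWeaklyToric P) {F : AddSubmonoid P}
    {p p' : P} (h : (faceSpan F).mkQ (toGp p) = (faceSpan F).mkQ (toGp p')) :
    ∃ a ∈ F, ∃ a' ∈ F, p + a = p' + a' := by
  rw [Submodule.mkQ_apply, Submodule.mkQ_apply, Submodule.Quotient.eq] at h
  obtain ⟨a, ha, b, hb, e⟩ := exists_of_mem_faceSpan h
  refine ⟨b, hb, a, ha, hP.toGp_injective ?_⟩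
  simp only [map_add] at *
  rw [eq_add_of_sub_eq e]; abel

/-- A morphism from `P^gp` to the quotient of `Q^gp` by a face lifts to a morphism `P → Q` if it
is compatible with the positivity structures. -/
theorem IsWeaklyToric.exists_lift (hP : IsWeaklyToric P) (hQ : IsWeaklyToric Q)
    {F : AddSubmonoid P} (hF : IsFace F) {E : AddSubmonoid Q} (hE : IsFace E)
    (τ : Gp P →ₗ[ℤ] Gp Q ⧸ faceSpan E) (hτF : ∀ a ∈ F, τ (toGp a) = 0)
    (hτ : ∀ p : P, ∀ β : Q →+ ℕ, (∀ e ∈ E, β e = 0) → ∀ g : Gp Q,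
      (faceSpan E).mkQ g = τ (toGp p) → 0 ≤ extInt β g) :
    ∃ κ : P →+ Q, (∀ a ∈ F, κ a = 0) ∧ ∀ p, (faceSpan E).mkQ (toGp (κ p)) = τ (toGp p) := by
  classical
  have := hQ.free_quotient hE
  obtain ⟨σ, hσ⟩ := (faceSpan E).mkQ.exists_rightInverse_of_surjective
    (LinearMap.range_eq_top.2 (Submodule.mkQ_surjective _))
  have hσ' : ∀ x, (faceSpan E).mkQ (σ x) = x := fun x => LinearMap.congr_fun hσ x
  have key : ∀ p : P, ∃ q : Q, ∃ e ∈ E, σ (τ (toGp p)) + toGp e = toGp q := fun p =>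
    hQ.exists_add_eq hE _ fun β hβ => hτ p β hβ _ (hσ' _)
  choose q e he hqe using key
  obtain ⟨S, hS, hfin⟩ := (AddMonoid.fg_iff (M := P)).1 hP.fg
  lift S to Finset P using hfin
  obtain ⟨α₀, h₀⟩ := hP.exists_eq_zero_iff hF
  -- The section `σ` need not land in `Q`; each generator needs a correction `e r` from the face
  -- `E`. Adding `α₀(p) u` keeps the map additive and zero on `F`, changes nothing modulo `E`, and
  -- provides every generator outside `F` with at least one copy of its `e r`.
  let u : Q := ∑ r ∈ S, e r
  have hu : u ∈ E := sum_mem fun r _ => he r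
  let k₁ : P →+ Gp Q := ((σ.comp τ).toAddMonoidHom.comp toGp) +
    ((AddMonoidHom.flip (smulAddHom ℕ (Gp Q)) (toGp u)).comp α₀)
  have hk₁ : ∀ p, k₁ p = σ (τ (toGp p)) + α₀ p • toGp u := fun p => rfl
  have himg : ∀ p : P, ∃ q : Q, toGp q = k₁ p := by
    intro p
    have hp : p ∈ AddSubmonoid.closure (S : Set P) := hS ▸ AddSubmonoid.mem_top p
    refine AddSubmonoid.closure_induction (motive := fun p _ => ∃ q : Q, toGp q = k₁ p) ?_ ?_ ?_ hp
    · intro r hr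
      by_cases hrF : r ∈ F
      · exact ⟨0, by rw [hk₁, hτF r hrF, (h₀ r).2 hrF]; simp⟩
      · obtain ⟨m, hm⟩ : ∃ m, α₀ r = m + 1 :=
          ⟨α₀ r - 1, by have : α₀ r ≠ 0 := fun h => hrF ((h₀ r).1 h); omega⟩
        refine ⟨q r + ∑ r' ∈ S.erase r, e r' + m • u, ?_⟩
        have hu' : toGp u = toGp (e r) + toGp (∑ r' ∈ S.erase r, e r') := by
          rw [← map_add, Finset.add_sum_erase S e hr]
        rw [hk₁, hm, add_smul, one_smul]
        nth_rewrite 2 [hu']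
        simp only [map_add, map_nsmul] at hqe ⊢
        rw [← hqe]; abel
    · exact ⟨0, by simp⟩
    · rintro x y _ _ ⟨a, ha⟩ ⟨b, hb⟩
      exact ⟨a + b, by rw [map_add, map_add, ha, hb]⟩
  choose κ hκ using himg
  refine ⟨⟨⟨κ, hQ.toGp_injective ?_⟩, fun x y => hQ.toGp_injective ?_⟩, fun a ha =>
    hQ.toGp_injective ?_, fun p => ?_⟩
  · rw [hκ, map_zero]; simp
  · simp only [map_add] at *
    rw [hκ, hκ, hκ, map_add]
  · show toGp (κ a) = _
    rw [hκ, hk₁, hτF a ha, (h₀ a).2 ha]; simp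
  · show (faceSpan E).mkQ (toGp (κ p)) = _
    rw [hκ, hk₁, map_add, hσ', map_nsmul, Submodule.mkQ_apply _ (toGp u),
      (Submodule.Quotient.mk_eq_zero _).2 (toGp_mem_faceSpan hu)]
    simp

/-- If `θ₀ : Q → P` induces a bijection from the morphisms `P → ℕ` vanishing on the face `F` to the
morphisms `Q → ℕ` vanishing on the face `E`, then there are morphisms `θ : Q → P` and `κ : P → Q`
which are mutually inverse modulo the faces, with `θ` equal to `θ₀` modulo `F`. -/
theorem IsWeaklyToric.exists_quasi_inverse (hP : IsWeaklyToric P) (hQ : IsWeaklyToric Q)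
    {F : AddSubmonoid P} (hF : IsFace F) {E : AddSubmonoid Q} (hE : IsFace E) (θ₀ : Q → P)
    (hadd : ∀ α : P →+ ℕ, (∀ a ∈ F, α a = 0) → ∃ β : Q →+ ℕ, (∀ e ∈ E, β e = 0) ∧
      ∀ q, α (θ₀ q) = β q)
    (hinj : ∀ α α' : P →+ ℕ, (∀ a ∈ F, α a = 0) → (∀ a ∈ F, α' a = 0) →
      (∀ q, α (θ₀ q) = α' (θ₀ q)) → α = α')
    (hsurj : ∀ β : Q →+ ℕ, (∀ e ∈ E, β e = 0) → ∃ α : P →+ ℕ, (∀ a ∈ F, α a = 0) ∧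
      ∀ q, α (θ₀ q) = β q) :
    ∃ (θ : Q →+ P) (κ : P →+ Q), (∀ e ∈ E, θ e = 0) ∧ (∀ a ∈ F, κ a = 0) ∧
      (∀ q, ∃ a ∈ F, ∃ a' ∈ F, θ q + a = θ₀ q + a') ∧
      (∀ q, ∃ e ∈ E, ∃ e' ∈ E, κ (θ q) + e = q + e') ∧
      (∀ p, ∃ a ∈ F, ∃ a' ∈ F, θ (κ p) + a = p + a') := by
  have := hP.finite_gp
  have := hQ.finite_gp
  have := hP.free_quotient hF
  have := hQ.free_quotient hE
  have mk0 : ∀ g : Gp P, g ∈ faceSpan F → (faceSpan F).mkQ g = 0 := fun g hg => by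
    rwa [Submodule.mkQ_apply, Submodule.Quotient.mk_eq_zero]
  -- The choice `θ₀` becomes additive modulo the face, because every morphism to `ℕ` killing the
  -- face sees it as additive and these morphisms detect the group of the face.
  let t₀ : Q →+ Gp P ⧸ faceSpan F :=
    { toFun := fun q => (faceSpan F).mkQ (toGp (θ₀ q))
      map_zero' := mk0 _ <| hP.mem_faceSpan hF fun α hα => by
        obtain ⟨β, -, h⟩ := hadd α hα
        rw [extInt_toGp, h, map_zero]; rfl
      map_add' := fun q q' => by
        rw [← map_add, ← sub_eq_zero, ← map_sub]
        refine mk0 _ (hP.mem_faceSpan hF fun α hα => ?_)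
        obtain ⟨β, -, h⟩ := hadd α hα
        rw [map_sub, map_add, extInt_toGp, extInt_toGp, extInt_toGp, h, h, h, map_add]
        push_cast; ring }
  let t₁ : Gp Q →ₗ[ℤ] Gp P ⧸ faceSpan F := (gpLift t₀).toIntLinearMap
  have ht₁ : ∀ q, t₁ (toGp q) = (faceSpan F).mkQ (toGp (θ₀ q)) := fun q => gpLift_toGp t₀ q
  have ht₁E : ∀ e ∈ E, t₁ (toGp e) = 0 := fun e he => by
    rw [ht₁]
    refine mk0 _ (hP.mem_faceSpan hF fun α hα => ?_)
    obtain ⟨β, hβ, h⟩ := hadd α hα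
    rw [extInt_toGp, h, hβ e he]; rfl
  let t : (Gp Q ⧸ faceSpan E) →ₗ[ℤ] Gp P ⧸ faceSpan F := (faceSpan E).liftQ t₁ <| by
    refine Submodule.span_le.2 ?_
    rintro _ ⟨e, he, rfl⟩
    exact ht₁E e he
  have ht : ∀ g, t ((faceSpan E).mkQ g) = t₁ g := fun g => rfl
  let desc : ∀ α : P →+ ℕ, (∀ a ∈ F, α a = 0) → (Gp P ⧸ faceSpan F →ₗ[ℤ] ℤ) := fun α hα =>
    (faceSpan F).liftQ (extInt α).toIntLinearMap fun g hg => extInt_eq_zero_of_mem_faceSpan hα hg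
  -- Pass to the dual: an integral functional on either quotient is a difference of morphisms to `ℕ`
  -- killing the face, and on those the bijection is given.
  have hbij : Function.Bijective t := by
    refine bijective_of_dualMap_bijective t ⟨?_, fun δ => ?_⟩
    · rw [injective_iff_map_eq_zero]
      intro γ hγ
      obtain ⟨α, α', hα, hα', e⟩ := hP.exists_sub hF (γ.comp (faceSpan F).mkQ).toAddMonoidHom
        fun a ha => by
          show γ ((faceSpan F).mkQ (toGp a)) = 0
          rw [mk0 _ (toGp_mem_faceSpan ha), map_zero]
      have : α = α' := by
        refine hinj α α' hα hα' fun q => ?_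
        have h1 : γ ((faceSpan F).mkQ (toGp (θ₀ q))) = 0 := by
          rw [← ht₁, ← ht]; exact LinearMap.congr_fun hγ _
        have h2 : γ ((faceSpan F).mkQ (toGp (θ₀ q))) = _ := DFunLike.congr_fun e (toGp (θ₀ q))
        rw [h1, AddMonoidHom.sub_apply, extInt_toGp, extInt_toGp] at h2
        omega
      rw [this, sub_self] at e
      ext x
      exact DFunLike.congr_fun e x
    · obtain ⟨β, β', hβ, hβ', e⟩ := hQ.exists_sub hE (δ.comp (faceSpan E).mkQ).toAddMonoidHom
        fun a ha => by
          show δ ((faceSpan E).mkQ (toGp a)) = 0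
          rw [Submodule.mkQ_apply, (Submodule.Quotient.mk_eq_zero _).2 (toGp_mem_faceSpan ha),
            map_zero]
      obtain ⟨α, hα, hαβ⟩ := hsurj β hβ
      obtain ⟨α', hα', hαβ'⟩ := hsurj β' hβ'
      refine ⟨desc α hα - desc α' hα', ?_⟩
      refine LinearMap.cancel_right (Submodule.mkQ_surjective (faceSpan E)) |>.1 ?_
      refine LinearMap.toAddMonoidHom_injective (e ▸ gp_hom_ext fun q => ?_)
      show (desc α hα - desc α' hα') (t ((faceSpan E).mkQ (toGp q))) = _
      rw [ht, ht₁, LinearMap.sub_apply, AddMonoidHom.sub_apply, extInt_toGp, extInt_toGp, ← hαβ,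
        ← hαβ', ← extInt_toGp, ← extInt_toGp]
      rfl
  let T := LinearEquiv.ofBijective t hbij
  have hpos : ∀ q : Q, ∀ α : P →+ ℕ, (∀ a ∈ F, α a = 0) → ∀ g : Gp P,
      (faceSpan F).mkQ g = t₁ (toGp q) → 0 ≤ extInt α g := by
    intro q α hα g hg
    have : extInt α g = extInt α (toGp (θ₀ q)) := by
      rw [ht₁] at hg
      exact congrArg (desc α hα) hg
    rw [this, extInt_toGp]; positivity
  obtain ⟨θ, hθE, hθ⟩ := hQ.exists_lift hP hE hF t₁ ht₁E hpos
  -- For positivity of the inverse, a morphism `β` on `Q` is `α ∘ t` for some `α` on `P`, so its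
  -- value on a lift of `T⁻¹ p` is `α p ≥ 0`.
  obtain ⟨κ, hκF, hκ⟩ := hP.exists_lift hQ hF hE (T.symm.toLinearMap.comp (faceSpan F).mkQ)
    (fun a ha => by
      show T.symm ((faceSpan F).mkQ (toGp a)) = 0
      rw [mk0 _ (toGp_mem_faceSpan ha), map_zero])
    (fun p β hβ g hg => by
      obtain ⟨α, hα, hαβ⟩ := hsurj β hβ
      have h1 : t₁ g = (faceSpan F).mkQ (toGp p) := by
        rw [← ht, hg]; exact T.apply_symm_apply _
      have h2 : extInt β g = desc α hα (t₁ g) := by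
        have : extInt β = ((desc α hα).comp t₁).toAddMonoidHom := gp_hom_ext fun q => by
          show _ = desc α hα (t₁ (toGp q))
          rw [ht₁, extInt_toGp, ← hαβ, ← extInt_toGp]; rfl
        rw [this]; rfl
      rw [h2, h1]
      show 0 ≤ extInt α (toGp p)
      rw [extInt_toGp]; positivity)
  have hκ' : ∀ p, (faceSpan E).mkQ (toGp (κ p)) = T.symm ((faceSpan F).mkQ (toGp p)) := hκ
  refine ⟨θ, κ, hθE, hκF, fun q => hP.exists_add_eq_add ((hθ q).trans (ht₁ q)), fun q => ?_,
    fun p => ?_⟩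
  · refine hQ.exists_add_eq_add ?_
    rw [hκ', hθ, ← ht]
    exact T.symm_apply_apply _
  · refine hP.exists_add_eq_add ?_
    rw [hθ, ← ht, hκ']
    exact T.apply_symm_apply _

end Monoid

section ModelPoints

variable {P : Type*} [AddCommMonoid P] {Q : Type*} [AddCommMonoid Q]

/-! ### Points of the model spaces -/

/-- The point of `X_P` with prescribed values. -/
def modelPoint (f : P → ℝ≥0) (h0 : f 0 = 1) (hadd : ∀ p q, f (p + q) = f p * f q) :
    ModelSpace P :=
  { toFun := fun p => f p.toAdd
    map_one' := h0
    map_mul' := fun p q => hadd p.toAdd q.toAdd }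

@[simp] theorem lam_modelPoint (f : P → ℝ≥0) (h0 : f 0 = 1)
    (hadd : ∀ p q, f (p + q) = f p * f q) (p : P) : lam p (modelPoint f h0 hadd) = f p := rfl

theorem model_ext {x y : ModelSpace P} (h : ∀ p, lam p x = lam p y) : x = y :=
  MonoidHom.ext (f := (show Multiplicative P →* ℝ≥0 from x)) fun p => h p.toAdd

theorem model_ext_of_closure {S : Set P} (hS : AddSubmonoid.closure S = ⊤) {x y : ModelSpace P}
    (h : ∀ p ∈ S, lam p x = lam p y) : x = y := by
  refine model_ext fun p => ?_
  have hp : p ∈ AddSubmonoid.closure S := hS ▸ AddSubmonoid.mem_top p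
  refine AddSubmonoid.closure_induction (motive := fun p _ => lam p x = lam p y) h ?_ ?_ hp
  · rw [lam_zero, lam_zero]
  · intro a b _ _ ha hb; rw [lam_add, lam_add, ha, hb]

theorem tendsto_model_iff {ι : Type*} {l : Filter ι} {F : ι → ModelSpace P} {x : ModelSpace P} :
    Tendsto F l (𝓝 x) ↔ ∀ p, Tendsto (fun i => lam p (F i)) l (𝓝 (lam p x)) := by
  rw [nhds_induced, tendsto_comap_iff, tendsto_pi_nhds]; rfl

theorem continuousOn_model_iff {X : Type*} [TopologicalSpace X] {F : X → ModelSpace P}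
    {s : Set X} : ContinuousOn F s ↔ ∀ p, ContinuousOn (fun i => lam p (F i)) s := by
  simp only [ContinuousOn, ContinuousWithinAt, tendsto_model_iff]
  exact ⟨fun h p x hx => h x hx p, fun h x hx p => h p x hx⟩

/-- The face of the monoid elements which do not vanish at a point. -/
def supportFace (x : ModelSpace P) : AddSubmonoid P where
  carrier := {p | lam p x ≠ 0}
  zero_mem' := by
    show lam 0 x ≠ 0
    rw [lam_zero]; exact one_ne_zero
  add_mem' := by
    intro a b ha hb
    show lam (a + b) x ≠ 0
    rw [lam_add]; exact mul_ne_zero ha hb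

theorem mem_supportFace {x : ModelSpace P} {p : P} : p ∈ supportFace x ↔ lam p x ≠ 0 := Iff.rfl

theorem isFace_supportFace (x : ModelSpace P) : IsFace (supportFace x) := by
  intro a b h
  rw [mem_supportFace, lam_add] at h
  exact left_ne_zero_of_mul h

theorem pos_of_mem_supportFace {x : ModelSpace P} {p : P} (h : p ∈ supportFace x) : 0 < lam p x :=
  pos_iff_ne_zero.2 h

/-- The action of `Hom(P, ℝ)` on `X_P` through the exponential. -/
noncomputable def scale (w : P →+ ℝ) (x : ModelSpace P) : ModelSpace P :=
  modelPoint (fun p => Real.toNNReal (Real.exp (w p)) * lam p x)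
    (by rw [map_zero, lam_zero, Real.exp_zero, Real.toNNReal_one, one_mul])
    fun p q => by
      rw [map_add, lam_add, Real.exp_add, Real.toNNReal_mul (Real.exp_pos _).le]; ring

theorem lam_scale (w : P →+ ℝ) (x : ModelSpace P) (p : P) :
    (lam p (scale w x) : ℝ) = Real.exp (w p) * lam p x := by
  rw [scale, lam_modelPoint, NNReal.coe_mul, Real.coe_toNNReal _ (Real.exp_pos _).le]

theorem scale_zero (x : ModelSpace P) : scale 0 x = x :=
  model_ext fun p => NNReal.coe_injective (by rw [lam_scale]; simp)

/-- The pullback of points along a morphism of monoids. -/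
def precomp (κ : P →+ Q) (y : ModelSpace Q) : ModelSpace P :=
  modelPoint (fun p => lam (κ p) y) (by rw [map_zero, lam_zero])
    fun p q => by rw [map_add, lam_add]

@[simp] theorem lam_precomp (κ : P →+ Q) (y : ModelSpace Q) (p : P) :
    lam p (precomp κ y) = lam (κ p) y := rfl

theorem tendsto_scale {w : P →+ ℝ} (x : ModelSpace P) :
    Tendsto (fun τ : ℝ => scale (τ • w) x) (𝓝 0) (𝓝 x) := by
  refine tendsto_model_iff.2 fun p => ?_
  rw [← NNReal.tendsto_coe]
  have : Continuous fun τ : ℝ => Real.exp (τ * w p) * lam p x := by fun_prop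
  have h := this.tendsto 0
  simp only [zero_mul, Real.exp_zero, one_mul] at h
  refine h.congr fun τ => ?_
  rw [lam_scale]; rfl

/-! ### Density of the interior -/

/-- The values of a point on its support face extend to an interior point. -/
theorem IsWeaklyToric.exists_interior_extension (hP : IsWeaklyToric P) (x : ModelSpace P) :
    ∃ z ∈ modelInterior P, ∀ p ∈ supportFace x, lam p z = lam p x := by
  let F := supportFace x
  let ℓ : F →+ ℝ :=
    { toFun := fun p => Real.log (lam (p : P) x)
      map_zero' := by simp [lam_zero]
      map_add' := fun p q => by
        rw [AddSubmonoid.coe_add, lam_add, NNReal.coe_mul, Real.log_mul]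
        · exact NNReal.coe_ne_zero.2 p.2
        · exact NNReal.coe_ne_zero.2 q.2 }
  let j : Gp F →+ Gp P := gpLift (toGp.comp F.subtype)
  -- The group completion of the face embeds in that of `P`. Since `ℝ` is divisible, hence
  -- injective, the logarithm of the point extends from the face to `P^gp`.
  have hj : Function.Injective j := by
    rw [injective_iff_map_eq_zero]
    intro g hg
    obtain ⟨a, b, rfl⟩ := gp_exists_sub g
    rw [map_sub, gpLift_toGp, gpLift_toGp, sub_eq_zero] at hg
    have : a = b := Subtype.ext (hP.toGp_injective hg)
    rw [this, sub_self]
  obtain ⟨h, hh⟩ := Module.Baer.extension_property_addMonoidHom (Module.Baer.of_divisible ℝ)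
    j hj (gpLift ℓ)
  refine ⟨modelPoint (fun p => Real.toNNReal (Real.exp (h (toGp p)))) (by simp)
    (fun p q => by rw [map_add, map_add, Real.exp_add, Real.toNNReal_mul (Real.exp_pos _).le]),
    fun p => ?_, fun p hp => ?_⟩
  · rw [lam_modelPoint]; exact Real.toNNReal_pos.2 (Real.exp_pos _)
  · have h1 : h (toGp p) = Real.log (lam p x) := by
      have := DFunLike.congr_fun hh (toGp ⟨p, hp⟩)
      rw [AddMonoidHom.comp_apply, gpLift_toGp, gpLift_toGp] at this
      exact this
    rw [lam_modelPoint, h1, Real.exp_log, Real.toNNReal_coe]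
    exact NNReal.coe_pos.2 (pos_of_mem_supportFace hp)

/-- The point `z · t^β`. -/
def ray (z : ModelSpace P) (β : P →+ ℕ) (t : ℝ≥0) : ModelSpace P :=
  modelPoint (fun p => lam p z * t ^ β p) (by rw [map_zero, lam_zero, pow_zero, one_mul])
    fun p q => by rw [map_add, lam_add, pow_add]; ring

theorem lam_ray (z : ModelSpace P) (β : P →+ ℕ) (t : ℝ≥0) (p : P) :
    lam p (ray z β t) = lam p z * t ^ β p := rfl

@[simp] theorem ray_mem_interior {z : ModelSpace P} (hz : z ∈ modelInterior P) (β : P →+ ℕ) {t : ℝ≥0}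
    (ht : 0 < t) : ray z β t ∈ modelInterior P := fun p =>
  mul_pos (hz p) (pow_pos ht _)

/-- On the face the values are constant, and off it the factor `t ^ β p` has positive exponent. Rays
of this kind make the interior dense and serve to measure orders of vanishing. -/
theorem tendsto_ray {x z : ModelSpace P} (hz : ∀ p ∈ supportFace x, lam p z = lam p x)
    {β : P →+ ℕ} (hβ : ∀ p, β p = 0 ↔ p ∈ supportFace x) :
    Tendsto (ray z β) (𝓝[>] 0) (𝓝 x) := by
  refine tendsto_model_iff.2 fun p => ?_
  show Tendsto (fun t : ℝ≥0 => lam p z * t ^ β p) _ _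
  by_cases hp : p ∈ supportFace x
  · simp only [(hβ p).2 hp, pow_zero, mul_one, hz p hp]; exact tendsto_const_nhds
  · have h0 : lam p x = 0 := not_not.1 hp
    have hc : Continuous fun t : ℝ≥0 => lam p z * t ^ β p := by fun_prop
    have := (hc.tendsto 0).mono_left (nhdsWithin_le_nhds (s := Ioi 0))
    rw [h0]
    rwa [zero_pow fun h => hp ((hβ p).1 h), mul_zero] at this

theorem IsWeaklyToric.neBot_interior (hP : IsWeaklyToric P) (x : ModelSpace P) :
    (𝓝[modelInterior P] x).NeBot := by
  obtain ⟨z, hz, hzx⟩ := hP.exists_interior_extension x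
  obtain ⟨β, hβ⟩ := hP.exists_eq_zero_iff (isFace_supportFace x)
  have h : Tendsto (ray z β) (𝓝[>] 0) (𝓝[modelInterior P] x) :=
    tendsto_nhdsWithin_iff.2 ⟨tendsto_ray hzx hβ,
      eventually_nhdsWithin_of_forall fun t ht => ray_mem_interior hz β ht⟩
  exact h.neBot

theorem IsWeaklyToric.exists_interior_mem (hP : IsWeaklyToric P) {x : ModelSpace P}
    {V : Set (ModelSpace P)} (hV : V ∈ 𝓝 x) : ∃ y ∈ V, y ∈ modelInterior P := by
  have := hP.neBot_interior x
  exact Filter.nonempty_of_mem (f := 𝓝[modelInterior P] x)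
    (Filter.inter_mem (mem_nhdsWithin_of_mem_nhds hV) self_mem_nhdsWithin)

/-- Continuous functions which agree on the interior agree. -/
theorem IsWeaklyToric.eqOn_of_interior (hP : IsWeaklyToric P) {Z : Type*} [TopologicalSpace Z]
    [T2Space Z] {U : Set (ModelSpace P)} (hU : IsOpen U) {f g : ModelSpace P → Z}
    (hf : ContinuousOn f U) (hg : ContinuousOn g U)
    (h : ∀ x ∈ U, x ∈ modelInterior P → f x = g x) : EqOn f g U := by
  intro x hx
  have := hP.neBot_interior x
  have h1 : Tendsto f (𝓝[modelInterior P] x) (𝓝 (f x)) :=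
    (hf.continuousAt (hU.mem_nhds hx)).mono_left nhdsWithin_le_nhds
  have h2 : Tendsto g (𝓝[modelInterior P] x) (𝓝 (g x)) :=
    (hg.continuousAt (hU.mem_nhds hx)).mono_left nhdsWithin_le_nhds
  refine tendsto_nhds_unique_of_eventuallyEq h1 h2 ?_
  filter_upwards [self_mem_nhdsWithin, mem_nhdsWithin_of_mem_nhds (hU.mem_nhds hx)] with y hy hyU
  exact h y hyU hy

/-! ### Continuity and directional derivatives of smooth functions -/

theorem continuous_lam_real (p : P) : Continuous fun x : ModelSpace P => (lam p x : ℝ) :=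
  NNReal.continuous_coe.comp (continuous_lam p)

theorem SmoothReal.continuousOn {U : Set (ModelSpace P)} {f : ModelSpace P → ℝ}
    (hf : SmoothReal U f) : ContinuousOn f U := by
  obtain ⟨n, r, W, g, hW, hg, H⟩ := hf
  have hc : Continuous fun x : ModelSpace P => fun i => (lam (r i) x : ℝ) :=
    continuous_pi fun i => continuous_lam_real (r i)
  exact (hg.continuousOn.comp hc.continuousOn fun x hx => (H x hx).1).congr fun x hx => (H x hx).2

theorem SmoothNonneg.continuousOn {U : Set (ModelSpace P)} {f : ModelSpace P → ℝ≥0}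
    (hf : SmoothNonneg U f) : ContinuousOn f U := by
  intro x hx
  obtain ⟨V, hV, hxV, -, h⟩ := hf.toReal hx
  have := h.continuousOn.continuousAt (hV.mem_nhds hxV)
  exact (NNReal.tendsto_coe.1 this).mono_left nhdsWithin_le_nhds

theorem SmoothMap.continuousOn {U : Set (ModelSpace P)} {F : ModelSpace P → ModelSpace Q}
    (hF : SmoothMap U F) : ContinuousOn F U :=
  continuousOn_model_iff.2 fun q => (hF q).continuousOn

theorem SmoothReal.log {U : Set (ModelSpace P)} {h : ModelSpace P → ℝ} (hh : SmoothReal U h)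
    (hpos : ∀ x ∈ U, 0 < h x) : SmoothReal U (fun x => Real.log (h x)) := by
  refine SmoothReal.comp (k := 1) (f := fun _ => h) (fun _ => hh) (W := {w | 0 < w 0})
    (g := fun w => Real.log (w 0)) ?_ ?_ hpos
  · exact isOpen_lt continuous_const (continuous_apply 0)
  · intro w hw
    exact ((contDiff_apply ℝ ℝ (0 : Fin 1)).contDiffAt.log (ne_of_gt hw)).contDiffWithinAt

theorem SmoothReal.exp {U : Set (ModelSpace P)} {h : ModelSpace P → ℝ} (hh : SmoothReal U h) :
    SmoothReal U (fun x => Real.exp (h x)) :=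
  hh.comp₁ Real.contDiff_exp

/-- The derivative of `a` at `x` along the one-parameter group generated by `w`. -/
noncomputable def dirDeriv (w : P →+ ℝ) (a : ModelSpace P → ℝ) (x : ModelSpace P) : ℝ :=
  deriv (fun τ : ℝ => a (scale (τ • w) x)) 0

theorem dirDeriv_congr {w : P →+ ℝ} {a a' : ModelSpace P → ℝ} {x : ModelSpace P}
    (h : a =ᶠ[𝓝 x] a') : dirDeriv w a x = dirDeriv w a' x :=
  Filter.EventuallyEq.deriv_eq ((tendsto_scale x).eventually h)

theorem hasDerivAt_lam_scale (w : P →+ ℝ) (x : ModelSpace P) (p : P) :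
    HasDerivAt (fun τ : ℝ => (lam p (scale (τ • w) x) : ℝ)) (lam p x * w p) 0 := by
  have h : HasDerivAt (fun τ : ℝ => Real.exp (τ * w p) * lam p x)
      (Real.exp (0 * w p) * (1 * w p) * lam p x) 0 :=
    (((hasDerivAt_id (0 : ℝ)).mul_const (w p)).exp).mul_const _
  rw [zero_mul, Real.exp_zero, one_mul, one_mul, mul_comm] at h
  refine h.congr_of_eventuallyEq (Eventually.of_forall fun τ => ?_)
  exact lam_scale _ _ _

/-- Chain rule: the flow of `w` moves the coordinate `λ_r` with velocity `λ_r w(r)`, a b-vector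
field. The formula makes sense at boundary points too, which gives continuity of the directional
derivative up to the boundary. -/
theorem hasDerivAt_of_eq_comp {n : ℕ} {r : Fin n → P} {W : Set (Fin n → ℝ)}
    {g : (Fin n → ℝ) → ℝ} (hW : IsOpen W) (hg : ContDiffOn ℝ ∞ g W) {a : ModelSpace P → ℝ}
    {x : ModelSpace P} (hx : (fun i => (lam (r i) x : ℝ)) ∈ W)
    (ha : ∀ᶠ y in 𝓝 x, a y = g fun i => (lam (r i) y : ℝ)) (w : P →+ ℝ) :
    HasDerivAt (fun τ : ℝ => a (scale (τ • w) x))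
      (fderiv ℝ g (fun i => (lam (r i) x : ℝ)) fun i => lam (r i) x * w (r i)) 0 := by
  have h1 : HasDerivAt (fun τ : ℝ => fun i => (lam (r i) (scale (τ • w) x) : ℝ))
      (fun i => lam (r i) x * w (r i)) 0 :=
    hasDerivAt_pi.2 fun i => hasDerivAt_lam_scale w x (r i)
  have h2 : HasFDerivAt g (fderiv ℝ g (fun i => (lam (r i) x : ℝ)))
      (fun i => (lam (r i) (scale ((0 : ℝ) • w) x) : ℝ)) := by
    rw [zero_smul, scale_zero]
    exact ((hg.contDiffAt (hW.mem_nhds hx)).differentiableAt (by simp)).hasFDerivAt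
  exact (h2.comp_hasDerivAt (0 : ℝ) h1).congr_of_eventuallyEq ((tendsto_scale x).eventually ha)

theorem SmoothReal.hasDerivAt {U : Set (ModelSpace P)} (hU : IsOpen U) {a : ModelSpace P → ℝ}
    (ha : SmoothReal U a) {x : ModelSpace P} (hx : x ∈ U) (w : P →+ ℝ) :
    HasDerivAt (fun τ : ℝ => a (scale (τ • w) x)) (dirDeriv w a x) 0 := by
  obtain ⟨n, r, W, g, hW, hg, H⟩ := ha
  have h := hasDerivAt_of_eq_comp hW hg (H x hx).1
    (mem_of_superset (hU.mem_nhds hx) fun y hy => (H y hy).2) w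
  rw [dirDeriv, h.deriv]; exact h

theorem SmoothReal.continuousOn_dirDeriv {U : Set (ModelSpace P)} (hU : IsOpen U)
    {a : ModelSpace P → ℝ} (ha : SmoothReal U a) (w : P →+ ℝ) :
    ContinuousOn (dirDeriv w a) U := by
  obtain ⟨n, r, W, g, hW, hg, H⟩ := ha
  have hc : Continuous fun x : ModelSpace P => fun i => (lam (r i) x : ℝ) :=
    continuous_pi fun i => continuous_lam_real (r i)
  have hc' : Continuous fun x : ModelSpace P => fun i => (lam (r i) x : ℝ) * w (r i) :=
    continuous_pi fun i => (continuous_lam_real (r i)).mul continuous_const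
  have h1 : ContinuousOn (fun x : ModelSpace P =>
      fderiv ℝ g (fun i => (lam (r i) x : ℝ)) fun i => lam (r i) x * w (r i)) U :=
    ((hg.continuousOn_fderiv_of_isOpen hW (by simp)).comp hc.continuousOn
      fun x hx => (H x hx).1).clm_apply hc'.continuousOn
  refine h1.congr fun x hx => ?_
  exact (hasDerivAt_of_eq_comp hW hg (H x hx).1
    (mem_of_superset (hU.mem_nhds hx) fun y hy => (H y hy).2) w).deriv

theorem scale_zero_smul (w : P →+ ℝ) (x : ModelSpace P) : scale ((0 : ℝ) • w) x = x := by
  rw [zero_smul, scale_zero]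

theorem dirDeriv_add {U : Set (ModelSpace P)} (hU : IsOpen U) {a b : ModelSpace P → ℝ}
    (ha : SmoothReal U a) (hb : SmoothReal U b) {x : ModelSpace P} (hx : x ∈ U) (w : P →+ ℝ) :
    dirDeriv w (fun y => a y + b y) x = dirDeriv w a x + dirDeriv w b x :=
  ((ha.hasDerivAt hU hx w).add (hb.hasDerivAt hU hx w)).deriv

theorem dirDeriv_mul {U : Set (ModelSpace P)} (hU : IsOpen U) {a b : ModelSpace P → ℝ}
    (ha : SmoothReal U a) (hb : SmoothReal U b) {x : ModelSpace P} (hx : x ∈ U) (w : P →+ ℝ) :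
    dirDeriv w (fun y => a y * b y) x = dirDeriv w a x * b x + a x * dirDeriv w b x := by
  have := ((ha.hasDerivAt hU hx w).mul (hb.hasDerivAt hU hx w)).deriv
  simp only [scale_zero_smul] at this
  exact this

theorem dirDeriv_lam (w : P →+ ℝ) (p : P) (x : ModelSpace P) :
    dirDeriv w (fun y => (lam p y : ℝ)) x = lam p x * w p :=
  (hasDerivAt_lam_scale w x p).deriv

theorem dirDeriv_log {U : Set (ModelSpace P)} (hU : IsOpen U) {h : ModelSpace P → ℝ}
    (hh : SmoothReal U h) {x : ModelSpace P} (hx : x ∈ U) (hpos : 0 < h x) (w : P →+ ℝ) :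
    dirDeriv w (fun y => Real.log (h y)) x = dirDeriv w h x / h x := by
  have := ((hh.hasDerivAt hU hx w).log (by rw [scale_zero_smul]; exact hpos.ne')).deriv
  simp only [scale_zero_smul] at this
  exact this

/-! ### Local representations of interior functions -/

/-- `f = lam p * h` near `x`, with `h` smooth and positive. -/
def LocalRep (f : ModelSpace P → ℝ≥0) (x : ModelSpace P) (p : P) (h : ModelSpace P → ℝ) : Prop :=
  ∃ U : Set (ModelSpace P), IsOpen U ∧ x ∈ U ∧ SmoothReal U h ∧
    ∀ y ∈ U, 0 < h y ∧ (f y : ℝ) = lam p y * h y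

theorem localRep_lam (p : P) (x : ModelSpace P) : LocalRep (lam p) x p (fun _ => 1) :=
  ⟨univ, isOpen_univ, mem_univ _, smoothReal_const _ 1, fun _ _ => ⟨one_pos, (mul_one _).symm⟩⟩

theorem LocalRep.congr {f f' : ModelSpace P → ℝ≥0} {x : ModelSpace P} {p : P}
    {h : ModelSpace P → ℝ} (H : LocalRep f x p h) (hff' : f' =ᶠ[𝓝 x] f) : LocalRep f' x p h := by
  obtain ⟨U, hU, hx, hh, H⟩ := H
  obtain ⟨V, hV, hVo, hxV⟩ := eventually_nhds_iff.1 hff'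
  exact ⟨U ∩ V, hU.inter hVo, ⟨hx, hxV⟩, hh.mono inter_subset_left, fun y hy =>
    ⟨(H y hy.1).1, by rw [hV y hy.2]; exact (H y hy.1).2⟩⟩

theorem LocalRep.mul {f f' : ModelSpace P → ℝ≥0} {x : ModelSpace P} {p p' : P}
    {h h' : ModelSpace P → ℝ} (H : LocalRep f x p h) (H' : LocalRep f' x p' h') :
    LocalRep (fun y => f y * f' y) x (p + p') (fun y => h y * h' y) := by
  obtain ⟨U, hU, hx, hh, H⟩ := H
  obtain ⟨U', hU', hx', hh', H'⟩ := H'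
  refine ⟨U ∩ U', hU.inter hU', ⟨hx, hx'⟩, (hh.mono inter_subset_left).mul
    (hh'.mono inter_subset_right), fun y hy => ⟨mul_pos (H y hy.1).1 (H' y hy.2).1, ?_⟩⟩
  rw [NNReal.coe_mul, (H y hy.1).2, (H' y hy.2).2, lam_add, NNReal.coe_mul]; ring

/-- The alternative that `f` vanishes near `x` contradicts density of the interior. -/
theorem IsWeaklyToric.exists_localRep (hP : IsWeaklyToric P) {U : Set (ModelSpace P)}
    {f : ModelSpace P → ℝ≥0} (hf : SmoothNonneg U f)
    (hpos : ∀ y ∈ U, y ∈ modelInterior P → 0 < f y) {x : ModelSpace P} (hx : x ∈ U) :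
    ∃ p h, LocalRep f x p h := by
  obtain ⟨V, hV, hxV, hVU, ⟨p, h, hh, H⟩ | H⟩ := hf x hx
  · exact ⟨p, h, V, hV, hxV, hh, H⟩
  · exfalso
    obtain ⟨y, hyV, hyi⟩ := hP.exists_interior_mem (hV.mem_nhds hxV)
    exact (hpos y (hVU hyV) hyi).ne' (H y hyV)

namespace LocalRep

variable {f : ModelSpace P → ℝ≥0} {x : ModelSpace P} {p p' : P} {h h' : ModelSpace P → ℝ}

theorem eventually (H : LocalRep f x p h) :
    ∀ᶠ y in 𝓝 x, 0 < h y ∧ (f y : ℝ) = lam p y * h y := by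
  obtain ⟨U, hU, hx, -, H⟩ := H
  exact mem_of_superset (hU.mem_nhds hx) H

theorem pos (H : LocalRep f x p h) : 0 < h x := H.eventually.self_of_nhds.1

theorem tendsto (H : LocalRep f x p h) : Tendsto h (𝓝 x) (𝓝 (h x)) := by
  obtain ⟨U, hU, hx, hh, -⟩ := H
  exact hh.continuousOn.continuousAt (hU.mem_nhds hx)

theorem ne_zero_iff (H : LocalRep f x p h) : f x ≠ 0 ↔ p ∈ supportFace x := by
  rw [mem_supportFace, ← NNReal.coe_ne_zero, H.eventually.self_of_nhds.2, mul_ne_zero_iff,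
    NNReal.coe_ne_zero]
  exact and_iff_left H.pos.ne'

/-- Along the ray `z t^β` towards `x`, the two representations say that `f` vanishes to exact order
`β p` and `β p'` in `t`. -/
theorem not_lt (hP : IsWeaklyToric P) (H : LocalRep f x p h) (H' : LocalRep f x p' h')
    {β : P →+ ℕ} (hβ : ∀ p, β p = 0 ↔ p ∈ supportFace x) : ¬ β p < β p' := by
  intro hlt
  obtain ⟨z, hz, hzx⟩ := hP.exists_interior_extension x
  have hr := tendsto_ray hzx hβ
  -- After division by `t ^ β p`, one side tends to a positive limit and the other to zero.
  obtain ⟨m, hm⟩ : ∃ m, β p' = β p + (m + 1) := ⟨β p' - β p - 1, by omega⟩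
  have h1 : Tendsto (fun t : ℝ≥0 => (lam p z : ℝ) * h (ray z β t)) (𝓝[>] 0)
      (𝓝 (lam p z * h x)) := tendsto_const_nhds.mul (H.tendsto.comp hr)
  have h2 : Tendsto (fun t : ℝ≥0 => (lam p' z : ℝ) * t ^ (m + 1) * h' (ray z β t)) (𝓝[>] 0)
      (𝓝 (lam p' z * 0 * h' x)) := by
    refine (tendsto_const_nhds.mul ?_).mul (H'.tendsto.comp hr)
    have : Continuous fun t : ℝ≥0 => (t : ℝ) ^ (m + 1) := by fun_prop
    have := (this.tendsto 0).mono_left (nhdsWithin_le_nhds (s := Ioi 0))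
    simpa using this
  have heq : (fun t : ℝ≥0 => (lam p z : ℝ) * h (ray z β t)) =ᶠ[𝓝[>] 0]
      fun t : ℝ≥0 => (lam p' z : ℝ) * t ^ (m + 1) * h' (ray z β t) := by
    filter_upwards [self_mem_nhdsWithin, hr.eventually H.eventually, hr.eventually H'.eventually]
      with t ht h1 h2
    have e := h1.2.symm.trans h2.2
    have ht' : (0 : ℝ) < (t : ℝ) ^ β p := pow_pos (NNReal.coe_pos.2 ht) _
    simp only [lam_ray, NNReal.coe_mul, NNReal.coe_pow, hm, pow_add _ (β p)] at e
    apply mul_left_cancel₀ ht'.ne'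
    linear_combination e
  have := tendsto_nhds_unique_of_eventuallyEq h1 h2 heq
  rw [mul_zero, zero_mul] at this
  exact (mul_pos (NNReal.coe_pos.2 (hz p)) H.pos).ne' this

/-- A ray towards `x` needs an exponent vanishing exactly on the support face, and `α` may vanish on
more. Comparing orders for such a `β` and for `α + β` isolates `α`. Thus the exponent of an interior
function is well defined modulo the support face. -/
theorem apply_eq (hP : IsWeaklyToric P) (H : LocalRep f x p h) (H' : LocalRep f x p' h')
    {α : P →+ ℕ} (hα : ∀ a ∈ supportFace x, α a = 0) : α p = α p' := by
  obtain ⟨β, hβ⟩ := hP.exists_eq_zero_iff (isFace_supportFace x)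
  have hβ' : ∀ p, (α + β) p = 0 ↔ p ∈ supportFace x := fun p => by
    rw [AddMonoidHom.add_apply, add_eq_zero, hβ]
    exact ⟨fun h => h.2, fun h => ⟨hα p h, h⟩⟩
  have h1 := H.not_lt hP H' hβ
  have h2 := H'.not_lt hP H hβ
  have h3 := H.not_lt hP H' hβ'
  have h4 := H'.not_lt hP H hβ'
  simp only [AddMonoidHom.add_apply] at h3 h4
  omega

/-- At interior points both sides are the derivative of `log f` along `w`. Each is continuous up to
the boundary, and the interior is dense. This makes b-derivatives independent of the representation.
-/
theorem apply_add_dirDeriv_eq (hP : IsWeaklyToric P) (H : LocalRep f x p h)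
    (H' : LocalRep f x p' h') (w : P →+ ℝ) :
    w p + dirDeriv w (fun y => Real.log (h y)) x =
      w p' + dirDeriv w (fun y => Real.log (h' y)) x := by
  have key : ∀ {p : P} {h : ModelSpace P → ℝ}, LocalRep f x p h →
      Tendsto (dirDeriv w fun y => Real.log (f y)) (𝓝[modelInterior P] x)
        (𝓝 (w p + dirDeriv w (fun y => Real.log (h y)) x)) := by
    rintro p h ⟨U, hU, hx, hh, H⟩
    have hl := hh.log fun y hy => (H y hy).1
    have h1 : Tendsto (fun y => w p + dirDeriv w (fun y => Real.log (h y)) y)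
        (𝓝[modelInterior P] x) (𝓝 (w p + dirDeriv w (fun y => Real.log (h y)) x)) :=
      tendsto_const_nhds.add (((hl.continuousOn_dirDeriv hU w).continuousAt
        (hU.mem_nhds hx)).mono_left nhdsWithin_le_nhds)
    refine h1.congr' ?_
    filter_upwards [self_mem_nhdsWithin, mem_nhdsWithin_of_mem_nhds (hU.mem_nhds hx)] with y hy hyU
    symm
    have h2 : HasDerivAt (fun τ : ℝ => Real.log (lam p y) + τ * w p +
        Real.log (h (scale (τ • w) y))) (1 * w p + dirDeriv w (fun y => Real.log (h y)) y) 0 :=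
      (((hasDerivAt_id (0 : ℝ)).mul_const (w p)).const_add _).add (hl.hasDerivAt hU hyU w)
    rw [one_mul] at h2
    refine (h2.congr_of_eventuallyEq ?_).deriv
    filter_upwards [(tendsto_scale (w := w) y).eventually (hU.mem_nhds hyU)] with τ hτ
    have hτ' := H _ hτ
    have hly : (0 : ℝ) < lam p y := NNReal.coe_pos.2 (hy p)
    rw [hτ'.2, lam_scale, Real.log_mul (mul_pos (Real.exp_pos _) hly).ne' hτ'.1.ne',
      Real.log_mul (Real.exp_pos _).ne' hly.ne', Real.log_exp]
    show τ * w p + _ + _ = _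
    ring
  have := hP.neBot_interior x
  exact tendsto_nhds_unique (key H) (key H')

end LocalRep

/-- A smooth map with a smooth inverse preserves the interior. -/
theorem mem_interior_of_smooth_inverse (hQ : IsWeaklyToric Q) {U : Set (ModelSpace P)}
    {F : ModelSpace P → ModelSpace Q} {G : ModelSpace Q → ModelSpace P} (hF : SmoothMap U F)
    {V : Set (ModelSpace Q)} (hV : IsOpen V) (hGc : ContinuousOn G V)
    (hFG : ∀ y ∈ V, F (G y) = y) {x : ModelSpace P} (hx : x ∈ U) (hFx : F x ∈ V)
    (hGF : G (F x) = x) (hi : x ∈ modelInterior P) : F x ∈ modelInterior Q := by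
  intro q
  obtain ⟨U', hU', hxU', hU'U, ⟨p, h, -, H⟩ | H⟩ := hF q x hx
  · have h1 := H x hxU'
    have : (0 : ℝ) < lam q (F x) := by
      rw [h1.2]; exact mul_pos (NNReal.coe_pos.2 (hi p)) h1.1
    exact this
  -- If `lam q ∘ F` vanished near `x`, composing with `G` would make `lam q` vanish near `F x`,
  -- where there are interior points.
  · exfalso
    have hmem : V ∩ G ⁻¹' U' ∈ 𝓝 (F x) :=
      (hGc.isOpen_inter_preimage hV hU').mem_nhds ⟨hFx, by rwa [mem_preimage, hGF]⟩
    obtain ⟨y, hy, hyi⟩ := hQ.exists_interior_mem hmem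
    have h0 := H _ hy.2
    simp only [hFG y hy.1] at h0
    exact (hyi q).ne' h0

end ModelPoints

/-! ### Hadamard's lemma and the implicit function theorem -/

/-- Differentiate under the integral sign and induct. The target `F` varies in the induction, since
the derivative takes values in `E →L[ℝ] F`. The dominating constant comes from compactness of a ball
times `[0, 1]`. -/
theorem contDiff_integral_nat {E : Type} [NormedAddCommGroup E] [NormedSpace ℝ E]
    [FiniteDimensional ℝ E] (n : ℕ) :
    ∀ {F : Type} [NormedAddCommGroup F] [NormedSpace ℝ F] {f : E × ℝ → F}, ContDiff ℝ ∞ f →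
      ContDiff ℝ n fun z => ∫ t in (0 : ℝ)..1, f (z, t) := by
  have : ProperSpace E := FiniteDimensional.proper ℝ E
  induction n with
  | zero =>
    intro F _ _ f hf
    simp only [Nat.cast_zero, contDiff_zero]
    exact intervalIntegral.continuous_parametric_intervalIntegral_of_continuous'
      (f := fun z t => f (z, t)) hf.continuous 0 1
  | succ n ih =>
    intro F _ _ f hf
    let f' : E × ℝ → E →L[ℝ] F := fun z => (fderiv ℝ f z).comp (ContinuousLinearMap.inl ℝ E ℝ)
    have hf' : ContDiff ℝ ∞ f' := (hf.fderiv_right (m := ∞) (by simp)).clm_comp contDiff_const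
    have hder : ∀ z t, HasFDerivAt (fun z => f (z, t)) (f' (z, t)) z := fun z t =>
      ((hf.differentiable (by simp)).differentiableAt.hasFDerivAt (x := (z, t))).comp z
        (hasFDerivAt_prodMk_left z t)
    have hint : ∀ z₀, HasFDerivAt (fun z => ∫ t in (0 : ℝ)..1, f (z, t))
        (∫ t in (0 : ℝ)..1, f' (z₀, t)) z₀ := by
      intro z₀
      obtain ⟨C, hC⟩ := ((isCompact_closedBall z₀ 1).prod
        (isCompact_Icc (a := (0 : ℝ)) (b := 1))).exists_bound_of_continuousOn
        hf'.continuous.continuousOn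
      refine intervalIntegral.hasFDerivAt_integral_of_dominated_of_fderiv_le
        (F' := fun z t => f' (z, t)) (bound := fun _ => C)
        (Metric.closedBall_mem_nhds z₀ one_pos) ?_ ?_ ?_ ?_ ?_ ?_
      · refine Eventually.of_forall fun z => Continuous.aestronglyMeasurable ?_
        exact hf.continuous.comp (Continuous.prodMk_right z)
      · exact (hf.continuous.comp (Continuous.prodMk_right z₀)).intervalIntegrable _ _
      · exact (hf'.continuous.comp (Continuous.prodMk_right z₀)).aestronglyMeasurable
      · refine Eventually.of_forall fun t ht z hz => hC (z, t) ⟨hz, ?_⟩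
        rw [uIoc_of_le zero_le_one] at ht
        exact Ioc_subset_Icc_self ht
      · exact intervalIntegrable_const
      · exact Eventually.of_forall fun t _ z _ => hder z t
    push_cast
    rw [contDiff_succ_iff_fderiv]
    refine ⟨fun z => (hint z).differentiableAt, fun h => by simp at h, ?_⟩
    have : fderiv ℝ (fun z => ∫ t in (0 : ℝ)..1, f (z, t)) =
        fun z => ∫ t in (0 : ℝ)..1, f' (z, t) := funext fun z => (hint z).fderiv
    rw [this]
    exact ih hf'

theorem contDiff_integral {E : Type} [NormedAddCommGroup E] [NormedSpace ℝ E]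
    [FiniteDimensional ℝ E] {F : Type} [NormedAddCommGroup F] [NormedSpace ℝ F] {f : E × ℝ → F}
    (hf : ContDiff ℝ ∞ f) : ContDiff ℝ ∞ fun z => ∫ t in (0 : ℝ)..1, f (z, t) :=
  contDiff_infty.2 fun n => contDiff_integral_nat n hf

/-- Multiplication by a bump function. A globally smooth representative lets Hadamard's integral run
over segments without regard to the domain of `g`. -/
theorem exists_contDiff_eventuallyEq {E : Type} [NormedAddCommGroup E] [NormedSpace ℝ E]
    [FiniteDimensional ℝ E] {W : Set E} (hW : IsOpen W) {g : E → ℝ} (hg : ContDiffOn ℝ ∞ g W)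
    {z₀ : E} (hz₀ : z₀ ∈ W) : ∃ g' : E → ℝ, ContDiff ℝ ∞ g' ∧ g' =ᶠ[𝓝 z₀] g := by
  obtain ⟨ε, hε, hball⟩ := Metric.nhds_basis_closedBall.mem_iff.1 (hW.mem_nhds hz₀)
  let χ : ContDiffBump z₀ := ⟨ε / 2, ε, half_pos hε, half_lt_self hε⟩
  refine ⟨fun z => χ z * g z, contDiff_iff_contDiffAt.2 fun z => ?_, ?_⟩
  · by_cases hz : z ∈ tsupport χ
    · rw [χ.tsupport_eq] at hz
      exact χ.contDiff.contDiffAt.mul (hg.contDiffAt (hW.mem_nhds (hball hz)))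
    · have : (fun z => χ z * g z) =ᶠ[𝓝 z] fun _ => 0 := by
        filter_upwards [notMem_tsupport_iff_eventuallyEq.1 hz] with y hy
        rw [hy]; simp
      exact contDiffAt_const.congr_of_eventuallyEq this
  · filter_upwards [χ.eventuallyEq_one] with z hz
    rw [hz]; simp

/-- Hadamard's lemma. -/
theorem exists_hadamard {n : ℕ} {g : (Fin n → ℝ) → ℝ} {W : Set (Fin n → ℝ)} (hW : IsOpen W)
    (hg : ContDiffOn ℝ ∞ g W) {z₀ : Fin n → ℝ} (hz₀ : z₀ ∈ W) :
    ∃ G : Fin n → (Fin n → ℝ) → ℝ, (∀ i, ContDiff ℝ ∞ (G i)) ∧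
      (∀ i, G i z₀ = fderiv ℝ g z₀ (Pi.single i 1)) ∧
      ∀ᶠ z in 𝓝 z₀, g z = g z₀ + ∑ i, (z i - z₀ i) * G i z := by
  obtain ⟨g', hg', heq⟩ := exists_contDiff_eventuallyEq hW hg hz₀
  -- The derivative along the segment from `z₀` to `z`. Its partial derivatives, integrated over
  -- `[0, 1]`, are the coefficients `G i`.
  let D : (Fin n → ℝ) × ℝ → (Fin n → ℝ) →L[ℝ] ℝ := fun p =>
    fderiv ℝ g' (z₀ + p.2 • (p.1 - z₀))
  have hγ : ContDiff ℝ ∞ fun p : (Fin n → ℝ) × ℝ => z₀ + p.2 • (p.1 - z₀) :=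
    contDiff_const.add (contDiff_snd.smul (contDiff_fst.sub contDiff_const))
  have hD : ContDiff ℝ ∞ D := (hg'.fderiv_right (m := ∞) (by simp)).comp hγ
  have hDi : ∀ i, ContDiff ℝ ∞ fun p => D p (Pi.single i 1) := fun i =>
    hD.clm_apply contDiff_const
  refine ⟨fun i z => ∫ t in (0 : ℝ)..1, D (z, t) (Pi.single i 1),
    fun i => contDiff_integral (hDi i), fun i => ?_, ?_⟩
  · simp only [D, sub_self, smul_zero, add_zero, intervalIntegral.integral_const, sub_zero,
      one_smul]
    rw [heq.fderiv_eq]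
  · have h0 : g' z₀ = g z₀ := heq.self_of_nhds
    filter_upwards [heq] with z hz
    rw [← hz, ← h0]
    have hder : ∀ t ∈ uIcc (0 : ℝ) 1, HasDerivAt (fun t : ℝ => g' (z₀ + t • (z - z₀)))
        (D (z, t) (z - z₀)) t := by
      intro t _
      have h1 : HasDerivAt (fun t : ℝ => z₀ + t • (z - z₀)) (z - z₀) t := by
        simpa using ((hasDerivAt_id t).smul_const (z - z₀)).const_add z₀
      exact ((hg'.differentiable (by simp)).differentiableAt.hasFDerivAt).comp_hasDerivAt t h1
    have hcont : ∀ v : Fin n → ℝ, Continuous fun t : ℝ => D (z, t) v := fun v =>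
      (hD.clm_apply contDiff_const).continuous.comp (Continuous.prodMk_right z)
    have h := intervalIntegral.integral_eq_sub_of_hasDerivAt hder
      ((hcont _).intervalIntegrable _ _)
    simp only [one_smul, add_sub_cancel, zero_smul, add_zero] at h
    rw [eq_sub_iff_add_eq'] at h
    rw [← h]
    congr 1
    have h2 : ∀ t : ℝ, D (z, t) (z - z₀) = ∑ i, (z i - z₀ i) * D (z, t) (Pi.single i 1) := by
      intro t
      conv_lhs => rw [pi_eq_sum_univ' (z - z₀)]
      simp [map_sum]
    simp only [h2]
    rw [intervalIntegral.integral_finsetSum]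
    · simp only [intervalIntegral.integral_const_mul]
    · exact fun i _ => ((hcont _).const_mul _).intervalIntegrable _ _

/-- The smooth implicit function theorem. -/
theorem exists_implicit_function {E₁ E₂ E₃ : Type*} [NormedAddCommGroup E₁] [NormedSpace ℝ E₁]
    [FiniteDimensional ℝ E₁] [NormedAddCommGroup E₂] [NormedSpace ℝ E₂] [FiniteDimensional ℝ E₂]
    [NormedAddCommGroup E₃] [NormedSpace ℝ E₃] {Φ : E₁ × E₂ → E₃} {W : Set (E₁ × E₂)}
    (hW : IsOpen W) (hΦ : ContDiffOn ℝ ∞ Φ W) {a : E₁} {b : E₂} (hab : (a, b) ∈ W)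
    (h0 : Φ (a, b) = 0) (hbij : Function.Bijective fun w : E₁ => fderiv ℝ Φ (a, b) (w, 0)) :
    ∃ (V : Set E₂) (c : E₂ → E₁), IsOpen V ∧ b ∈ V ∧ ContDiffOn ℝ ∞ c V ∧ c b = a ∧
      (∀ η ∈ V, Φ (c η, η) = 0) ∧ ∀ᶠ z in 𝓝 (a, b), Φ z = 0 → z.1 = c z.2 := by
  have : CompleteSpace (E₁ × E₂) := FiniteDimensional.complete ℝ _
  -- The inverse function theorem is applied to `Ψ`; the implicit function is the first component of
  -- `Ψ⁻¹ (0, η)`.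
  let Ψ : E₁ × E₂ → E₃ × E₂ := fun z => (Φ z, z.2)
  have hΨ : ContDiffOn ℝ ∞ Ψ W := hΦ.prodMk contDiffOn_snd
  have hdΨ : HasFDerivAt Ψ ((fderiv ℝ Φ (a, b)).prod (ContinuousLinearMap.snd ℝ E₁ E₂)) (a, b) :=
    ((hΦ.contDiffAt (hW.mem_nhds hab)).differentiableAt (by simp)).hasFDerivAt.prodMk
      hasFDerivAt_snd
  have hsplit : ∀ u : E₁ × E₂, fderiv ℝ Φ (a, b) u =
      fderiv ℝ Φ (a, b) (u.1, 0) + fderiv ℝ Φ (a, b) (0, u.2) := fun u => by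
    rw [← map_add]; simp
  have hbij' : Function.Bijective (((fderiv ℝ Φ (a, b)).prod
      (ContinuousLinearMap.snd ℝ E₁ E₂)) : E₁ × E₂ →ₗ[ℝ] E₃ × E₂) := by
    constructor
    · rw [injective_iff_map_eq_zero]
      intro u hu
      have h2 : u.2 = 0 := congrArg Prod.snd hu
      have h1 : fderiv ℝ Φ (a, b) u = 0 := congrArg Prod.fst hu
      rw [hsplit, h2] at h1
      have : u.1 = 0 := hbij.1 (by
        have hz : fderiv ℝ Φ (a, b) ((0 : E₁), (0 : E₂)) = 0 := map_zero _
        simpa only [hz, add_zero] using h1)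
      exact Prod.ext this h2
    · rintro ⟨s, η⟩
      obtain ⟨w, hw⟩ := hbij.2 (s - fderiv ℝ Φ (a, b) (0, η))
      refine ⟨(w, η), Prod.ext ?_ rfl⟩
      show fderiv ℝ Φ (a, b) (w, η) = s
      rw [hsplit]
      simp only at hw ⊢
      rw [hw]; abel
  have : FiniteDimensional ℝ (E₃ × E₂) :=
    LinearEquiv.finiteDimensional (LinearEquiv.ofBijective _ hbij')
  let L : (E₁ × E₂) ≃L[ℝ] (E₃ × E₂) := (LinearEquiv.ofBijective _ hbij').toContinuousLinearEquiv
  have hL : HasFDerivAt Ψ (L : (E₁ × E₂) →L[ℝ] (E₃ × E₂)) (a, b) := hdΨ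
  let e₀ := (hΨ.contDiffAt (hW.mem_nhds hab)).toOpenPartialHomeomorph Ψ hL (by simp)
  have hmem : (a, b) ∈ e₀.source :=
    (hΨ.contDiffAt (hW.mem_nhds hab)).mem_toOpenPartialHomeomorph_source hL (by simp)
  -- Restricting to points where the derivative stays invertible makes the inverse smooth on its
  -- whole target, and not merely at the image of `(a, b)`.
  let W' : Set (E₁ × E₂) := W ∩ fderiv ℝ Ψ ⁻¹' range
    (ContinuousLinearEquiv.toContinuousLinearMap : ((E₁ × E₂) ≃L[ℝ] (E₃ × E₂)) → _)
  have hW' : IsOpen W' := (hΨ.continuousOn_fderiv_of_isOpen hW (by simp)).isOpen_inter_preimage hW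
    ContinuousLinearEquiv.isOpen
  have habW' : (a, b) ∈ W' := ⟨hab, L, hL.fderiv.symm⟩
  let e := e₀.restrOpen W' hW'
  have he : ∀ z, e z = Ψ z := fun z => rfl
  have hes : ∀ z, z ∈ e.source → z ∈ W' := fun z hz => hz.2
  have hmem' : (a, b) ∈ e.source := ⟨hmem, habW'⟩
  have hsymm : ContDiffOn ℝ ∞ e.symm e.target := by
    intro y hy
    obtain ⟨hyW, M, hM⟩ := hes _ (e.map_target hy)
    have hc := hΨ.contDiffAt (hW.mem_nhds hyW)
    refine (e.contDiffAt_symm hy (f₀' := M) ?_ hc).contDiffWithinAt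
    rw [hM]
    exact (hc.differentiableAt (by simp)).hasFDerivAt
  let V : Set E₂ := {η | ((0 : E₃), η) ∈ e.target}
  have hVc : Continuous fun η : E₂ => ((0 : E₃), η) := Continuous.prodMk_right 0
  refine ⟨V, fun η => (e.symm (0, η)).1, e.open_target.preimage hVc, ?_, ?_, ?_, ?_, ?_⟩
  · have := e.map_source hmem'
    rw [he] at this
    simp only [Ψ, h0] at this
    exact this
  · exact contDiff_fst.comp_contDiffOn (hsymm.comp (contDiff_prodMk_right 0).contDiffOn
      fun η hη => hη)
  · have := e.left_inv hmem'
    rw [he] at this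
    simp only [Ψ, h0] at this
    exact congrArg Prod.fst this
  · intro η hη
    have h1 : Ψ (e.symm (0, η)) = (0, η) := e.right_inv hη
    have h2 : (e.symm (0, η)).2 = η := congrArg Prod.snd h1
    have h3 : Φ (e.symm (0, η)) = 0 := congrArg Prod.fst h1
    have h4 : ((e.symm (0, η)).1, η) = e.symm (0, η) := Prod.ext rfl h2.symm
    simp only
    rw [h4, h3]
  · filter_upwards [e.open_source.mem_nhds hmem'] with z hz hz0
    have h1 : e z = (0, z.2) := Prod.ext hz0 rfl
    rw [← h1, e.left_inv hz]

/-! ### Normal form of a smooth map at a point -/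

section InverseFunction

variable {P : Type*} [AddCommMonoid P] {Q : Type*} [AddCommMonoid Q]

/-- Restriction of real functionals to a finite set. -/
def restr (S : Finset P) : (P →+ ℝ) →ₗ[ℝ] (S → ℝ) where
  toFun w s := w s
  map_add' _ _ := rfl
  map_smul' _ _ := rfl

@[simp] theorem restr_apply (S : Finset P) (w : P →+ ℝ) (s : S) : restr S w s = w s := rfl

theorem restr_injective {S : Finset P} (hS : AddSubmonoid.closure (S : Set P) = ⊤) :
    Function.Injective (restr S) := by
  intro w w' h
  exact AddMonoidHom.eq_of_eqOn_denseM hS fun s hs => congrFun h ⟨s, hs⟩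

theorem IsWeaklyToric.finiteDimensional (hP : IsWeaklyToric P) :
    FiniteDimensional ℝ (P →+ ℝ) := by
  obtain ⟨S, hS, hfin⟩ := (AddMonoid.fg_iff (M := P)).1 hP.fg
  lift S to Finset P using hfin
  exact FiniteDimensional.of_injective (restr S) (restr_injective hS)

/-- The logarithm of an interior point. -/
noncomputable def logHom {x : ModelSpace P} (hx : x ∈ modelInterior P) : P →+ ℝ where
  toFun p := Real.log (lam p x)
  map_zero' := by simp [lam_zero]
  map_add' p q := by
    rw [lam_add, NNReal.coe_mul, Real.log_mul (NNReal.coe_pos.2 (hx p)).ne'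
      (NNReal.coe_pos.2 (hx q)).ne']

theorem logHom_apply {x : ModelSpace P} (hx : x ∈ modelInterior P) (p : P) :
    logHom hx p = Real.log (lam p x) := rfl

/-- The range of `restr S` is a finite-dimensional, hence closed, subspace, and the interior is
dense. At boundary points a family of exponents need not be determined by the vanishing `λ`-values,
so its additivity is obtained as a limit from the interior. -/
theorem IsWeaklyToric.mem_range_restr (hP : IsWeaklyToric P) {S : Finset Q}
    {U : Set (ModelSpace P)} (hU : IsOpen U) {k : ModelSpace P → S → ℝ} (hk : ContinuousOn k U)
    (h : ∀ x ∈ U, x ∈ modelInterior P → k x ∈ LinearMap.range (restr S)) {x : ModelSpace P}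
    (hx : x ∈ U) : k x ∈ LinearMap.range (restr S) := by
  have := hP.neBot_interior x
  have hc : IsClosed (LinearMap.range (restr S) : Set (S → ℝ)) :=
    Submodule.closed_of_finiteDimensional _
  refine hc.mem_of_tendsto (b := 𝓝[modelInterior P] x) (f := k)
    ((hk.continuousAt (hU.mem_nhds hx)).mono_left nhdsWithin_le_nhds) ?_
  filter_upwards [self_mem_nhdsWithin, mem_nhdsWithin_of_mem_nhds (hU.mem_nhds hx)] with y hy hyU
  exact h y hyU hy

/-- Equality of monoid elements modulo a face becomes equality of functions up to the positive
factor `λ_{a'} / λ_a`. The exponential form prepares for taking logarithms. -/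
theorem eq_mul_exp_of_add_eq {x : ModelSpace P} {p p' a a' : P} (h : p + a = p' + a')
    (ha : 0 < lam a x) (ha' : 0 < lam a' x) :
    (lam p x : ℝ) = lam p' x * Real.exp (Real.log (lam a' x) - Real.log (lam a x)) := by
  have ha : (0 : ℝ) < lam a x := ha
  have ha' : (0 : ℝ) < lam a' x := ha'
  have e : (lam p x : ℝ) * lam a x = lam p' x * lam a' x := by
    rw [← NNReal.coe_mul, ← NNReal.coe_mul, ← lam_add, ← lam_add, h]
  rw [Real.exp_sub, Real.exp_log ha, Real.exp_log ha', ← mul_div_assoc, ← e,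
    mul_div_cancel_right₀ _ ha.ne']

theorem isOpen_pos (a : P) : IsOpen {x : ModelSpace P | 0 < lam a x} :=
  isOpen_lt continuous_const (continuous_lam a)

/-- The factor `λ_a / λ_{a'}` is smooth and positive near `x` and is absorbed into `h`. This permits
replacing the arbitrary choice `θ₀` by a morphism `θ`. -/
theorem LocalRep.exists_change {f : ModelSpace P → ℝ≥0} {x : ModelSpace P} {p p' a a' : P}
    {h : ModelSpace P → ℝ} (H : LocalRep f x p h) (e : p' + a = p + a')
    (ha : a ∈ supportFace x) (ha' : a' ∈ supportFace x) : ∃ h', LocalRep f x p' h' := by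
  obtain ⟨U, hU, hx, hh, H⟩ := H
  let V : Set (ModelSpace P) := {y | 0 < lam a y} ∩ {y | 0 < lam a' y}
  have hV : IsOpen V := (isOpen_pos a).inter (isOpen_pos a')
  have hs : SmoothReal V fun y => Real.exp (Real.log (lam a y) - Real.log (lam a' y)) := by
    have h1 := (smoothReal_lam V a).log fun y hy => hy.1
    have h2 := (smoothReal_lam V a').log fun y hy => hy.2
    exact (h1.comp₂ h2 (contDiff_fst.sub contDiff_snd)).exp
  refine ⟨fun y => Real.exp (Real.log (lam a y) - Real.log (lam a' y)) * h y, U ∩ V,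
    hU.inter hV, ⟨hx, pos_of_mem_supportFace ha, pos_of_mem_supportFace ha'⟩,
    (hs.mono inter_subset_right).mul (hh.mono inter_subset_left), fun y hy =>
    ⟨mul_pos (Real.exp_pos _) (H y hy.1).1, ?_⟩⟩
  rw [(H y hy.1).2, eq_mul_exp_of_add_eq e.symm hy.2.2 hy.2.1]; ring

/-- A smooth map near a point, written in terms of morphisms `θ : Q → P` and `κ : P → Q` which are
inverse to each other modulo the support faces. -/
theorem exists_normal_form (hP : IsWeaklyToric P) (hQ : IsWeaklyToric Q) {U : Set (ModelSpace P)}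
    (hU : IsOpen U) {F : ModelSpace P → ModelSpace Q} {x₀ : ModelSpace P} (hx₀ : x₀ ∈ U)
    {θ₀ : Q → P} {h₀ : Q → ModelSpace P → ℝ}
    (hrep : ∀ q, LocalRep (fun x => lam q (F x)) x₀ (θ₀ q) (h₀ q))
    (hinj : ∀ α α' : P →+ ℕ, (∀ a ∈ supportFace x₀, α a = 0) →
      (∀ a ∈ supportFace x₀, α' a = 0) → (∀ q, α (θ₀ q) = α' (θ₀ q)) → α = α')
    (hsurj : ∀ β : Q →+ ℕ, (∀ e ∈ supportFace (F x₀), β e = 0) →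
      ∃ α : P →+ ℕ, (∀ a ∈ supportFace x₀, α a = 0) ∧ ∀ q, α (θ₀ q) = β q)
    (SP : Finset P) (SQ : Finset Q) :
    ∃ (θ : Q →+ P) (κ : P →+ Q) (e e' : Q → Q) (l : Q → ModelSpace P → ℝ)
      (k : P → ModelSpace P → ℝ) (U₁ : Set (ModelSpace P)),
      (∀ q, e q ∈ supportFace (F x₀) ∧ e' q ∈ supportFace (F x₀) ∧ κ (θ q) + e q = q + e' q) ∧
      IsOpen U₁ ∧ x₀ ∈ U₁ ∧ U₁ ⊆ U ∧
      (∀ q ∈ SQ, SmoothReal U₁ (l q) ∧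
        (∀ x ∈ U₁, (lam q (F x) : ℝ) = lam (θ q) x * Real.exp (l q x)) ∧
        ∀ w : P →+ ℝ, w (θ q) + dirDeriv w (l q) x₀ =
          w (θ₀ q) + dirDeriv w (fun y => Real.log (h₀ q y)) x₀) ∧
      (∀ p ∈ SP, SmoothReal U₁ (k p) ∧
        ∀ x ∈ U₁, (lam (κ p) (F x) : ℝ) = lam p x * Real.exp (k p x)) := by
  -- Additivity of `α ∘ θ₀` compares two representations of `λ_{q + q'} ∘ F`: the chosen one and the
  -- product of those for `q` and `q'`.
  have hadd : ∀ α : P →+ ℕ, (∀ a ∈ supportFace x₀, α a = 0) →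
      ∃ β : Q →+ ℕ, (∀ e ∈ supportFace (F x₀), β e = 0) ∧ ∀ q, α (θ₀ q) = β q := by
    intro α hα
    refine ⟨⟨⟨fun q => α (θ₀ q), ?_⟩, fun q q' => ?_⟩, fun e he => ?_, fun q => rfl⟩
    · have : LocalRep (fun x => lam (0 : Q) (F x)) x₀ 0 fun _ => 1 :=
        (localRep_lam (0 : P) x₀).congr (Eventually.of_forall fun x =>
          (lam_zero _).trans (lam_zero _).symm)
      rw [(hrep 0).apply_eq hP this hα, map_zero]
    · have := ((hrep q).mul (hrep q')).congr (f' := fun x => lam (q + q') (F x))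
        (Eventually.of_forall fun x => lam_add _ _ _)
      show α (θ₀ (q + q')) = α (θ₀ q) + α (θ₀ q')
      rw [(hrep (q + q')).apply_eq hP this hα, map_add]
    · exact hα _ ((hrep e).ne_zero_iff.1 he)
  obtain ⟨θ, κ, -, -, hθ, hκθ, hθκ⟩ := hP.exists_quasi_inverse hQ (isFace_supportFace x₀)
    (isFace_supportFace (F x₀)) θ₀ hadd hinj hsurj
  have hrep' : ∀ q, ∃ h, LocalRep (fun x => lam q (F x)) x₀ (θ q) h := fun q => by
    obtain ⟨a, ha, a', ha', e⟩ := hθ q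
    exact (hrep q).exists_change e ha ha'
  choose h hh using hrep'
  choose e he e' he' hee using hκθ
  choose a ha a' ha' haa using hθκ
  have hh' := hh
  choose O hO hxO hsO HO using hh
  let V : P → Set (ModelSpace P) := fun p => {y | 0 < lam (a p) y} ∩ {y | 0 < lam (a' p) y}
  have hV : ∀ p, IsOpen (V p) := fun p => (isOpen_pos _).inter (isOpen_pos _)
  let U₁ : Set (ModelSpace P) := U ∩ ((⋂ q ∈ SQ, O q) ∩ ⋂ p ∈ SP, (O (κ p) ∩ V p))
  have hQ1 : ∀ q ∈ SQ, U₁ ⊆ O q := fun q hq x hx => mem_iInter₂.1 hx.2.1 q hq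
  have hP1 : ∀ p ∈ SP, U₁ ⊆ O (κ p) ∩ V p := fun p hp x hx => mem_iInter₂.1 hx.2.2 p hp
  -- The exponent `k p` combines `λ_{κ p} ∘ F = λ_{θ κ p} h` with `θ (κ p) + a p = p + a' p`, which
  -- turns `λ_{θ κ p}` into `λ_p λ_{a'} / λ_a`.
  refine ⟨θ, κ, e, e', fun q x => Real.log (h q x), fun p x => Real.log (lam (a' p) x) -
    Real.log (lam (a p) x) + Real.log (h (κ p) x), U₁, fun q => ⟨he q, he' q, hee q⟩,
    ?_, ?_, inter_subset_left, fun q hq => ⟨?_, ?_, ?_⟩, fun p hp => ⟨?_, ?_⟩⟩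
  · exact hU.inter ((isOpen_biInter_finset fun q _ => hO q).inter
      (isOpen_biInter_finset fun p _ => (hO _).inter (hV p)))
  · exact ⟨hx₀, mem_iInter₂.2 fun q _ => hxO q, mem_iInter₂.2 fun p _ => ⟨hxO _,
      pos_of_mem_supportFace (ha p), pos_of_mem_supportFace (ha' p)⟩⟩
  · exact ((hsO q).log fun x hx => (HO q x hx).1).mono (hQ1 q hq)
  · intro x hx
    have := HO q x (hQ1 q hq hx)
    rw [this.2, Real.exp_log this.1]
  · exact fun w => (hh' q).apply_add_dirDeriv_eq hP (hrep q) w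
  · have h1 := ((smoothReal_lam (V p) (a p)).log fun y hy => hy.1).mono
      ((hP1 p hp).trans inter_subset_right)
    have h2 := ((smoothReal_lam (V p) (a' p)).log fun y hy => hy.2).mono
      ((hP1 p hp).trans inter_subset_right)
    have h3 := ((hsO (κ p)).log fun x hx => (HO _ x hx).1).mono
      ((hP1 p hp).trans inter_subset_left)
    exact (h2.comp₂ h1 (contDiff_fst.sub contDiff_snd)).add h3
  · intro x hx
    obtain ⟨hxO, hxV⟩ := hP1 p hp hx
    have := HO (κ p) x hxO
    rw [this.2, eq_mul_exp_of_add_eq (haa p) hxV.1 hxV.2, Real.exp_add, Real.exp_log this.1,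
      mul_assoc]

theorem scale_add (w w' : P →+ ℝ) (x : ModelSpace P) :
    scale (w + w') x = scale w' (scale w x) :=
  model_ext fun p => NNReal.coe_injective (by
    rw [lam_scale, lam_scale, lam_scale, AddMonoidHom.add_apply, Real.exp_add]; ring)

end InverseFunction

/-! ### The inverse function theorem on model spaces -/

section InverseFunction

variable {P : Type*} [AddCommMonoid P] {Q : Type*} [AddCommMonoid Q]

/-- At interior points the logarithm is an additive functional, so `k` is the restriction to `S` of
`log x ∘ f - log y ∘ g`. -/
theorem log_sub_mem_range {R : Type*} [AddCommMonoid R] {S : Finset R} {x : ModelSpace P}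
    {y : ModelSpace Q} (hx : x ∈ modelInterior P) (hy : y ∈ modelInterior Q) (f : R →+ P)
    (g : R →+ Q) {k : S → ℝ}
    (hk : ∀ p : S, (lam (f p) x : ℝ) = lam (g p) y * Real.exp (k p)) :
    k ∈ LinearMap.range (restr S) := by
  refine ⟨(logHom hx).comp f - (logHom hy).comp g, funext fun p => ?_⟩
  have h1 : (0 : ℝ) < lam (g p) y := hy _
  rw [restr_apply, AddMonoidHom.sub_apply, AddMonoidHom.comp_apply, AddMonoidHom.comp_apply,
    logHom_apply, logHom_apply, hk, Real.log_mul h1.ne' (Real.exp_pos _).ne', Real.log_exp]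
  ring

/-- The functions `c(θ q) + log (lam (κ θ q) / lam q)(y) + l q (exp(c) • κ^* y)` extend to smooth
functions of `c` and of finitely many of the `lam s y`. -/
theorem exists_smooth_extension {E : Type*} [NormedAddCommGroup E] [NormedSpace ℝ E]
    [FiniteDimensional ℝ E] (A : E →ₗ[ℝ] (P →+ ℝ)) (θ : Q →+ P) (κ : P →+ Q) (e e' : Q → Q)
    (l : Q → ModelSpace P → ℝ) (U : Set (ModelSpace P)) (S : Finset Q)
    (hl : ∀ q ∈ S, SmoothReal U (l q)) :
    ∃ (K : Type) (_ : Fintype K) (s : K → Q) (W : Set (E × (K → ℝ)))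
      (φ : E × (K → ℝ) → S → ℝ), IsOpen W ∧ ContDiffOn ℝ ∞ φ W ∧
      ∀ (c : E) (y : ModelSpace Q), (∀ q ∈ S, 0 < lam (e q) y ∧ 0 < lam (e' q) y) →
        scale (A c) (precomp κ y) ∈ U → (c, fun i => (lam (s i) y : ℝ)) ∈ W ∧
          ∀ q : S, φ (c, fun i => (lam (s i) y : ℝ)) q = A c (θ q) +
            (Real.log (lam (e' q) y) - Real.log (lam (e q) y)) +
              l q (scale (A c) (precomp κ y)) := by
  choose N r W g hW hg H using fun q : S => hl q q.2
  let i₀ := Fintype.equivFin S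
  -- Three kinds of coordinates of `y`: the `λ_{κ r}` needed for the arguments `λ_r` of each `l q`,
  -- then the `λ_{e q}` and the `λ_{e' q}`.
  let K : Type := (Σ i : Fin (Fintype.card S), Fin (N (i₀.symm i))) ⊕
    (Fin (Fintype.card S) ⊕ Fin (Fintype.card S))
  let s : K → Q := Sum.elim (fun j => κ (r (i₀.symm j.1) j.2))
    (Sum.elim (fun i => e (i₀.symm i)) (fun i => e' (i₀.symm i)))
  let cp : P → E × (K → ℝ) → ℝ := fun p z => A z.1 p
  have hcp : ∀ p, ContDiff ℝ ∞ (cp p) := fun p => by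
    let L : E →ₗ[ℝ] ℝ := ⟨⟨fun c => A c p, fun a b => by simp⟩, fun a b => by simp⟩
    exact (LinearMap.toContinuousLinearMap L).contDiff.comp contDiff_fst
  have hco : ∀ k : K, ContDiff ℝ ∞ fun z : E × (K → ℝ) => z.2 k := fun k =>
    (contDiff_apply ℝ ℝ k).comp contDiff_snd
  -- This encodes `λ_r (exp(c) · κ^* y) = exp(c r) λ_{κ r}(y)`.
  let arg : ∀ i : Fin (Fintype.card S), E × (K → ℝ) → Fin (N (i₀.symm i)) → ℝ := fun i z j =>
    Real.exp (cp (r (i₀.symm i) j) z) * z.2 (Sum.inl ⟨i, j⟩)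
  have harg : ∀ i, ContDiff ℝ ∞ (arg i) := fun i => contDiff_pi.2 fun j =>
    (hcp _).exp.mul (hco _)
  let W' : Fin (Fintype.card S) → Set (E × (K → ℝ)) := fun i =>
    ({z | 0 < z.2 (Sum.inr (Sum.inl i))} ∩ {z | 0 < z.2 (Sum.inr (Sum.inr i))}) ∩
      arg i ⁻¹' W (i₀.symm i)
  have hW' : ∀ i, IsOpen (W' i) := fun i =>
    ((isOpen_lt continuous_const (hco _).continuous).inter
      (isOpen_lt continuous_const (hco _).continuous)).inter
        ((hW _).preimage (harg i).continuous)
  let φ : Fin (Fintype.card S) → E × (K → ℝ) → ℝ := fun i z =>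
    cp (θ (i₀.symm i)) z + (Real.log (z.2 (Sum.inr (Sum.inr i))) -
      Real.log (z.2 (Sum.inr (Sum.inl i)))) + g (i₀.symm i) (arg i z)
  have hφ : ∀ i, ContDiffOn ℝ ∞ (φ i) (W' i) := fun i =>
    ((hcp _).contDiffOn.add (((hco _).contDiffOn.log fun z hz => (ne_of_gt hz.1.2)).sub
      ((hco _).contDiffOn.log fun z hz => (ne_of_gt hz.1.1)))).add
        ((hg _).comp (harg i).contDiffOn fun z hz => hz.2)
  refine ⟨K, inferInstance, s, ⋂ i, W' i, fun z q => φ (i₀ q) z,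
    isOpen_iInter_of_finite hW', contDiffOn_pi.2 fun q => (hφ _).mono (iInter_subset _ _),
    fun c y hy hU => ?_⟩
  have harg' : ∀ i, arg i (c, fun i => (lam (s i) y : ℝ)) =
      fun j => (lam (r (i₀.symm i) j) (scale (A c) (precomp κ y)) : ℝ) := fun i => by
    funext j
    rw [lam_scale]; rfl
  refine ⟨mem_iInter.2 fun i => ⟨⟨?_, ?_⟩, ?_⟩, fun q => ?_⟩
  · exact (hy _ (i₀.symm i).2).1
  · exact (hy _ (i₀.symm i).2).2
  · rw [mem_preimage, harg']; exact (H _ _ hU).1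
  · obtain ⟨i, rfl⟩ := i₀.symm.surjective q
    simp only [φ, Equiv.apply_symm_apply, harg']
    rw [(H (i₀.symm i) _ hU).2]
    rfl

/-- The ansatz `x = exp(c) · κ^* y` turns `F x = y` into a finite-dimensional smooth equation for
`c`, with `B` as its derivative in `c` at the base point. This is where the implicit function
theorem enters, and the combinatorics of the corner survives only in `θ` and `κ`. -/
theorem exists_local_inverse_of_normal_form (hP : IsWeaklyToric P) (hQ : IsWeaklyToric Q)
    {U : Set (ModelSpace P)} (hU : IsOpen U) {F : ModelSpace P → ModelSpace Q}
    (hFc : ContinuousOn F U) (hFi : ∀ x ∈ U, x ∈ modelInterior P → F x ∈ modelInterior Q)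
    {x₀ : ModelSpace P} (hx₀ : x₀ ∈ U) {SP : Finset P} {SQ : Finset Q}
    (hSP : AddSubmonoid.closure (SP : Set P) = ⊤) (hSQ : AddSubmonoid.closure (SQ : Set Q) = ⊤)
    {θ : Q →+ P} {κ : P →+ Q} {e e' : Q → Q} {l : Q → ModelSpace P → ℝ}
    {k : P → ModelSpace P → ℝ}
    (he : ∀ q, e q ∈ supportFace (F x₀) ∧ e' q ∈ supportFace (F x₀) ∧ κ (θ q) + e q = q + e' q)
    (hl : ∀ q ∈ SQ, SmoothReal U (l q) ∧
      ∀ x ∈ U, (lam q (F x) : ℝ) = lam (θ q) x * Real.exp (l q x))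
    (hk : ∀ p ∈ SP, SmoothReal U (k p) ∧
      ∀ x ∈ U, (lam (κ p) (F x) : ℝ) = lam p x * Real.exp (k p x))
    (B : (P →+ ℝ) →ₗ[ℝ] (Q →+ ℝ)) (hB : Function.Bijective B)
    (hBl : ∀ w, ∀ q ∈ SQ, B w q = w (θ q) + dirDeriv w (l q) x₀) :
    ∃ (U' : Set (ModelSpace P)) (V : Set (ModelSpace Q)) (G : ModelSpace Q → ModelSpace P),
      IsOpen U' ∧ x₀ ∈ U' ∧ U' ⊆ U ∧ IsOpen V ∧ SmoothMap V G ∧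
      (∀ x ∈ U', F x ∈ V ∧ G (F x) = x) ∧ ∀ y ∈ V, G y ∈ U' ∧ F (G y) = y := by
  have := hP.finiteDimensional
  have := hQ.finiteDimensional
  -- `MP` and `MQ` extract a functional from its values on generators. They are arbitrary off the
  -- range of `restr`, so membership in that range has to be proved before they are used.
  obtain ⟨MP, hMP⟩ := (restr SP).exists_leftInverse_of_injective
    (LinearMap.ker_eq_bot.2 (restr_injective hSP))
  obtain ⟨MQ, hMQ⟩ := (restr SQ).exists_leftInverse_of_injective
    (LinearMap.ker_eq_bot.2 (restr_injective hSQ))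
  have hMP' : ∀ f ∈ LinearMap.range (restr SP), restr SP (MP f) = f := by
    rintro _ ⟨w, rfl⟩
    exact congrArg (restr SP) (LinearMap.congr_fun hMP w)
  have hMQ' : ∀ f ∈ LinearMap.range (restr SQ), MQ f = 0 → f = 0 := by
    rintro _ ⟨w, rfl⟩ h
    have : w = 0 := (LinearMap.congr_fun hMQ w).symm.trans h
    rw [this, map_zero]
  let AP := (Module.finBasis ℝ (P →+ ℝ)).equivFun
  let AQ := (Module.finBasis ℝ (Q →+ ℝ)).equivFun
  obtain ⟨K, _, s, W, φ, hW, hφ, Hφ⟩ := exists_smooth_extension AP.symm.toLinearMap θ κ e e' l U SQ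
    fun q hq => (hl q hq).1
  have Hφ' : ∀ (c : P →+ ℝ) (y : ModelSpace Q),
      (∀ q ∈ SQ, 0 < lam (e q) y ∧ 0 < lam (e' q) y) → scale c (precomp κ y) ∈ U →
        (AP c, fun i => (lam (s i) y : ℝ)) ∈ W ∧
          ∀ q : SQ, φ (AP c, fun i => (lam (s i) y : ℝ)) q = c (θ q) +
            (Real.log (lam (e' q) y) - Real.log (lam (e q) y)) +
              l q (scale c (precomp κ y)) := fun c y h1 h2 => by
    have := Hφ (AP c) y h1
    simp only [LinearEquiv.coe_coe, LinearEquiv.symm_apply_apply] at this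
    exact this h2
  let η : ModelSpace Q → K → ℝ := fun y i => lam (s i) y
  have hη : Continuous η := continuous_pi fun i => continuous_lam_real _
  let L : (SQ → ℝ) →ₗ[ℝ] (Fin (Module.finrank ℝ (Q →+ ℝ)) → ℝ) := AQ.toLinearMap.comp MQ
  let Lc := LinearMap.toContinuousLinearMap L
  -- The generators may satisfy relations, so `φ` has too many components. Projecting to `Hom(Q, ℝ)`
  -- leaves as many equations as unknowns, and `Φ = 0` still forces `φ = 0` at actual points, where
  -- `φ` lies in the range of `restr SQ`.
  let Φ := fun z => Lc (φ z)
  have hΦ : ContDiffOn ℝ ∞ Φ W := Lc.contDiff.comp_contDiffOn hφ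
  let V₁ : Set (ModelSpace Q) := ⋂ q ∈ SQ, ({y | 0 < lam (e q) y} ∩ {y | 0 < lam (e' q) y})
  have hV₁ : IsOpen V₁ :=
    isOpen_biInter_finset fun q _ => (isOpen_pos _).inter (isOpen_pos _)
  have hV₁' : ∀ y ∈ V₁, ∀ q ∈ SQ, 0 < lam (e q) y ∧ 0 < lam (e' q) y := fun y hy q hq =>
    mem_iInter₂.1 hy q hq
  have hy₀ : F x₀ ∈ V₁ := mem_iInter₂.2 fun q _ =>
    ⟨pos_of_mem_supportFace (he q).1, pos_of_mem_supportFace (he q).2.1⟩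
  -- the torus element relating `x` and `κ^* (F x)`
  have hkr : ∀ x ∈ U, (fun p : SP => k p x) ∈ LinearMap.range (restr SP) := fun x hx =>
    hP.mem_range_restr hU (k := fun x p => k p x)
      (continuousOn_pi.2 fun p => (hk p p.2).1.continuousOn)
      (fun x hx hi => log_sub_mem_range (hFi x hx hi) hi κ (AddMonoidHom.id P)
        fun p => (hk p p.2).2 x hx) hx
  let c : ModelSpace P → P →+ ℝ := fun x => -MP fun p => k p x
  have hc : ∀ x ∈ U, ∀ p ∈ SP, c x p = -k p x := fun x hx p hp => by
    have := congrFun (hMP' _ (hkr x hx)) ⟨p, hp⟩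
    simp only [restr_apply] at this
    show -(MP (fun p : SP => k p x) p) = _
    rw [this]
  have hcx : ∀ x ∈ U, scale (c x) (precomp κ (F x)) = x := fun x hx =>
    model_ext_of_closure hSP fun p hp => NNReal.coe_injective (by
      rw [lam_scale, lam_precomp, (hk p hp).2 x hx, hc x hx p hp, Real.exp_neg]
      have := Real.exp_ne_zero (k p x)
      field_simp)
  have hcc : ContinuousOn (fun x => AP (c x)) U := by
    have h1 : ContinuousOn (fun x => fun p : SP => k p x) U :=
      continuousOn_pi.2 fun p => (hk p p.2).1.continuousOn
    exact ((LinearMap.toContinuousLinearMap (-(AP.toLinearMap.comp MP))).continuous.comp_continuousOn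
      h1).congr fun x _ => by simp [c]
  -- solutions of `Φ = 0` are preimages
  have hm : ∀ q ∈ SQ, ∀ y ∈ V₁, (lam (κ (θ q)) y : ℝ) =
      lam q y * Real.exp (Real.log (lam (e' q) y) - Real.log (lam (e q) y)) := fun q hq y hy =>
    eq_mul_exp_of_add_eq (he q).2.2 (hV₁' y hy q hq).1 (hV₁' y hy q hq).2
  have hmr : ∀ y ∈ V₁, (fun q : SQ => Real.log (lam (e' q) y) - Real.log (lam (e q) y)) ∈
      LinearMap.range (restr SQ) := fun y hy =>
    hQ.mem_range_restr hV₁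
      (k := fun y (q : SQ) => Real.log (lam (e' q) y) - Real.log (lam (e q) y))
      (continuousOn_pi.2 fun q =>
        ((continuous_lam_real (e' q)).continuousOn.log fun y hy =>
          (NNReal.coe_pos.2 (hV₁' y hy q q.2).2).ne').sub
        ((continuous_lam_real (e q)).continuousOn.log fun y hy =>
          (NNReal.coe_pos.2 (hV₁' y hy q q.2).1).ne'))
      (fun y hy hi => log_sub_mem_range hi hi (κ.comp θ) (AddMonoidHom.id Q)
        fun q => hm q q.2 y hy) hy
  have hlr : ∀ x ∈ U, (fun q : SQ => l q x) ∈ LinearMap.range (restr SQ) := fun x hx =>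
    hP.mem_range_restr hU (k := fun x q => l q x)
      (continuousOn_pi.2 fun q => (hl q q.2).1.continuousOn)
      (fun x hx hi => log_sub_mem_range (hFi x hx hi) hi (AddMonoidHom.id Q) θ
        fun q => (hl q q.2).2 x hx) hx
  -- At `x = exp(w) · κ^* y` the normal form gives `λ_q (F x) = λ_q(y) exp(φ_q)`, so `φ = 0` means
  -- `F x = y`.
  have hsol : ∀ (w : P →+ ℝ), ∀ y ∈ V₁, scale w (precomp κ y) ∈ U → Φ (AP w, η y) = 0 →
      F (scale w (precomp κ y)) = y := by
    intro w y hy hwU h0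
    obtain ⟨-, hval⟩ := Hφ' w y (hV₁' y hy) hwU
    have h1 : φ (AP w, η y) = 0 := by
      refine hMQ' _ ?_ (AQ.map_eq_zero_iff.1 h0)
      have : φ (AP w, η y) = restr SQ (w.comp θ) +
          (fun q : SQ => Real.log (lam (e' q) y) - Real.log (lam (e q) y)) +
          fun q : SQ => l q (scale w (precomp κ y)) := funext hval
      rw [this]
      exact add_mem (add_mem ⟨_, rfl⟩ (hmr y hy)) (hlr _ hwU)
    refine model_ext_of_closure hSQ fun q hq => NNReal.coe_injective ?_
    have h2 := (hval ⟨q, hq⟩).symm.trans (congrFun h1 ⟨q, hq⟩)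
    simp only [Pi.zero_apply] at h2
    rw [(hl q hq).2 _ hwU, lam_scale, lam_precomp, hm q hq y hy]
    calc _ = lam q y * Real.exp (w (θ q) +
          (Real.log (lam (e' q) y) - Real.log (lam (e q) y)) +
            l q (scale w (precomp κ y))) := by rw [Real.exp_add, Real.exp_add]; ring
      _ = _ := by rw [h2, Real.exp_zero, mul_one]
  -- conversely
  have hU₂ : IsOpen (U ∩ F ⁻¹' V₁) := hFc.isOpen_inter_preimage hU hV₁
  have hzero : ∀ x ∈ U ∩ F ⁻¹' V₁, Φ (AP (c x), η (F x)) = 0 := by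
    intro x hx
    have hval : ∀ x ∈ U ∩ F ⁻¹' V₁, (AP (c x), η (F x)) ∈ W ∧ ∀ q : SQ,
        φ (AP (c x), η (F x)) q = c x (θ q) +
          (Real.log (lam (e' q) (F x)) - Real.log (lam (e q) (F x))) + l q x := by
      intro x hx
      have := Hφ' (c x) (F x) (hV₁' _ hx.2) (by rw [hcx x hx.1]; exact hx.1)
      rwa [hcx x hx.1] at this
    -- At interior points `λ_q (F x)` is positive and can be cancelled; both sides are continuous
    -- and the interior is dense.
    have h1 : EqOn (fun x => φ (AP (c x), η (F x))) (fun _ => 0) (U ∩ F ⁻¹' V₁) := by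
      refine hP.eqOn_of_interior hU₂ ?_ continuousOn_const fun x hx hi => funext fun q => ?_
      · exact hφ.continuousOn.comp ((hcc.mono inter_subset_left).prodMk
          (hη.comp_continuousOn (hFc.mono inter_subset_left))) fun x hx => (hval x hx).1
      · have hFx := hFi x hx.1 hi
        have h2 : (lam (q : Q) (F x) : ℝ) = lam (q : Q) (F x) * Real.exp (c x (θ q) +
            (Real.log (lam (e' q) (F x)) - Real.log (lam (e q) (F x))) + l q x) := by
          conv_lhs => rw [(hl q q.2).2 x hx.1, ← hcx x hx.1, lam_scale, lam_precomp,
            hm q q.2 _ hx.2, hcx x hx.1]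
          rw [Real.exp_add, Real.exp_add]; ring
        have h3 : (0 : ℝ) < lam (q : Q) (F x) := hFx q
        have h4 := mul_left_cancel₀ h3.ne' ((mul_one _).trans h2)
        rw [(hval x hx).2 q]
        exact Real.exp_eq_one_iff _ |>.1 h4.symm
    show Lc (φ _) = 0
    have h1' : φ (AP (c x), η (F x)) = 0 := h1 hx
    rw [h1', map_zero]
  -- the derivative of `Φ`
  have hx₀' : scale (c x₀) (precomp κ (F x₀)) = x₀ := hcx x₀ hx₀
  have hbase : (AP (c x₀), η (F x₀)) ∈ W :=
    (Hφ' (c x₀) (F x₀) (hV₁' _ hy₀) (by rw [hx₀']; exact hx₀)).1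
  have hder : ∀ w : P →+ ℝ, fderiv ℝ Φ (AP (c x₀), η (F x₀)) (AP w, 0) = AQ (B w) := by
    intro w
    have h1 : HasDerivAt (fun τ : ℝ => (AP (c x₀ + τ • w), η (F x₀))) (AP w, 0) 0 := by
      have : HasDerivAt (fun τ : ℝ => AP (c x₀) + τ • AP w) (AP w) 0 := by
        simpa using ((hasDerivAt_id (0 : ℝ)).smul_const (AP w)).const_add (AP (c x₀))
      refine HasDerivAt.prodMk ?_ (hasDerivAt_const _ _)
      simpa only [map_add, map_smul] using this
    have hd : HasFDerivAt Φ (fderiv ℝ Φ (AP (c x₀), η (F x₀)))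
        (AP (c x₀ + (0 : ℝ) • w), η (F x₀)) := by
      rw [zero_smul, add_zero]
      exact ((hΦ.contDiffAt (hW.mem_nhds hbase)).differentiableAt (by simp)).hasFDerivAt
    have h2 := hd.comp_hasDerivAt (0 : ℝ) h1
    have h3 : HasDerivAt (fun τ : ℝ => φ (AP (c x₀ + τ • w), η (F x₀))) (restr SQ (B w)) 0 := by
      refine hasDerivAt_pi.2 fun q => ?_
      rw [restr_apply, hBl w q q.2]
      have h4 : HasDerivAt (fun τ : ℝ => (c x₀ (θ q) + (Real.log (lam (e' q) (F x₀)) -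
          Real.log (lam (e q) (F x₀))) + τ * w (θ q)) + l q (scale (τ • w) x₀))
          (1 * w (θ q) + dirDeriv w (l q) x₀) 0 :=
        (((hasDerivAt_id (0 : ℝ)).mul_const _).const_add _).add
          ((hl q q.2).1.hasDerivAt hU hx₀ w)
      rw [one_mul] at h4
      refine h4.congr_of_eventuallyEq ?_
      filter_upwards [(tendsto_scale (w := w) x₀).eventually (hU.mem_nhds hx₀)] with τ hτ
      -- Varying `c` in direction `w` with `y` fixed moves `x₀` along the one-parameter group of
      -- `w`. Hence the derivative of `φ` is `w(θ q) + ∂_w l_q`, that is `B w` on generators.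
      have e1 : scale (c x₀ + τ • w) (precomp κ (F x₀)) = scale (τ • w) x₀ := by
        rw [scale_add, hx₀']
      have := (Hφ' (c x₀ + τ • w) (F x₀) (hV₁' _ hy₀) (by rw [e1]; exact hτ)).2 q
      rw [e1] at this
      refine this.trans ?_
      rw [AddMonoidHom.add_apply]
      show _ + τ * w (θ q) + _ + _ = _
      ring
    have h5 := Lc.hasFDerivAt.comp_hasDerivAt (0 : ℝ) h3
    refine (h2.unique h5).trans ?_
    show AQ (MQ (restr SQ (B w))) = _
    exact congrArg AQ (LinearMap.congr_fun hMQ (B w))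
  have hbij : Function.Bijective fun u => fderiv ℝ Φ (AP (c x₀), η (F x₀)) (u, 0) := by
    have : (fun u => fderiv ℝ Φ (AP (c x₀), η (F x₀)) (u, 0)) = AQ ∘ B ∘ AP.symm := by
      funext u
      have := hder (AP.symm u)
      rw [LinearEquiv.apply_symm_apply] at this
      exact this
    rw [this]
    exact AQ.bijective.comp (hB.comp AP.symm.bijective)
  obtain ⟨V₂, ĉ, hV₂, hηV₂, hĉ, hĉ₀, hĉz, huniq⟩ := exists_implicit_function hW hΦ hbase
    (hzero x₀ ⟨hx₀, hy₀⟩) hbij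
  -- Smooth because `λ_p ∘ G = λ_{κ p} exp(ĉ(p))`, with `ĉ` smooth in the finitely many values
  -- `λ_s(y)`.
  let G : ModelSpace Q → ModelSpace P := fun y => scale (AP.symm (ĉ (η y))) (precomp κ y)
  let V₃ : Set (ModelSpace Q) := V₁ ∩ η ⁻¹' V₂
  have hV₃ : IsOpen V₃ := hV₁.inter (hV₂.preimage hη)
  have hG : SmoothMap V₃ G := by
    intro p y hy
    refine ⟨V₃, hV₃, hy, Subset.rfl, Or.inl ⟨κ p, fun y => Real.exp (AP.symm (ĉ (η y)) p), ?_,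
      fun y _ => ⟨Real.exp_pos _, ?_⟩⟩⟩
    · refine SmoothReal.exp ?_
      refine SmoothReal.of_fintype s V₂ (fun z => AP.symm (ĉ z) p) hV₂ ?_
        fun y hy => ⟨hy.2, rfl⟩
      let T : (Fin (Module.finrank ℝ (P →+ ℝ)) → ℝ) →ₗ[ℝ] ℝ :=
        ⟨⟨fun u => AP.symm u p, fun a b => by simp⟩, fun a b => by simp⟩
      exact (LinearMap.toContinuousLinearMap T).contDiff.comp_contDiffOn hĉ
    · rw [lam_scale, lam_precomp, mul_comm]
  have hGc := hG.continuousOn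
  have hG₀ : G (F x₀) = x₀ := by
    show scale (AP.symm (ĉ (η (F x₀)))) _ = _
    rw [hĉ₀, LinearEquiv.symm_apply_apply, hx₀']
  let V₀ : Set (ModelSpace Q) := V₃ ∩ G ⁻¹' U
  have hV₀ : IsOpen V₀ := hGc.isOpen_inter_preimage hV₃ hU
  have hFG : ∀ y ∈ V₀, F (G y) = y := fun y hy => by
    refine hsol _ y hy.1.1 hy.2 ?_
    rw [LinearEquiv.apply_symm_apply]
    exact hĉz _ hy.1.2
  -- By local uniqueness of the implicit solution, `c x` agrees with `ĉ` at `F x` for `x` near `x₀`.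
  have hev : ∀ᶠ x in 𝓝 x₀, x ∈ U ∧ G (F x) = x := by
    have ht : Tendsto (fun x => (AP (c x), η (F x))) (𝓝 x₀) (𝓝 (AP (c x₀), η (F x₀))) :=
      (hcc.continuousAt (hU.mem_nhds hx₀)).prodMk_nhds
        ((hη.tendsto _).comp (hFc.continuousAt (hU.mem_nhds hx₀)))
    filter_upwards [ht.eventually huniq, hU₂.mem_nhds ⟨hx₀, hy₀⟩] with x hx hxU
    refine ⟨hxU.1, ?_⟩
    have := hx (hzero x hxU)
    show scale (AP.symm (ĉ (η (F x)))) _ = _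
    rw [← this, LinearEquiv.symm_apply_apply, hcx x hxU.1]
  obtain ⟨U₀, hU₀, hU₀o, hxU₀⟩ := eventually_nhds_iff.1 hev
  have hy₀' : F x₀ ∈ V₀ := ⟨⟨hy₀, hηV₂⟩, by rw [mem_preimage, hG₀]; exact hx₀⟩
  -- `G ∘ F = id` holds on `U₀` and `F ∘ G = id` on `V₀`; these intersections are exchanged by the
  -- two maps.
  refine ⟨U₀ ∩ F ⁻¹' V₀, V₀ ∩ G ⁻¹' U₀, G, ?_, ⟨hxU₀, hy₀'⟩, fun x hx => (hU₀ x hx.1).1, ?_, ?_,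
    ?_, ?_⟩
  · exact (hFc.mono fun x hx => (hU₀ x hx).1).isOpen_inter_preimage hU₀o hV₀
  · exact (hGc.mono inter_subset_left).isOpen_inter_preimage hV₀ hU₀o
  · have hsub : V₀ ∩ G ⁻¹' U₀ ⊆ V₃ := fun y hy => hy.1.1
    have ho : IsOpen (V₀ ∩ G ⁻¹' U₀) :=
      (hGc.mono inter_subset_left).isOpen_inter_preimage hV₀ hU₀o
    intro p
    have := (hG p).inter ho
    rwa [inter_eq_left.2 hsub] at this
  · intro x hx
    have hx' := (hU₀ x hx.1).2
    exact ⟨⟨hx.2, by rw [mem_preimage, hx']; exact hx.1⟩, hx'⟩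
  · intro y hy
    exact ⟨⟨hy.2, by rw [mem_preimage, hFG y hy.1]; exact hy.1⟩, hFG y hy.1⟩

/-- The inverse function theorem for maps of the model spaces: a smooth map which induces a
bijection of the morphisms to `ℕ` vanishing on the support faces, and whose b-derivative is
bijective, is a local diffeomorphism. -/
theorem exists_local_inverse (hP : IsWeaklyToric P) (hQ : IsWeaklyToric Q)
    {U : Set (ModelSpace P)} (hU : IsOpen U) {F : ModelSpace P → ModelSpace Q}
    (hFc : ContinuousOn F U) (hFi : ∀ x ∈ U, x ∈ modelInterior P → F x ∈ modelInterior Q)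
    {x₀ : ModelSpace P} (hx₀ : x₀ ∈ U) {θ₀ : Q → P} {h₀ : Q → ModelSpace P → ℝ}
    (hrep : ∀ q, LocalRep (fun x => lam q (F x)) x₀ (θ₀ q) (h₀ q))
    (hinj : ∀ α α' : P →+ ℕ, (∀ a ∈ supportFace x₀, α a = 0) →
      (∀ a ∈ supportFace x₀, α' a = 0) → (∀ q, α (θ₀ q) = α' (θ₀ q)) → α = α')
    (hsurj : ∀ β : Q →+ ℕ, (∀ e ∈ supportFace (F x₀), β e = 0) →
      ∃ α : P →+ ℕ, (∀ a ∈ supportFace x₀, α a = 0) ∧ ∀ q, α (θ₀ q) = β q)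
    (B : (P →+ ℝ) →ₗ[ℝ] (Q →+ ℝ)) (hB : Function.Bijective B)
    (hBq : ∀ w q, B w q = w (θ₀ q) + dirDeriv w (fun y => Real.log (h₀ q y)) x₀) :
    ∃ (U' : Set (ModelSpace P)) (V : Set (ModelSpace Q)) (G : ModelSpace Q → ModelSpace P),
      IsOpen U' ∧ x₀ ∈ U' ∧ U' ⊆ U ∧ IsOpen V ∧ SmoothMap V G ∧
      (∀ x ∈ U', F x ∈ V ∧ G (F x) = x) ∧ ∀ y ∈ V, G y ∈ U' ∧ F (G y) = y := by
  obtain ⟨SP, hSP, hfin⟩ := (AddMonoid.fg_iff (M := P)).1 hP.fg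
  lift SP to Finset P using hfin
  obtain ⟨SQ, hSQ, hfin⟩ := (AddMonoid.fg_iff (M := Q)).1 hQ.fg
  lift SQ to Finset Q using hfin
  obtain ⟨θ, κ, e, e', l, k, U₁, he, hU₁, hx₁, hU₁U, hl, hk⟩ :=
    exists_normal_form hP hQ hU hx₀ hrep hinj hsurj SP SQ
  obtain ⟨U', V, G, h1, h2, h3, h4⟩ := exists_local_inverse_of_normal_form hP hQ hU₁
    (hFc.mono hU₁U) (fun x hx => hFi x (hU₁U hx)) hx₁ hSP hSQ he
    (fun q hq => ⟨(hl q hq).1, (hl q hq).2.1⟩) hk B hB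
    (fun w q hq => by rw [hBq, (hl q hq).2.2])
  exact ⟨U', V, G, h1, h2, h3.trans hU₁U, h4⟩

end InverseFunction

/-! ### Locality and composition of smooth maps of model spaces -/

section ModelMaps

variable {P : Type*} [AddCommMonoid P] {Q : Type*} [AddCommMonoid Q] {R : Type*} [AddCommMonoid R]

theorem SmoothNonneg.congr {U : Set (ModelSpace P)} {f f' : ModelSpace P → ℝ≥0}
    (hf : SmoothNonneg U f) (h : ∀ x ∈ U, f' x = f x) : SmoothNonneg U f' := by
  intro x hx
  obtain ⟨U', hU', hxU', hs, H⟩ := hf x hx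
  refine ⟨U', hU', hxU', hs, ?_⟩
  rcases H with ⟨p, k, hk, K⟩ | K
  · exact Or.inl ⟨p, k, hk, fun y hy => ⟨(K y hy).1, by rw [h y (hs hy)]; exact (K y hy).2⟩⟩
  · exact Or.inr fun y hy => by rw [h y (hs hy)]; exact K y hy

theorem SmoothNonneg.of_local {U : Set (ModelSpace P)} {f : ModelSpace P → ℝ≥0}
    (h : ∀ x ∈ U, ∃ V, x ∈ V ∧ V ⊆ U ∧ SmoothNonneg V f) : SmoothNonneg U f := by
  intro x hx
  obtain ⟨V, hxV, hVU, hV⟩ := h x hx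
  obtain ⟨U', hU', hxU', hs, H⟩ := hV x hxV
  exact ⟨U', hU', hxU', hs.trans hVU, H⟩

theorem SmoothNonneg.mono {U V : Set (ModelSpace P)} {f : ModelSpace P → ℝ≥0}
    (hf : SmoothNonneg V f) (hU : IsOpen U) (h : U ⊆ V) : SmoothNonneg U f := by
  have := hf.inter hU
  rwa [inter_eq_left.2 h] at this

theorem SmoothMap.mono {U V : Set (ModelSpace P)} {F : ModelSpace P → ModelSpace Q}
    (hF : SmoothMap V F) (hU : IsOpen U) (h : U ⊆ V) : SmoothMap U F := fun q => (hF q).mono hU h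

theorem SmoothMap.comp {U : Set (ModelSpace P)} {V : Set (ModelSpace Q)}
    {F : ModelSpace P → ModelSpace Q} {H : ModelSpace Q → ModelSpace R} (hH : SmoothMap V H)
    (hF : SmoothMap U F) (hU : IsOpen U) (hUV : ∀ x ∈ U, F x ∈ V) :
    SmoothMap U (fun x => H (F x)) := fun r =>
  SmoothNonneg.pullback (f := fun y => lam r (H y)) hU hF.continuousOn hF (hH r) hUV

end ModelMaps

section Manifold

variable {X : Type*} [TopologicalSpace X] [ManifoldWithGCorners X]
  {Y : Type*} [TopologicalSpace Y] [ManifoldWithGCorners Y]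

/-! ### Smooth maps in charts -/

theorem isOpen_chart_domain_of_continuousOn {f : X → Y} {W : Set X} (hW : IsOpen W)
    (hf : ContinuousOn f W) (c : GChart (ManifoldWithGCorners.dim X) X)
    (d : GChart (ManifoldWithGCorners.dim Y) Y) {V : Set (ModelSpace d.P)} (hV : IsOpen V) :
    IsOpen (c.φ.source ∩ c.φ ⁻¹' (W ∩ f ⁻¹' (d.φ.target ∩ d.φ.symm ⁻¹' V))) :=
  c.φ.isOpen_inter_preimage (hf.isOpen_inter_preimage hW (d.φ.isOpen_inter_preimage_symm hV))

theorem isOpen_chart_domain' {f : X → Y} {W : Set X} (hW : IsOpen W)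
    (hf : ContinuousOn f W) (c : GChart (ManifoldWithGCorners.dim X) X)
    (d : GChart (ManifoldWithGCorners.dim Y) Y) :
    IsOpen (c.φ.source ∩ c.φ ⁻¹' (W ∩ f ⁻¹' d.φ.target)) :=
  c.φ.isOpen_inter_preimage (hf.isOpen_inter_preimage hW d.φ.open_target)

theorem isSmoothOn_id {W : Set X} (hW : IsOpen W) : IsSmoothOn (fun x : X => x) W :=
  ⟨continuousOn_id, fun c hc d hd =>
    ((ManifoldWithGCorners.compatible c hc d hd).1).mono
      (isOpen_chart_domain' hW continuousOn_id c d) fun _ hu => ⟨hu.1, hu.2.2⟩⟩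

theorem IsSmoothOn.mono {f : X → Y} {U W : Set X} (hf : IsSmoothOn f W) (hU : IsOpen U)
    (h : U ⊆ W) : IsSmoothOn f U :=
  ⟨hf.1.mono h, fun c hc d hd => (hf.2 c hc d hd).mono
    (isOpen_chart_domain' hU (hf.1.mono h) c d) fun _ hu => ⟨hu.1, h hu.2.1, hu.2.2⟩⟩

/-- A smooth map on `W` takes interior points to interior points in all charts. -/
def InteriorOn (f : X → Y) (W : Set X) : Prop :=
  ∀ c ∈ gAtlas X, ∀ d ∈ gAtlas Y, ∀ u ∈ c.φ.source ∩ c.φ ⁻¹' (W ∩ f ⁻¹' d.φ.target),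
    u ∈ modelInterior c.P → d.φ.symm (f (c.φ u)) ∈ modelInterior d.P

/-- `f : U → V` and `g : V → U` are mutually inverse smooth maps of open sets. -/
structure LocalInverse (f : X → Y) (U : Set X) (g : Y → X) (V : Set Y) : Prop where
  isOpen_source : IsOpen U
  isOpen_target : IsOpen V
  smooth : IsSmoothOn f U
  smooth_inv : IsSmoothOn g V
  map : ∀ x ∈ U, f x ∈ V
  map_inv : ∀ y ∈ V, g y ∈ U
  left_inv : ∀ x ∈ U, g (f x) = x
  right_inv : ∀ y ∈ V, f (g y) = y

namespace LocalInverse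

variable {f : X → Y} {U : Set X} {g : Y → X} {V : Set Y}

theorem symm (h : LocalInverse f U g V) : LocalInverse g V f U :=
  ⟨h.isOpen_target, h.isOpen_source, h.smooth_inv, h.smooth, h.map_inv, h.map, h.right_inv,
    h.left_inv⟩

theorem interiorOn (h : LocalInverse f U g V) : InteriorOn f U := by
  intro c hc d hd u hu hi
  have hg := h.smooth_inv.2 d hd c hc
  refine mem_interior_of_smooth_inverse d.weaklyToric (h.smooth.2 c hc d hd)
    (isOpen_chart_domain' h.isOpen_target h.smooth_inv.1 d c) hg.continuousOn ?_ hu ?_ ?_ hi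
  · intro y hy
    rw [c.φ.right_inv hy.2.2, h.right_inv _ hy.2.1, d.φ.left_inv hy.1]
  · refine ⟨d.φ.map_target hu.2.2, ?_⟩
    rw [mem_preimage, d.φ.right_inv hu.2.2]
    refine ⟨h.map _ hu.2.1, ?_⟩
    rw [mem_preimage, h.left_inv _ hu.2.1]
    exact c.φ.map_source hu.1
  · rw [d.φ.right_inv hu.2.2, h.left_inv _ hu.2.1, c.φ.left_inv hu.1]

end LocalInverse

theorem localInverse_id {W : Set X} (hW : IsOpen W) :
    LocalInverse (fun x : X => x) W (fun x : X => x) W :=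
  ⟨hW, hW, isSmoothOn_id hW, isSmoothOn_id hW, fun _ h => h, fun _ h => h, fun _ _ => rfl,
    fun _ _ => rfl⟩

theorem IsEtale.exists_localInverse {f : X → Y} (hf : IsEtale f) (x : X) :
    ∃ U g V, x ∈ U ∧ LocalInverse f U g V := by
  obtain ⟨U, V, hU, hx, hV, -, hfU, hs, g, hg, hgs⟩ := hf.2 x
  have h : ∀ y ∈ V, g y ∈ U ∧ f (g y) = y := by
    rintro y hy
    rw [← hfU] at hy
    obtain ⟨x, hx, rfl⟩ := hy
    rw [hg x hx]; exact ⟨hx, rfl⟩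
  exact ⟨U, g, V, hx, hU, hV, hs, hgs, fun x hx => hfU ▸ mem_image_of_mem f hx,
    fun y hy => (h y hy).1, hg, fun y hy => (h y hy).2⟩

theorem LocalInverse.isDiffeomorphismOn {f : X → Y} {U : Set X} {g : Y → X} {V : Set Y}
    (h : LocalInverse f U g V) : IsDiffeomorphismOn f U V := by
  refine ⟨Subset.antisymm ?_ fun y hy => ⟨g y, h.map_inv y hy, h.right_inv y hy⟩, h.smooth, g,
    h.left_inv, h.smooth_inv⟩
  rintro _ ⟨x, hx, rfl⟩
  exact h.map x hx

theorem IsEtale.isInterior {f : X → Y} (hf : IsEtale f) : IsInterior f := by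
  refine ⟨hf.1, fun c hc d hd u hu hi => ?_⟩
  obtain ⟨U, g, V, hx, h⟩ := hf.exists_localInverse (c.φ u)
  exact h.interiorOn c hc d hd u ⟨hu.1, hx, hu.2⟩ hi

/-- Smoothness of a map on an open set from smoothness in a single pair of charts. -/
theorem isSmoothOn_of_chart {c : GChart (ManifoldWithGCorners.dim X) X} (hc : c ∈ gAtlas X)
    {d : GChart (ManifoldWithGCorners.dim Y) Y} (hd : d ∈ gAtlas Y) {V : Set (ModelSpace c.P)}
    (hV : IsOpen V) (hVs : V ⊆ c.φ.source) {G : ModelSpace c.P → ModelSpace d.P}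
    (hG : SmoothMap V G) (hGs : ∀ y ∈ V, G y ∈ d.φ.source) :
    IsSmoothOn (fun x => d.φ (G (c.φ.symm x))) (c.φ '' V) := by
  have hmem : ∀ x ∈ c.φ '' V, x ∈ c.φ.target ∧ c.φ.symm x ∈ V := by
    rintro _ ⟨u, hu, rfl⟩
    exact ⟨c.φ.map_source (hVs hu), by rwa [c.φ.left_inv (hVs hu)]⟩
  have hcont : ContinuousOn (fun x => d.φ (G (c.φ.symm x))) (c.φ '' V) :=
    d.φ.continuousOn.comp (hG.continuousOn.comp (c.φ.symm.continuousOn.mono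
      fun x hx => (hmem x hx).1) fun x hx => (hmem x hx).2) fun x hx => hGs _ (hmem x hx).2
  have ho := c.φ.isOpen_image_of_subset_source hV hVs
  refine ⟨hcont, fun c' hc' d' hd' => ?_⟩
  have hD := isOpen_chart_domain' ho hcont c' d'
  have h1 : SmoothMap (c'.φ.source ∩ c'.φ ⁻¹' (c.φ '' V ∩
      (fun x => d.φ (G (c.φ.symm x))) ⁻¹' d'.φ.target)) fun u => c.φ.symm (c'.φ u) :=
    (ManifoldWithGCorners.compatible c' hc' c hc).1.mono hD
      fun u hu => ⟨hu.1, (hmem _ hu.2.1).1⟩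
  have h2 := hG.comp h1 hD fun u hu => (hmem _ hu.2.1).2
  exact (ManifoldWithGCorners.compatible d hd d' hd').1.comp h2 hD
    fun u hu => ⟨hGs _ (hmem _ hu.2.1).2, hu.2.2⟩

/-- The pullback of a function which is smooth near `f x` in one chart is smooth. -/
theorem smoothNear_of_chart {f : X → Y} {W : Set X} (hW : IsOpen W) (hf : IsSmoothOn f W) {x : X}
    (hx : x ∈ W) {d : GChart (ManifoldWithGCorners.dim Y) Y} (hd : d ∈ gAtlas Y)
    (hfx : f x ∈ d.φ.target) {V : Set (ModelSpace d.P)} (hV : IsOpen V)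
    (hxV : d.φ.symm (f x) ∈ V) {a : Y → ℝ} (ha : SmoothReal V fun u => a (d.φ u)) :
    SmoothNear (fun y => a (f y)) x := by
  intro c hc hxc
  have hD := isOpen_chart_domain_of_continuousOn hW hf.1 c d hV
  have h1 := (hf.2 c hc d hd).mono hD fun u hu => ⟨hu.1, hu.2.1, hu.2.2.1⟩
  obtain ⟨U, hU, hxU, hs, hr⟩ := ha.pullback h1 (fun u hu => hu.2.2.2) (x := c.φ.symm x)
    ⟨c.φ.map_target hxc, by rw [mem_preimage, c.φ.right_inv hxc]; exact ⟨hx, hfx, hxV⟩⟩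
  exact ⟨U, hU, hxU, fun u hu => (hs hu).1,
    hr.congr fun u hu => by rw [d.φ.right_inv (hs hu).2.2.1]⟩

theorem interiorNear_of_chart {f : X → Y} {W : Set X} (hW : IsOpen W) (hf : IsSmoothOn f W)
    (hfi : InteriorOn f W) {x : X}
    (hx : x ∈ W) {d : GChart (ManifoldWithGCorners.dim Y) Y} (hd : d ∈ gAtlas Y)
    (hfx : f x ∈ d.φ.target) {V : Set (ModelSpace d.P)} (hV : IsOpen V)
    (hxV : d.φ.symm (f x) ∈ V) {b : Y → ℝ≥0} (hb : SmoothNonneg V fun u => b (d.φ u))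
    (hpos : ∀ u ∈ V, u ∈ modelInterior d.P → 0 < b (d.φ u)) :
    InteriorNear (fun y => b (f y)) x := by
  intro c hc hxc
  have hD := isOpen_chart_domain_of_continuousOn hW hf.1 c d hV
  have h1 := (hf.2 c hc d hd).mono hD fun u hu => ⟨hu.1, hu.2.1, hu.2.2.1⟩
  refine ⟨_, hD, ⟨c.φ.map_target hxc, by
    rw [mem_preimage, c.φ.right_inv hxc]; exact ⟨hx, hfx, hxV⟩⟩, inter_subset_left, ?_, ?_⟩
  · exact (SmoothNonneg.pullback hD h1.continuousOn h1 hb fun u hu => hu.2.2.2).congr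
      fun u hu => by rw [d.φ.right_inv hu.2.2.1]
  · intro u hu hi
    have := hpos _ hu.2.2.2 (hfi c hc d hd u ⟨hu.1, hu.2.1, hu.2.2.1⟩ hi)
    rwa [d.φ.right_inv hu.2.2.1] at this

theorem SmoothNear.comp_on {f : X → Y} {W : Set X} (hW : IsOpen W) (hf : IsSmoothOn f W) {x : X}
    (hx : x ∈ W) {a : Y → ℝ} (ha : SmoothNear a (f x)) : SmoothNear (fun y => a (f y)) x := by
  obtain ⟨d, hd, hfx⟩ := ManifoldWithGCorners.covers (f x)
  obtain ⟨V, hV, hxV, -, h⟩ := ha d hd hfx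
  exact smoothNear_of_chart hW hf hx hd hfx hV hxV h

theorem InteriorNear.comp_on {f : X → Y} {W : Set X} (hW : IsOpen W) (hf : IsSmoothOn f W)
    (hfi : InteriorOn f W) {x : X} (hx : x ∈ W) {b : Y → ℝ≥0} (hb : InteriorNear b (f x)) :
    InteriorNear (fun y => b (f y)) x := by
  obtain ⟨d, hd, hfx⟩ := ManifoldWithGCorners.covers (f x)
  obtain ⟨V, hV, hxV, -, h, hpos⟩ := hb d hd hfx
  exact interiorNear_of_chart hW hf hfi hx hd hfx hV hxV h hpos

theorem LocalInverse.tendsto {f : X → Y} {U : Set X} {g : Y → X} {V : Set Y}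
    (h : LocalInverse f U g V) {x : X} (hx : x ∈ U) : Tendsto f (𝓝 x) (𝓝 (f x)) :=
  h.smooth.1.continuousAt (h.isOpen_source.mem_nhds hx)

theorem LocalInverse.tendsto_inv {f : X → Y} {U : Set X} {g : Y → X} {V : Set Y}
    (h : LocalInverse f U g V) {x : X} (hx : x ∈ U) : Tendsto g (𝓝 (f x)) (𝓝 x) := by
  have := h.symm.tendsto (h.map x hx)
  rwa [h.left_inv x hx] at this

/-! ### Étale maps -/

/-- The inverse on germs is pullback along the local inverse, which is itself interior by
`LocalInverse.interiorOn`. -/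
theorem pullInterior_bijective {f : X → Y} (hf : IsEtale f) (x : X) :
    Function.Bijective (pullInterior f hf.isInterior x) := by
  obtain ⟨U, g, V, hx, h⟩ := hf.exists_localInverse x
  constructor
  · rintro ⟨_, b, rfl, hb⟩ ⟨_, b', rfl, hb'⟩ e
    have e : (fun y => b (f y)) =ᶠ[𝓝 x] fun y => b' (f y) :=
      Germ.coe_eq.1 (congrArg Subtype.val e)
    refine Subtype.ext (Germ.coe_eq.2 ?_)
    filter_upwards [(h.tendsto_inv hx).eventually e,
      h.isOpen_target.mem_nhds (h.map x hx)] with y hy hyV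
    rwa [h.right_inv y hyV] at hy
  · rintro ⟨_, b, rfl, hb⟩
    have hb' : InteriorNear (fun y => b (g y)) (f x) :=
      InteriorNear.comp_on h.isOpen_target h.smooth_inv h.symm.interiorOn (h.map x hx)
        (by rwa [h.left_inv x hx])
    refine ⟨⟨_, _, rfl, hb'⟩, Subtype.ext (Germ.coe_eq.2 ?_)⟩
    filter_upwards [h.isOpen_source.mem_nhds hx] with y hy
    exact congrArg b (h.left_inv y hy)

theorem pullSmooth_bijective {f : X → Y} (hf : IsEtale f) (x : X) :
    Function.Bijective (pullSmooth f hf.1 x) := by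
  obtain ⟨U, g, V, hx, h⟩ := hf.exists_localInverse x
  constructor
  · rintro ⟨_, b, rfl, hb⟩ ⟨_, b', rfl, hb'⟩ e
    have e : (fun y => b (f y)) =ᶠ[𝓝 x] fun y => b' (f y) :=
      Germ.coe_eq.1 (congrArg Subtype.val e)
    refine Subtype.ext (Germ.coe_eq.2 ?_)
    filter_upwards [(h.tendsto_inv hx).eventually e,
      h.isOpen_target.mem_nhds (h.map x hx)] with y hy hyV
    rwa [h.right_inv y hyV] at hy
  · rintro ⟨_, b, rfl, hb⟩
    have hb' : SmoothNear (fun y => b (g y)) (f x) :=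
      SmoothNear.comp_on h.isOpen_target h.smooth_inv (h.map x hx) (by rwa [h.left_inv x hx])
    refine ⟨⟨_, _, rfl, hb'⟩, Subtype.ext (Germ.coe_eq.2 ?_)⟩
    filter_upwards [h.isOpen_source.mem_nhds hx] with y hy
    exact congrArg b (h.left_inv y hy)

theorem evInterior_pullInterior {f : X → Y} (hf : IsInterior f) (x : X)
    (b : interiorGerms (f x)) : evInterior (pullInterior f hf x b) = evInterior b := by
  obtain ⟨_, b, rfl, hb⟩ := b; rfl

theorem evSmooth_pullSmooth {f : X → Y} (hf : IsSmooth f) (x : X)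
    (a : smoothGerms (f x)) : evSmooth (pullSmooth f hf x a) = evSmooth a := by
  obtain ⟨_, a, rfl, ha⟩ := a; rfl

theorem smoothMul_pullSmooth {f : X → Y} (hf : IsSmooth f) (x : X) (a b : smoothGerms (f x)) :
    smoothMul (pullSmooth f hf x a) (pullSmooth f hf x b) =
      pullSmooth f hf x (smoothMul a b) := by
  obtain ⟨_, a, rfl, ha⟩ := a
  obtain ⟨_, b, rfl, hb⟩ := b
  rfl

theorem expGerm_pullSmooth {f : X → Y} (hf : IsInterior f) (x : X) (a : smoothGerms (f x)) :
    expGerm (pullSmooth f hf.1 x a) = pullInterior f hf x (expGerm a) := by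
  obtain ⟨_, a, rfl, ha⟩ := a; rfl

theorem incGerm_pullInterior {f : X → Y} (hf : IsInterior f) (x : X)
    (b : interiorGerms (f x)) :
    incGerm (pullInterior f hf x b) = pullSmooth f hf.1 x (incGerm b) := by
  obtain ⟨_, b, rfl, hb⟩ := b; rfl

/-- `M̃_x` depends only on the monoid of interior germs and on which germs are positive at `x`; the
isomorphism `f^*` respects both. -/
theorem IsEtale.isSimple {f : X → Y} (hf : IsEtale f) : IsSimple f := by
  refine ⟨hf.isInterior, fun x => ⟨fun α α' e => ?_, fun β => ?_⟩⟩
  · refine Subtype.ext (AddMonoidHom.ext fun b => ?_)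
    obtain ⟨b', hb'⟩ := (pullInterior_bijective hf x).2 b.toMul
    have := DFunLike.congr_fun (congrArg Subtype.val e) (Additive.ofMul b')
    have h2 : α.1 (Additive.ofMul (pullInterior f hf.isInterior x b')) =
      α'.1 (Additive.ofMul (pullInterior f hf.isInterior x b')) := this
    rwa [hb'] at h2
  · let E := MulEquiv.ofBijective _ (pullInterior_bijective hf x)
    refine ⟨⟨β.1.comp (MonoidHom.toAdditive E.symm.toMonoidHom), fun b hb => ?_⟩, ?_⟩
    · obtain ⟨b', rfl⟩ := E.surjective b
      have h1 : β.1 (Additive.ofMul b') = 0 :=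
        β.2 b' (by rwa [← evInterior_pullInterior hf.isInterior])
      show β.1 (Additive.ofMul (E.symm (E b'))) = 0
      rw [E.symm_apply_apply, h1]
    · refine Subtype.ext (AddMonoidHom.ext fun b => ?_)
      show β.1 (Additive.ofMul (E.symm (E b.toMul))) = _
      rw [E.symm_apply_apply]; rfl

/-- The b-tangent space is defined by product, exponential, inclusion and evaluation of germs, all
compatible with the isomorphisms `f^*`; conjugation by them gives the inverse. -/
theorem IsEtale.bDiff_bijective {f : X → Y} (hf : IsEtale f) (x : X) :
    Function.Bijective (bDiff f hf.isInterior x) := by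
  have hS := pullSmooth_bijective hf x
  have hI := pullInterior_bijective hf x
  constructor
  · intro v v' e
    have e1 := congrArg Prod.fst (congrArg Subtype.val e)
    have e2 := congrArg Prod.snd (congrArg Subtype.val e)
    refine Subtype.ext (Prod.ext (LinearMap.ext fun a => ?_) (AddMonoidHom.ext fun b => ?_))
    · obtain ⟨a, rfl⟩ := hS.2 a
      exact LinearMap.congr_fun e1 a
    · obtain ⟨b', hb'⟩ := hI.2 b.toMul
      have h2 : v.1.2 (Additive.ofMul (pullInterior f hf.isInterior x b')) =
        v'.1.2 (Additive.ofMul (pullInterior f hf.isInterior x b')) :=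
          DFunLike.congr_fun e2 (Additive.ofMul b')
      rwa [hb'] at h2
  · intro u
    let ES := LinearEquiv.ofBijective _ hS
    let EI := MulEquiv.ofBijective _ hI
    have hES : ∀ a, ES.symm (pullSmooth f hf.1 x a) = a := ES.symm_apply_apply
    have hEI : ∀ b, EI.symm (pullInterior f hf.isInterior x b) = b := EI.symm_apply_apply
    refine ⟨⟨(u.1.1.comp ES.symm.toLinearMap,
      u.1.2.comp (MonoidHom.toAdditive EI.symm.toMonoidHom)), fun a b => ?_, fun a => ?_,
      fun b => ?_⟩, ?_⟩
    · obtain ⟨a, rfl⟩ := hS.2 a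
      obtain ⟨b, rfl⟩ := hS.2 b
      rw [smoothMul_pullSmooth, evSmooth_pullSmooth, evSmooth_pullSmooth]
      show u.1.1 (ES.symm _) = u.1.1 (ES.symm _) * _ + _ * u.1.1 (ES.symm _)
      rw [hES, hES, hES]
      exact u.2.1 a b
    · obtain ⟨a, rfl⟩ := hS.2 a
      rw [expGerm_pullSmooth hf.isInterior]
      show u.1.2 (Additive.ofMul (EI.symm _)) = u.1.1 (ES.symm _)
      rw [hES, toMul_ofMul, hEI]
      exact u.2.2.1 a
    · obtain ⟨b, rfl⟩ := hI.2 b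
      rw [incGerm_pullInterior hf.isInterior, evInterior_pullInterior hf.isInterior]
      show u.1.1 (ES.symm _) = _ * u.1.2 (Additive.ofMul (EI.symm _))
      rw [hES, toMul_ofMul, hEI]
      exact u.2.2.2 b
    · refine Subtype.ext (Prod.ext (LinearMap.ext fun a => ?_) (AddMonoidHom.ext fun b => ?_))
      · exact congrArg u.1.1 (hES a)
      · exact congrArg (fun z => u.1.2 (Additive.ofMul z)) (hEI b.toMul)

theorem IsEtale.isBDiffIso {f : X → Y} (hf : IsEtale f) : IsBDiffIso f hf.isInterior := by
  refine ⟨hf.bDiff_bijective, fun U hU s => ⟨fun hs => ?_, fun hs => ?_⟩⟩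
  · intro V b hb hV x₀ hx₀ hfx₀
    have hV' : IsOpen (f ⁻¹' V) := hV.preimage (continuousOn_univ.1 hf.1.1)
    exact hs (f ⁻¹' V) (fun y => b (f y)) (fun y hy => (hb (f y) hy).comp hf.isInterior) hV' x₀
      hx₀ hfx₀
  · intro V b hb hV x₀ hx₀ hxV
    obtain ⟨U₁, g, V₁, hx₁, h⟩ := hf.exists_localInverse x₀
    have hV' : IsOpen (V₁ ∩ g ⁻¹' V) := h.smooth_inv.1.isOpen_inter_preimage h.isOpen_target hV
    -- Near `x₀` a test function `b` on `X` is `f^*` of `b ∘ g`, so the smoothness of the pushed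
    -- section on `b ∘ g` is that of `s` on `b`.
    obtain ⟨a, ha, hae⟩ := hs (V₁ ∩ g ⁻¹' V) (fun y => b (g y)) (fun y hy =>
      InteriorNear.comp_on h.isOpen_target h.smooth_inv h.symm.interiorOn hy.1 (hb _ hy.2)) hV'
      x₀ hx₀ ⟨h.map x₀ hx₁, by rwa [mem_preimage, h.left_inv x₀ hx₁]⟩
    refine ⟨a, ha, ?_⟩
    filter_upwards [hae, h.isOpen_source.mem_nhds hx₁] with x hx hxU₁ hxV
    have hfx : f x ∈ V₁ ∩ g ⁻¹' V :=
      ⟨h.map x hxU₁, by rwa [mem_preimage, h.left_inv x hxU₁]⟩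
    rw [← hx hfx]
    show (s x).1.2 (Additive.ofMul _) = (s x).1.2 (Additive.ofMul _)
    congr 2
    refine Subtype.ext (Germ.coe_eq.2 ?_)
    filter_upwards [h.isOpen_source.mem_nhds hxU₁] with y hy
    exact congrArg b (h.left_inv y hy).symm

theorem IsEtale.isDiffeomorphism_iff {f : X → Y} (hf : IsEtale f) :
    IsDiffeomorphism f ↔ Function.Bijective f := by
  constructor
  · rintro ⟨g, hl, hr, -, -⟩
    exact ⟨hl.injective, hr.surjective⟩
  · intro hbij
    obtain ⟨g, hl, hr⟩ := Function.bijective_iff_has_inverse.1 hbij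
    -- By injectivity of `f`, the global inverse coincides with each local inverse on the domain of
    -- the latter; smoothness is local.
    have hloc : ∀ y, ∃ g' V, y ∈ V ∧ IsOpen V ∧ IsSmoothOn g' V ∧ ∀ z ∈ V, g z = g' z := by
      intro y
      obtain ⟨U, g', V, hx, h⟩ := hf.exists_localInverse (g y)
      refine ⟨g', V, by simpa only [hr y] using h.map _ hx, h.isOpen_target, h.smooth_inv,
        fun z hz => ?_⟩
      conv_lhs => rw [← h.right_inv z hz, hl]
    have hgc : ContinuousOn g univ := by
      refine continuousOn_univ.2 (continuous_iff_continuousAt.2 fun y => ?_)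
      obtain ⟨g', V, hy, hV, hg', he⟩ := hloc y
      refine (hg'.1.continuousAt (hV.mem_nhds hy)).congr ?_
      filter_upwards [hV.mem_nhds hy] with z hz
      exact (he z hz).symm
    refine ⟨g, hl, hr, hf.1, hgc, fun c hc d hd q => SmoothNonneg.of_local fun u hu => ?_⟩
    obtain ⟨g', V, hy, hV, hg', he⟩ := hloc (c.φ u)
    refine ⟨c.φ.source ∩ c.φ ⁻¹' (V ∩ g' ⁻¹' d.φ.target), ⟨hu.1, hy, ?_⟩, ?_,
      (hg'.2 c hc d hd q).congr ?_⟩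
    · rw [mem_preimage, ← he _ hy]; exact hu.2.2
    · intro v hv
      refine ⟨hv.1, mem_univ _, ?_⟩
      rw [mem_preimage, he _ hv.2.1]; exact hv.2.2
    · intro v hv
      simp only [he _ hv.2.1]

end Manifold

section Germs

variable {X : Type*} [TopologicalSpace X] [ManifoldWithGCorners X]

/-! ### Germs in a chart -/

/-- The germ of a function which is smooth near `x`. -/
def smoothGerm (a : X → ℝ) (x : X) (ha : SmoothNear a x) : smoothGerms x :=
  ⟨(a : Germ (𝓝 x) ℝ), a, rfl, ha⟩

theorem smoothGerms_exists {x : X} (a : smoothGerms x) :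
    ∃ (f : X → ℝ) (hf : SmoothNear f x), a = smoothGerm f x hf := by
  obtain ⟨_, f, rfl, hf⟩ := a
  exact ⟨f, hf, rfl⟩

theorem interiorGerms_exists {x : X} (b : interiorGerms x) :
    ∃ (f : X → ℝ≥0) (hf : InteriorNear f x), b = interiorGerm f x hf := by
  obtain ⟨_, f, rfl, hf⟩ := b
  exact ⟨f, hf, rfl⟩

theorem smoothGerm_eq {x : X} {a a' : X → ℝ} {ha : SmoothNear a x} {ha' : SmoothNear a' x} :
    smoothGerm a x ha = smoothGerm a' x ha' ↔ a =ᶠ[𝓝 x] a' :=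
  Subtype.ext_iff.trans Germ.coe_eq

section Chart

variable {c : GChart (ManifoldWithGCorners.dim X) X} {x : X}

theorem tendsto_chart (hx : x ∈ c.φ.target) : Tendsto c.φ (𝓝 (c.φ.symm x)) (𝓝 x) := by
  have := c.φ.continuousAt (c.φ.map_target hx)
  rwa [ContinuousAt, c.φ.right_inv hx] at this

theorem tendsto_chart_symm (hx : x ∈ c.φ.target) :
    Tendsto c.φ.symm (𝓝 x) (𝓝 (c.φ.symm x)) :=
  c.φ.symm.continuousAt hx

theorem smoothNear_of_chart_id (hc : c ∈ gAtlas X) (hx : x ∈ c.φ.target)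
    {U : Set (ModelSpace c.P)} (hU : IsOpen U) (hxU : c.φ.symm x ∈ U)
    {a : X → ℝ} (ha : SmoothReal U fun u => a (c.φ u)) : SmoothNear a x :=
  smoothNear_of_chart isOpen_univ (isSmoothOn_id isOpen_univ) (mem_univ x) hc hx hU hxU ha

theorem interiorNear_of_chart_id (hc : c ∈ gAtlas X) (hx : x ∈ c.φ.target)
    {U : Set (ModelSpace c.P)} (hU : IsOpen U)
    (hxU : c.φ.symm x ∈ U) {b : X → ℝ≥0} (hb : SmoothNonneg U fun u => b (c.φ u))
    (hpos : ∀ u ∈ U, u ∈ modelInterior c.P → 0 < b (c.φ u)) : InteriorNear b x :=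
  interiorNear_of_chart isOpen_univ (isSmoothOn_id isOpen_univ)
    (localInverse_id isOpen_univ).interiorOn (mem_univ x) hc hx hU hxU hb hpos

/-- Smooth functions of a chart are smooth near the point. -/
theorem smoothNear_comp_symm (hc : c ∈ gAtlas X) (hx : x ∈ c.φ.target)
    {U : Set (ModelSpace c.P)} (hU : IsOpen U) (hxU : c.φ.symm x ∈ U)
    {a : ModelSpace c.P → ℝ} (ha : SmoothReal U a) : SmoothNear (fun y => a (c.φ.symm y)) x :=
  smoothNear_of_chart_id hc hx (hU.inter c.φ.open_source) ⟨hxU, c.φ.map_target hx⟩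
    ((ha.mono inter_subset_left).congr fun u hu => by rw [c.φ.left_inv hu.2])

theorem interiorNear_lam (hc : c ∈ gAtlas X) (hx : x ∈ c.φ.target) (p : c.P) :
    InteriorNear (fun y => lam p (c.φ.symm y)) x := by
  refine interiorNear_of_chart_id hc hx c.φ.open_source (c.φ.map_target hx) ?_ ?_
  · intro u hu
    refine ⟨c.φ.source, c.φ.open_source, hu, Subset.rfl, Or.inl ⟨p, fun _ => 1,
      smoothReal_const _ 1, fun v hv => ⟨one_pos, ?_⟩⟩⟩
    simp only [c.φ.left_inv hv, mul_one]
  · intro u hu hi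
    rw [c.φ.left_inv hu]; exact hi p

/-- The germ at `x` of the function `lam p` of a chart. -/
def lamGerm (hc : c ∈ gAtlas X) (hx : x ∈ c.φ.target) (p : c.P) : interiorGerms x :=
  interiorGerm _ x (interiorNear_lam hc hx p)

theorem lamGerm_zero (hc : c ∈ gAtlas X) (hx : x ∈ c.φ.target) : lamGerm hc hx (0 : c.P) = 1 :=
  Subtype.ext (Germ.coe_eq.2 (Eventually.of_forall fun _ => lam_zero _))

theorem lamGerm_add (hc : c ∈ gAtlas X) (hx : x ∈ c.φ.target) (p q : c.P) :
    lamGerm hc hx (p + q) = lamGerm hc hx p * lamGerm hc hx q :=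
  Subtype.ext (Germ.coe_eq.2 (Eventually.of_forall fun _ => lam_add _ _ _))

theorem evInterior_lamGerm (hc : c ∈ gAtlas X) (hx : x ∈ c.φ.target) (p : c.P) :
    evInterior (lamGerm hc hx p) = lam p (c.φ.symm x) := rfl

/-- The representation of a germ of an interior function as `lam p * h` in a chart. -/
def GermRep (b : interiorGerms x) (p : c.P) (h : ModelSpace c.P → ℝ) : Prop :=
  ∃ f : X → ℝ≥0, (f : Germ (𝓝 x) ℝ≥0) = b.1 ∧
    LocalRep (fun u => f (c.φ u)) (c.φ.symm x) p h

theorem germRep_exists (hc : c ∈ gAtlas X) (hx : x ∈ c.φ.target) (b : interiorGerms x) :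
    ∃ (p : c.P) (h : ModelSpace c.P → ℝ), GermRep b p h := by
  obtain ⟨_, f, rfl, hf⟩ := b
  obtain ⟨U, -, hxU, -, hs, hpos⟩ := hf c hc hx
  obtain ⟨p, h, H⟩ := c.weaklyToric.exists_localRep hs hpos hxU
  exact ⟨p, h, f, rfl, H⟩

theorem germRep_lamGerm (hc : c ∈ gAtlas X) (hx : x ∈ c.φ.target) (p : c.P) :
    GermRep (lamGerm hc hx p) p fun _ => 1 := by
  refine ⟨_, rfl, (localRep_lam p _).congr ?_⟩
  filter_upwards [c.φ.open_source.mem_nhds (c.φ.map_target hx)] with u hu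
  rw [c.φ.left_inv hu]

theorem GermRep.mul {b b' : interiorGerms x} {p p' : c.P} {h h' : ModelSpace c.P → ℝ}
    (H : GermRep b p h) (H' : GermRep b' p' h') :
    GermRep (b * b') (p + p') (fun y => h y * h' y) := by
  obtain ⟨f, hf, H⟩ := H
  obtain ⟨f', hf', H'⟩ := H'
  refine ⟨fun y => f y * f' y, ?_, H.mul H'⟩
  show ((f : Germ (𝓝 x) ℝ≥0) * (f' : Germ (𝓝 x) ℝ≥0)) = b.1 * b'.1
  rw [hf, hf']

theorem GermRep.exists_common (hx : x ∈ c.φ.target) {b : interiorGerms x} {p p' : c.P}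
    {h h' : ModelSpace c.P → ℝ} (H : GermRep b p h) (H' : GermRep b p' h') :
    ∃ f, LocalRep f (c.φ.symm x) p h ∧ LocalRep f (c.φ.symm x) p' h' := by
  obtain ⟨f, hf, H⟩ := H
  obtain ⟨f', hf', H'⟩ := H'
  exact ⟨_, H, H'.congr ((tendsto_chart hx).eventually (Germ.coe_eq.1 (hf.trans hf'.symm)))⟩

theorem GermRep.apply_eq (hx : x ∈ c.φ.target) {b : interiorGerms x} {p p' : c.P}
    {h h' : ModelSpace c.P → ℝ} (H : GermRep b p h) (H' : GermRep b p' h') {α : c.P →+ ℕ}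
    (hα : ∀ a ∈ supportFace (c.φ.symm x), α a = 0) : α p = α p' := by
  obtain ⟨f, H, H'⟩ := H.exists_common hx H'
  exact H.apply_eq c.weaklyToric H' hα

theorem GermRep.apply_add_dirDeriv_eq (hx : x ∈ c.φ.target) {b : interiorGerms x} {p p' : c.P}
    {h h' : ModelSpace c.P → ℝ} (H : GermRep b p h) (H' : GermRep b p' h') (w : c.P →+ ℝ) :
    w p + dirDeriv w (fun y => Real.log (h y)) (c.φ.symm x) =
      w p' + dirDeriv w (fun y => Real.log (h' y)) (c.φ.symm x) := by
  obtain ⟨f, H, H'⟩ := H.exists_common hx H'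
  exact H.apply_add_dirDeriv_eq c.weaklyToric H' w

theorem GermRep.evInterior_ne_zero (hx : x ∈ c.φ.target) {b : interiorGerms x} {p : c.P}
    {h : ModelSpace c.P → ℝ} (H : GermRep b p h) :
    evInterior b ≠ 0 ↔ p ∈ supportFace (c.φ.symm x) := by
  obtain ⟨f, hf, H⟩ := H
  rw [← H.ne_zero_iff, c.φ.right_inv hx, evInterior, ← hf]; rfl

/-- A positive smooth factor is the exponential of its logarithm. Hence elements of `M̃_x X` and
b-tangent vectors are determined on interior germs by the germs `lam p` and by smooth functions. -/
theorem GermRep.exists_eq_mul_exp (hc : c ∈ gAtlas X) (hx : x ∈ c.φ.target) {b : interiorGerms x}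
    {p : c.P} {h : ModelSpace c.P → ℝ} (H : GermRep b p h) :
    ∃ ha : SmoothNear (fun y => Real.log (h (c.φ.symm y))) x,
      b = lamGerm hc hx p * expGerm (smoothGerm _ x ha) := by
  obtain ⟨f, hf, U, hU, hxU, hh, H⟩ := H
  refine ⟨smoothNear_comp_symm hc hx hU hxU (hh.log fun y hy => (H y hy).1), Subtype.ext ?_⟩
  rw [← hf]
  refine Germ.coe_eq.2 ?_
  filter_upwards [(tendsto_chart_symm hx).eventually (hU.mem_nhds hxU),
    c.φ.open_target.mem_nhds hx] with y hy hyt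
  have := H _ hy
  simp only [c.φ.right_inv hyt] at this
  refine NNReal.coe_injective (this.2.trans ?_)
  show _ = (lam p (c.φ.symm y) : ℝ) * Real.toNNReal (Real.exp (Real.log (h (c.φ.symm y))))
  rw [Real.exp_log this.1, Real.coe_toNNReal _ this.1.le]

theorem evInterior_expGerm_pos (a : smoothGerms x) : 0 < evInterior (expGerm a) := by
  obtain ⟨_, f, rfl, hf⟩ := a
  exact Real.toNNReal_pos.2 (Real.exp_pos _)

/-! ### The monoid `M̃_x X` in a chart -/

/-- The morphism `P → ℕ` of an element of `M̃_x X` in a chart. -/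
def toFaceHom (hc : c ∈ gAtlas X) (hx : x ∈ c.φ.target) (α : tildeM x) : c.P →+ ℕ where
  toFun p := α.1 (Additive.ofMul (lamGerm hc hx p))
  map_zero' := by rw [lamGerm_zero, ofMul_one, map_zero]
  map_add' p q := by rw [lamGerm_add, ofMul_mul, map_add]

theorem toFaceHom_eq_zero (hc : c ∈ gAtlas X) (hx : x ∈ c.φ.target) (α : tildeM x) :
    ∀ a ∈ supportFace (c.φ.symm x), toFaceHom hc hx α a = 0 := fun _ ha =>
  α.2 _ (pos_of_mem_supportFace ha)

/-- The exponential factor is positive at `x` and so is killed by `α`; only the exponent `p` counts.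
-/
theorem GermRep.tildeM_apply (hc : c ∈ gAtlas X) (hx : x ∈ c.φ.target) {b : interiorGerms x}
    {p : c.P} {h : ModelSpace c.P → ℝ} (H : GermRep b p h) (α : tildeM x) :
    α.1 (Additive.ofMul b) = toFaceHom hc hx α p := by
  obtain ⟨ha, rfl⟩ := H.exists_eq_mul_exp hc hx
  rw [ofMul_mul, map_add, α.2 _ (evInterior_expGerm_pos _), add_zero]; rfl

theorem toFaceHom_injective (hc : c ∈ gAtlas X) (hx : x ∈ c.φ.target) :
    Function.Injective (toFaceHom hc hx) := by
  intro α α' e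
  refine Subtype.ext (AddMonoidHom.ext fun b => ?_)
  obtain ⟨p, h, H⟩ := germRep_exists hc hx b.toMul
  exact (H.tildeM_apply hc hx α).trans
    ((DFunLike.congr_fun e p).trans (H.tildeM_apply hc hx α').symm)

/-- Send a germ to `δ` of its exponent. The exponent is unique modulo the support face, which `δ`
kills, so the choice does not matter and the map is additive. -/
theorem exists_toFaceHom_eq (hc : c ∈ gAtlas X) (hx : x ∈ c.φ.target) {δ : c.P →+ ℕ}
    (hδ : ∀ a ∈ supportFace (c.φ.symm x), δ a = 0) : ∃ α, toFaceHom hc hx α = δ := by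
  choose p h H using germRep_exists (c := c) hc hx
  have hp : ∀ {b : interiorGerms x} {q : c.P} {k : ModelSpace c.P → ℝ}, GermRep b q k →
      δ (p b) = δ q := fun K => (H _).apply_eq hx K hδ
  refine ⟨⟨⟨⟨fun b => δ (p b.toMul), ?_⟩, fun b b' => ?_⟩, fun b hb => ?_⟩,
    AddMonoidHom.ext fun q => ?_⟩
  · show δ (p 1) = 0
    rw [← lamGerm_zero hc hx, hp (germRep_lamGerm hc hx 0), map_zero]
  · show δ (p (b.toMul * b'.toMul)) = _
    rw [hp ((H b.toMul).mul (H b'.toMul)), map_add]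
  · exact hδ _ ((H b).evInterior_ne_zero hx |>.1 hb.ne')
  · exact hp (germRep_lamGerm hc hx q)

/-! ### The b-tangent space in a chart -/

/-- The additive functional on `P` of a b-tangent vector in a chart. -/
def toFunctional (hc : c ∈ gAtlas X) (hx : x ∈ c.φ.target) : BTangent x →ₗ[ℝ] (c.P →+ ℝ) where
  toFun v :=
    { toFun := fun p => v.1.2 (Additive.ofMul (lamGerm hc hx p))
      map_zero' := by rw [lamGerm_zero, ofMul_one, map_zero]
      map_add' := fun p q => by rw [lamGerm_add, ofMul_mul, map_add] }
  map_add' _ _ := rfl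
  map_smul' _ _ := rfl

theorem toFunctional_apply (hc : c ∈ gAtlas X) (hx : x ∈ c.φ.target) (v : BTangent x) (p : c.P) :
    toFunctional hc hx v p = v.1.2 (Additive.ofMul (lamGerm hc hx p)) := rfl

theorem BTangent.const {v : BTangent x} (r : ℝ) :
    v.1.1 (smoothGerm (fun _ => r) x (smoothNear_const x r)) = 0 := by
  have h1 : v.1.1 (smoothGerm (fun _ => 1) x (smoothNear_const x 1)) = 0 := by
    have := v.2.1 (smoothGerm (fun _ => 1) x (smoothNear_const x 1))
      (smoothGerm (fun _ => 1) x (smoothNear_const x 1))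
    have e : smoothMul (smoothGerm (fun _ => 1) x (smoothNear_const x 1))
      (smoothGerm (fun _ => 1) x (smoothNear_const x 1)) =
        smoothGerm (fun _ => 1) x (smoothNear_const x 1) :=
      Subtype.ext (Germ.coe_eq.2 (Eventually.of_forall fun _ => mul_one 1))
    have e1 : evSmooth (smoothGerm (fun _ => 1) x (smoothNear_const x 1)) = 1 := rfl
    rw [e, e1] at this
    linarith
  have e : smoothGerm (fun _ => r) x (smoothNear_const x r) =
      r • smoothGerm (fun _ => 1) x (smoothNear_const x 1) :=
    Subtype.ext (Germ.coe_eq.2 (Eventually.of_forall fun _ => (mul_one r).symm))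
  rw [e, map_smul, h1, smul_zero]

/-- A b-tangent vector acts on smooth functions as a directional derivative. -/
theorem BTangent.apply_smoothGerm (hc : c ∈ gAtlas X) (hx : x ∈ c.φ.target) (v : BTangent x)
    {a : X → ℝ} (ha : SmoothNear a x) : v.1.1 (smoothGerm a x ha) =
      dirDeriv (toFunctional hc hx v) (fun u => a (c.φ u)) (c.φ.symm x) := by
  obtain ⟨U, hU, hxU, hUs, n, r, W, g, hW, hg, H⟩ := ha c hc hx
  set x₀ := c.φ.symm x with hx₀
  obtain ⟨hz₀, -⟩ := H x₀ hxU
  set z₀ : Fin n → ℝ := fun i => lam (r i) x₀ with hz₀d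
  -- Hadamard gives `a = a(x) + Σ (λ_{r_i} - z_i) G_i`. A derivation kills the constant and sees
  -- only `G_i(z₀)` times its value on `λ_{r_i}`, which the inclusion axiom gives as `λ_{r_i}(x)
  -- w(r_i)`.
  obtain ⟨G, hG, hG₀, hGe⟩ := exists_hadamard hW hg hz₀
  have hlamc : Continuous fun u : ModelSpace c.P => fun i => (lam (r i) u : ℝ) :=
    continuous_pi fun i => continuous_lam_real (r i)
  have hA : ∀ i, SmoothNear (fun y => (lam (r i) (c.φ.symm y) : ℝ) - z₀ i) x := fun i =>
    smoothNear_comp_symm hc hx isOpen_univ (mem_univ _)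
      ((smoothReal_lam univ (r i)).comp₁ (contDiff_id.sub contDiff_const))
  have hB : ∀ i, SmoothNear (fun y => G i fun j => (lam (r j) (c.φ.symm y) : ℝ)) x := fun i =>
    smoothNear_comp_symm hc hx isOpen_univ (mem_univ _)
      ⟨n, r, univ, G i, isOpen_univ, (hG i).contDiffOn, fun u _ => ⟨mem_univ _, rfl⟩⟩
  have hdecomp : smoothGerm a x ha = smoothGerm (fun _ => g z₀) x (smoothNear_const x _) +
      ∑ i, smoothMul (smoothGerm _ x (hA i)) (smoothGerm _ x (hB i)) := by
    have hsum : ∀ s : Finset (Fin n),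
        (∑ i ∈ s, smoothMul (smoothGerm _ x (hA i)) (smoothGerm _ x (hB i)) : smoothGerms x).1 =
        ((fun y => ∑ i ∈ s, ((lam (r i) (c.φ.symm y) : ℝ) - z₀ i) *
          G i fun j => (lam (r j) (c.φ.symm y) : ℝ) : X → ℝ) : Germ (𝓝 x) ℝ) := by
      classical
      intro s
      induction s using Finset.induction_on with
      | empty => simp only [Finset.sum_empty]; rfl
      | insert i s hi ih =>
        rw [Finset.sum_insert hi, Submodule.coe_add, ih]
        simp only [Finset.sum_insert hi]
        rfl
    refine Subtype.ext ?_
    rw [Submodule.coe_add, hsum]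
    refine Germ.coe_eq.2 ?_
    have ht : Tendsto (fun y => fun i => (lam (r i) (c.φ.symm y) : ℝ)) (𝓝 x) (𝓝 z₀) :=
      (hlamc.tendsto x₀).comp (tendsto_chart_symm hx)
    filter_upwards [ht.eventually hGe, (tendsto_chart_symm hx).eventually (hU.mem_nhds hxU),
      c.φ.open_target.mem_nhds hx] with y h1 h2 h3
    have h4 := (H _ h2).2
    simp only [c.φ.right_inv h3] at h4
    rw [h4, h1]
  have hvA : ∀ i, v.1.1 (smoothGerm _ x (hA i)) = z₀ i * toFunctional hc hx v (r i) := by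
    intro i
    have e : smoothGerm _ x (hA i) = incGerm (lamGerm hc hx (r i)) -
        smoothGerm (fun _ => z₀ i) x (smoothNear_const x _) := rfl
    rw [e, map_sub, BTangent.const, sub_zero, v.2.2.2, evInterior_lamGerm, toFunctional_apply]
  have hevA : ∀ i, evSmooth (smoothGerm _ x (hA i)) = 0 := fun i => sub_self (z₀ i)
  have hevB : ∀ i, evSmooth (smoothGerm _ x (hB i)) = G i z₀ := fun i => rfl
  rw [hdecomp, map_add, BTangent.const, zero_add, map_sum]
  rw [dirDeriv, (hasDerivAt_of_eq_comp hW hg hz₀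
    (mem_of_superset (hU.mem_nhds hxU) fun y hy => (H y hy).2) _).deriv]
  conv_rhs => rw [pi_eq_sum_univ' (fun i => (lam (r i) x₀ : ℝ) * toFunctional hc hx v (r i))]
  rw [map_sum]
  refine Finset.sum_congr rfl fun i _ => ?_
  rw [v.2.1, hevA, hevB, hvA, map_smul, hG₀, zero_mul, add_zero]; rfl

theorem GermRep.bTangent_apply (hc : c ∈ gAtlas X) (hx : x ∈ c.φ.target) {b : interiorGerms x}
    {p : c.P} {h : ModelSpace c.P → ℝ} (H : GermRep b p h) (v : BTangent x) :
    v.1.2 (Additive.ofMul b) = toFunctional hc hx v p +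
      dirDeriv (toFunctional hc hx v) (fun y => Real.log (h y)) (c.φ.symm x) := by
  obtain ⟨ha, rfl⟩ := H.exists_eq_mul_exp hc hx
  rw [ofMul_mul, map_add, v.2.2.1, BTangent.apply_smoothGerm hc hx]
  congr 1
  refine dirDeriv_congr ?_
  filter_upwards [c.φ.open_source.mem_nhds (c.φ.map_target hx)] with u hu
  rw [c.φ.left_inv hu]

theorem toFunctional_injective (hc : c ∈ gAtlas X) (hx : x ∈ c.φ.target) :
    Function.Injective (toFunctional hc hx) := by
  intro v v' e
  refine Subtype.ext (Prod.ext (LinearMap.ext fun a => ?_) (AddMonoidHom.ext fun b => ?_))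
  · obtain ⟨f, hf, rfl⟩ := smoothGerms_exists a
    rw [BTangent.apply_smoothGerm hc hx, BTangent.apply_smoothGerm hc hx, e]
  · obtain ⟨p, h, H⟩ := germRep_exists hc hx b.toMul
    have h1 := H.bTangent_apply hc hx v
    rw [e, ← H.bTangent_apply hc hx v'] at h1
    exact h1

/-- Given `w`, put `v(a) = ∂_w a` and `v'(b) = w(p) + ∂_w log h` for `b = λ_p h`. Independence of
the chosen representation, from `GermRep.apply_add_dirDeriv_eq`, gives both well-definedness and
additivity. -/
theorem toFunctional_surjective (hc : c ∈ gAtlas X) (hx : x ∈ c.φ.target) :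
    Function.Surjective (toFunctional hc hx) := by
  intro w
  choose p h H using germRep_exists (c := c) hc hx
  choose f hf hfa using smoothGerms_exists (x := x)
  have hv : ∀ {a : X → ℝ} (ha : SmoothNear a x),
      dirDeriv w (fun u => f (smoothGerm a x ha) (c.φ u)) (c.φ.symm x) =
        dirDeriv w (fun u => a (c.φ u)) (c.φ.symm x) := fun ha =>
    dirDeriv_congr ((tendsto_chart hx).eventually (smoothGerm_eq.1 (hfa (smoothGerm _ x ha)).symm))
  have hp : ∀ {b : interiorGerms x} {q : c.P} {k : ModelSpace c.P → ℝ}, GermRep b q k →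
      w (p b) + dirDeriv w (fun y => Real.log (h b y)) (c.φ.symm x) =
      w q + dirDeriv w (fun y => Real.log (k y)) (c.φ.symm x) := fun K =>
    (H _).apply_add_dirDeriv_eq hx K w
  have hsm : ∀ {a : X → ℝ}, SmoothNear a x → ∃ U : Set (ModelSpace c.P), IsOpen U ∧
      c.φ.symm x ∈ U ∧ SmoothReal U fun u => a (c.φ u) := fun ha => by
    obtain ⟨U, hU, hxU, -, h⟩ := ha c hc hx
    exact ⟨U, hU, hxU, h⟩
  have hlog1 : dirDeriv w (fun _ => Real.log 1) (c.φ.symm x) = 0 := by simp [dirDeriv]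
  let v₁ : smoothGerms x →ₗ[ℝ] ℝ :=
    { toFun := fun a => dirDeriv w (fun u => f a (c.φ u)) (c.φ.symm x)
      map_add' := fun a b => by
        obtain ⟨a, ha, rfl⟩ := smoothGerms_exists a
        obtain ⟨b, hb, rfl⟩ := smoothGerms_exists b
        have e : smoothGerm a x ha + smoothGerm b x hb =
          smoothGerm (fun y => a y + b y) x (ha.comp₂ hb contDiff_add) := rfl
        rw [e, hv, hv, hv]
        obtain ⟨U, hU, hxU, hs⟩ := hsm ha
        obtain ⟨U', hU', hxU', hs'⟩ := hsm hb
        exact dirDeriv_add (hU.inter hU') (hs.mono inter_subset_left)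
          (hs'.mono inter_subset_right) ⟨hxU, hxU'⟩ w
      map_smul' := fun s a => by
        obtain ⟨a, ha, rfl⟩ := smoothGerms_exists a
        have e : s • smoothGerm a x ha =
          smoothGerm (fun y => s * a y) x ((smoothNear_const x s).comp₂ ha contDiff_mul) := rfl
        rw [e, hv, hv]
        obtain ⟨U, hU, hxU, hs⟩ := hsm ha
        have := dirDeriv_mul hU (smoothReal_const U s) hs hxU w
        rw [this]
        simp [dirDeriv] }
  have hv₁ : ∀ {a : X → ℝ} (ha : SmoothNear a x), v₁ (smoothGerm a x ha) =
      dirDeriv w (fun u => a (c.φ u)) (c.φ.symm x) := fun ha => hv ha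
  let v₂ : Additive (interiorGerms x) →+ ℝ :=
    { toFun := fun b => w (p b.toMul) +
        dirDeriv w (fun y => Real.log (h b.toMul y)) (c.φ.symm x)
      map_zero' := by
        have := hp (germRep_lamGerm hc hx 0)
        rw [lamGerm_zero, map_zero, hlog1, add_zero] at this
        exact this
      map_add' := fun b b' => by
        refine (hp ((H b.toMul).mul (H b'.toMul))).trans ?_
        obtain ⟨_, -, U, hU, hxU, hh, K⟩ := H b.toMul
        obtain ⟨_, -, U', hU', hxU', hh', K'⟩ := H b'.toMul
        have := dirDeriv_add (hU.inter hU')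
          ((hh.log fun y hy => (K y hy).1).mono inter_subset_left)
          ((hh'.log fun y hy => (K' y hy).1).mono inter_subset_right) ⟨hxU, hxU'⟩ w
        have e : dirDeriv w (fun y => Real.log (h b.toMul y * h b'.toMul y)) (c.φ.symm x) =
            dirDeriv w (fun y => Real.log (h b.toMul y) + Real.log (h b'.toMul y))
              (c.φ.symm x) := by
          refine dirDeriv_congr ?_
          filter_upwards [(hU.inter hU').mem_nhds ⟨hxU, hxU'⟩] with y hy
          exact Real.log_mul (K y hy.1).1.ne' (K' y hy.2).1.ne'
        rw [e, this, map_add]; ring }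
  have hv₂ : ∀ {b : interiorGerms x} {q : c.P} {k : ModelSpace c.P → ℝ}, GermRep b q k →
      v₂ (Additive.ofMul b) = w q + dirDeriv w (fun y => Real.log (k y)) (c.φ.symm x) :=
    fun K => hp K
  refine ⟨⟨(v₁, v₂), fun a b => ?_, fun a => ?_, fun b => ?_⟩, AddMonoidHom.ext fun q => ?_⟩
  · obtain ⟨a, ha, rfl⟩ := smoothGerms_exists a
    obtain ⟨b, hb, rfl⟩ := smoothGerms_exists b
    have e : smoothMul (smoothGerm a x ha) (smoothGerm b x hb) =
      smoothGerm (fun y => a y * b y) x (ha.comp₂ hb contDiff_mul) := rfl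
    simp only
    rw [e, hv₁, hv₁, hv₁]
    obtain ⟨U, hU, hxU, hs⟩ := hsm ha
    obtain ⟨U', hU', hxU', hs'⟩ := hsm hb
    have := dirDeriv_mul (hU.inter hU') (hs.mono inter_subset_left)
      (hs'.mono inter_subset_right) ⟨hxU, hxU'⟩ w
    rw [this, c.φ.right_inv hx]; rfl
  · obtain ⟨a, ha, rfl⟩ := smoothGerms_exists a
    obtain ⟨U, hU, hxU, hs⟩ := hsm ha
    have K : GermRep (expGerm (smoothGerm a x ha)) (0 : c.P) fun u => Real.exp (a (c.φ u)) :=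
      ⟨_, rfl, U, hU, hxU, hs.exp, fun y _ => ⟨Real.exp_pos _, by
        rw [lam_zero, NNReal.coe_one, one_mul]; exact Real.coe_toNNReal _ (Real.exp_pos _).le⟩⟩
    simp only
    rw [hv₂ K, hv₁, map_zero, zero_add]
    simp only [Real.log_exp]
  · obtain ⟨b, hb, rfl⟩ := interiorGerms_exists b
    have e : incGerm (interiorGerm b x hb) = smoothGerm _ x hb.toReal := rfl
    simp only
    have K := H (interiorGerm b x hb)
    obtain ⟨b', hb', U, hU, hxU, hs, K'⟩ := K
    have hbb : (fun u => (b (c.φ u) : ℝ)) =ᶠ[𝓝 (c.φ.symm x)]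
        fun u => lam (p (interiorGerm b x hb)) u * h (interiorGerm b x hb) u := by
      filter_upwards [(tendsto_chart hx).eventually (Germ.coe_eq.1 hb'), hU.mem_nhds hxU]
        with u hu hu'
      rw [← hu]; exact (K' u hu').2
    have hpos := (K' _ hxU).1
    have hev : (evInterior (interiorGerm b x hb) : ℝ) =
        lam (p (interiorGerm b x hb)) (c.φ.symm x) * h (interiorGerm b x hb) (c.φ.symm x) := by
      have := hbb.self_of_nhds
      simp only [c.φ.right_inv hx] at this
      exact this
    -- Leibniz for `b = λ_p h`: `∂_w b = λ_p w(p) h + λ_p ∂_w h = b (w(p) + ∂_w log h)`.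
    rw [e, hv₁, hv₂ (H _), hev, dirDeriv_congr hbb,
      dirDeriv_mul hU (smoothReal_lam U _) hs hxU w, dirDeriv_lam,
      dirDeriv_log hU hs hxU hpos]
    field_simp
  · have := hv₂ (germRep_lamGerm hc hx q)
    rw [hlog1, add_zero] at this
    exact this

/-- The b-tangent space is isomorphic to the space of additive functionals on the monoid of a
chart. -/
noncomputable def bTangentEquiv (hc : c ∈ gAtlas X) (hx : x ∈ c.φ.target) :
    BTangent x ≃ₗ[ℝ] (c.P →+ ℝ) :=
  LinearEquiv.ofBijective (toFunctional hc hx)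
    ⟨toFunctional_injective hc hx, toFunctional_surjective hc hx⟩

end Chart

end Germs

/-! ### The inverse function theorem on manifolds with g-corners -/

section Converse

variable {X : Type*} [TopologicalSpace X] [ManifoldWithGCorners X]
  {Y : Type*} [TopologicalSpace Y] [ManifoldWithGCorners Y]

theorem LocalInverse.of_chart {f : X → Y} (hf : IsSmooth f)
    {c : GChart (ManifoldWithGCorners.dim X) X} (hc : c ∈ gAtlas X)
    {d : GChart (ManifoldWithGCorners.dim Y) Y} (hd : d ∈ gAtlas Y)
    {U : Set (ModelSpace c.P)} (hU : IsOpen U) (hUs : ∀ u ∈ U, u ∈ c.φ.source ∧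
      f (c.φ u) ∈ d.φ.target) {V : Set (ModelSpace d.P)} (hV : IsOpen V)
    {G : ModelSpace d.P → ModelSpace c.P} (hG : SmoothMap V G)
    (hl : ∀ u ∈ U, d.φ.symm (f (c.φ u)) ∈ V ∧ G (d.φ.symm (f (c.φ u))) = u)
    (hr : ∀ y ∈ V, G y ∈ U ∧ d.φ.symm (f (c.φ (G y))) = y) :
    LocalInverse f (c.φ '' U) (fun y => c.φ (G (d.φ.symm y))) (d.φ '' V) := by
  have hVs : V ⊆ d.φ.source := fun y hy => by
    rw [← (hr y hy).2]
    exact d.φ.map_target (hUs _ (hr y hy).1).2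
  have hUo := c.φ.isOpen_image_of_subset_source hU fun u hu => (hUs u hu).1
  refine ⟨hUo, d.φ.isOpen_image_of_subset_source hV hVs, hf.mono hUo (subset_univ _),
    isSmoothOn_of_chart hd hc hV hVs hG fun y hy => (hUs _ (hr y hy).1).1, ?_, ?_, ?_, ?_⟩
  · rintro _ ⟨u, hu, rfl⟩
    exact ⟨_, (hl u hu).1, d.φ.right_inv (hUs u hu).2⟩
  · rintro _ ⟨y, hy, rfl⟩
    exact ⟨G y, (hr y hy).1, by simp only [d.φ.left_inv (hVs hy)]⟩
  · rintro _ ⟨u, hu, rfl⟩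
    simp only [(hl u hu).2]
  · rintro _ ⟨y, hy, rfl⟩
    simp only [d.φ.left_inv (hVs hy)]
    conv_rhs => rw [← (hr y hy).2]
    rw [d.φ.right_inv (hUs _ (hr y hy).1).2]

/-- The inverse function theorem for manifolds with g-corners. -/
theorem exists_localInverse {f : X → Y} (hf : IsInterior f) {x : X}
    (hM : Function.Bijective (tildeMMap f hf x)) (hB : Function.Bijective (bDiff f hf x)) :
    ∃ U g V, x ∈ U ∧ LocalInverse f U g V := by
  obtain ⟨c, hc, hx⟩ := ManifoldWithGCorners.covers x
  obtain ⟨d, hd, hfx⟩ := ManifoldWithGCorners.covers (f x)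
  have hU := isOpen_chart_domain' isOpen_univ hf.1.1 c d
  have hFs := hf.1.2 c hc d hd
  set U := c.φ.source ∩ c.φ ⁻¹' (univ ∩ f ⁻¹' d.φ.target) with hUd
  set F : ModelSpace c.P → ModelSpace d.P := fun u => d.φ.symm (f (c.φ u)) with hF
  have hFx : F (c.φ.symm x) = d.φ.symm (f x) := by simp only [hF, c.φ.right_inv hx]
  have hx₀ : c.φ.symm x ∈ U := ⟨c.φ.map_target hx, mem_univ _, by
    rw [mem_preimage, c.φ.right_inv hx]; exact hfx⟩
  have hFi : ∀ u ∈ U, u ∈ modelInterior c.P → F u ∈ modelInterior d.P :=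
    fun u hu => hf.2 c hc d hd u ⟨hu.1, hu.2.2⟩
  -- A mere choice of exponents, not yet additive in `q`.
  choose θ h hrep using fun q : d.P => c.weaklyToric.exists_localRep (hFs q)
    (fun u hu hi => hFi u hu hi q) hx₀
  have hgr : ∀ q, GermRep (pullInterior f hf x (lamGerm hd hfx q)) (θ q) (h q) :=
    fun q => ⟨fun y => lam q (d.φ.symm (f y)), rfl, hrep q⟩
  have hθ : ∀ (α : tildeM x) q,
      toFaceHom hd hfx (tildeMMap f hf x α) q = toFaceHom hc hx α (θ q) :=
    fun α q => (hgr q).tildeM_apply hc hx α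
  -- The b-differential read in the identifications of b-tangent spaces with `Hom(P, ℝ)` and `Hom(Q,
  -- ℝ)`.
  let B : (c.P →+ ℝ) →ₗ[ℝ] (d.P →+ ℝ) := (bTangentEquiv hd hfx).toLinearMap ∘ₗ
    bDiff f hf x ∘ₗ (bTangentEquiv hc hx).symm.toLinearMap
  have hBq : ∀ w q, B w q = w (θ q) + dirDeriv w (fun y => Real.log (h q y)) (c.φ.symm x) := by
    intro w q
    obtain ⟨v, rfl⟩ := (bTangentEquiv hc hx).surjective w
    have e : B (bTangentEquiv hc hx v) = toFunctional hd hfx (bDiff f hf x v) := by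
      simp only [B, LinearMap.comp_apply, LinearEquiv.coe_coe, LinearEquiv.symm_apply_apply]
      rfl
    rw [e]
    exact (hgr q).bTangent_apply hc hx v
  have hinj : ∀ α α' : c.P →+ ℕ, (∀ a ∈ supportFace (c.φ.symm x), α a = 0) →
      (∀ a ∈ supportFace (c.φ.symm x), α' a = 0) → (∀ q, α (θ q) = α' (θ q)) → α = α' := by
    intro α α' hα hα' e
    obtain ⟨α, rfl⟩ := exists_toFaceHom_eq hc hx hα
    obtain ⟨α', rfl⟩ := exists_toFaceHom_eq hc hx hα'
    have : α = α' := hM.1 (toFaceHom_injective hd hfx (AddMonoidHom.ext fun q => by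
      rw [hθ, hθ, e]))
    rw [this]
  have hsurj : ∀ β : d.P →+ ℕ, (∀ e ∈ supportFace (F (c.φ.symm x)), β e = 0) →
      ∃ α : c.P →+ ℕ, (∀ a ∈ supportFace (c.φ.symm x), α a = 0) ∧ ∀ q, α (θ q) = β q := by
    intro β hβ
    rw [hFx] at hβ
    obtain ⟨β, rfl⟩ := exists_toFaceHom_eq hd hfx hβ
    obtain ⟨α, rfl⟩ := hM.2 β
    exact ⟨toFaceHom hc hx α, toFaceHom_eq_zero hc hx α, fun q => (hθ α q).symm⟩
  obtain ⟨U', V, G, hU', hxU', hU'U, hV, hG, hl, hr⟩ := exists_local_inverse c.weaklyToric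
    d.weaklyToric hU hFs.continuousOn hFi hx₀ hrep hinj hsurj B
    ((bTangentEquiv hd hfx).bijective.comp (hB.comp (bTangentEquiv hc hx).symm.bijective)) hBq
  exact ⟨c.φ '' U', _, _, ⟨_, hxU', c.φ.right_inv hx⟩, LocalInverse.of_chart hf.1 hc hd hU'
    (fun u hu => ⟨(hU'U hu).1, (hU'U hu).2.2⟩) hV hG hl hr⟩

/-- Simplicity supplies the morphisms `θ` and `κ`, the fibrewise bijectivity the invertible
derivative, at each point separately. -/
theorem IsSimple.isEtale {f : X → Y} (hf : IsSimple f)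
    (hB : ∀ x, Function.Bijective (bDiff f hf.isInterior x)) : IsEtale f := by
  refine ⟨hf.isInterior.1, fun x => ?_⟩
  obtain ⟨U, g, V, hx, h⟩ := exists_localInverse hf.isInterior (hf.2 x) (hB x)
  exact ⟨U, V, h.isOpen_source, hx, h.isOpen_target, h.map x hx, h.isDiffeomorphismOn⟩

end Converse

end GCorners

/-- A smooth map of manifolds with g-corners is étale if and only if it is simple and its
b-differential is an isomorphism of vector bundles; an étale map is a diffeomorphism if and only if
it is a bijection. -/
theorem corollary4p14
    {X : Type*} [TopologicalSpace X] [GCorners.ManifoldWithGCorners X]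
    {Y : Type*} [TopologicalSpace Y] [GCorners.ManifoldWithGCorners Y]
    (f : X → Y) (hf : GCorners.IsSmooth f) :
    (GCorners.IsEtale f ↔
      ∃ hs : GCorners.IsSimple f, GCorners.IsBDiffIso f hs.isInterior) ∧
    (GCorners.IsEtale f → (GCorners.IsDiffeomorphism f ↔ Function.Bijective f)) :=
  ⟨⟨fun h => ⟨h.isSimple, h.isBDiffIso⟩, fun ⟨hs, hB⟩ => hs.isEtale hB.1⟩,
    fun h => h.isDiffeomorphism_iff⟩
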